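/- Throughout, $K$ is a field, algebras are associative unital $K$-algebras, and $\otimes=\otimes_K$. **Weak bialgebras.** A weak bialgebra is an algebra $B$ with a coalgebra structure $(\Delta,\varepsilon)$ such that, for all $a,b,c\in B$, $\Delta(ab)=\Delta(a)\Delta(b)$, $(\Delta(1)\otimes1)(1\otimes\Delta(1))=1_{(1)}\otimes1_{(2)}\otimes1_{(3)}=(1\otimes\Delta(1))(\Delta(1)\otimes1)$ and $\varepsilon(ab_{(1)})\varepsilon(b_{(2)}c)=\varepsilon(abc)=\varepsilon(ab_{(2)})\varepsilon(b_{(1)}c)$. Put $\varepsilon_s(a)=1_{(1)}\varepsilon(a1_{(2)})$ and $\varepsilon_t(a)=\varepsilon(1_{(1)}a)1_{(2)}$. It is a weak Hopf algebra if there is a linear $S:B\to B$ with $S(h_{(1)})h_{(2)}=\varepsilon_s(h)$, $h_{(1)}S(h_{(2)})=\varepsilon_t(h)$, $S(h_{(1)})h_{(2)}S(h_{(3)})=S(h)$. A weak bialgebra homomorphism is a map that is both an algebra and a coalgebra homomorphism. For an algebra $A$ and linear $f,g:B\to A$ let $(f\star g)(b)=f(b_{(1)})g(b_{(2)})$. An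 antipode of an algebra map $f^+:B\to A$ is a linear map $f^-:B\to A$ with $f^+\star f^-=f^+\circ\varepsilon_t$, $f^-\star f^+=f^+\circ\varepsilon_s$, $f^+\star f^-\star f^+=f^+$ and $f^-\star f^+\star f^-=f^-$. **Data.** Let $R$ be an algebra with an idempotent Frobenius system: a linear map $\psi:R\to K$ and an element $e^{(1)}\otimes e^{(2)}\in R\otimes R$ with $\psi(re^{(1)})e^{(2)}=r=e^{(1)}\psi(e^{(2)}r)$ for all $r$ and $e^{(1)}e^{(2)}=1$. Let $\Lambda$ be a non-empty finite set, $X$ a finite set, and $M=M_\Lambda(R)$ the algebra of maps $\Lambda\to R$. Let $\deg$ assign to each $a\in X$ a permutation of $\Lambda$, written on the right, $\lambda\mapsto\lambda\deg(a)$, and put $T_{\deg(a)}(f)(\lambda)=f(\lambda\deg(a))$ for $f\in M$. Let $\sigma^{ab}_{cd}\in M$ $(a,b,c,d\in X)$ have values in the centre of $R$ and satisfy $\sigma^{bd}_{ac}(\lambda)=0$ whenever $\lambda\deg(d)\deg(b)\neq\lambda\deg(c)\deg(a)$. Let $\delta_\lambda\in M$ be the indicator of $\lambda$ and $r_M\in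 M$ the constant map with value $r$. **The algebra $A_\sigma$.** It is generated by $M\otimes M^{op}$ (as a unital subalgebra image) and symbols $L_{ab},(L^{-1})_{ab}$ $(a,b\in X)$ with the relations $\sum_cL_{ac}(L^{-1})_{cb}=\delta_{ab}=\sum_c(L^{-1})_{ac}L_{cb}$, $(T_{\deg(a)}(f)\otimes1)L_{ab}=L_{ab}(f\otimes1)$, $(1\otimes T_{\deg(b)}(f))L_{ab}=L_{ab}(1\otimes f)$, $(f\otimes1)(L^{-1})_{ab}=(L^{-1})_{ab}(T_{\deg(b)}(f)\otimes1)$, $(1\otimes f)(L^{-1})_{ab}=(L^{-1})_{ab}(1\otimes T_{\deg(a)}(f))$ and $\sum_{x,y}(\sigma^{xy}_{ac}\otimes1)L_{yd}L_{xb}=\sum_{x,y}(1\otimes\sigma^{bd}_{xy})L_{cy}L_{ax}$. Put $s(f)=f\otimes1$, $t(f)=1\otimes f$. Regard $A_\sigma$ as an $M$-bimodule by $f\cdot a\cdot g=s(f)t(g)a$. The map $\Delta_M:A_\sigma\to A_\sigma\otimes_MA_\sigma$ is induced by the multiplicative assignment $f\otimes g\mapsto s(f)\otimes t(g)$, $L_{ab}\mapsto\sum_cL_{ac}\otimes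 L_{cb}$, $(L^{-1})_{ab}\mapsto\sum_c(L^{-1})_{cb}\otimes(L^{-1})_{ac}$, and $\pi(a)=\chi(a)(1)$, where $\chi:A_\sigma\to\mathrm{End}_K(M)$ is the algebra map with $\chi(f\otimes g)(h)=fhg$, $\chi(L_{ab})=\delta_{ab}T_{\deg(a)}$, $\chi((L^{-1})_{ab})=\delta_{ab}T_{\deg(a)}^{-1}$. The family $\sigma$ is *rigid* if there are $x_{ab},y_{ab}\in A_\sigma$ $(a,b\in X)$ with $\sum_c(L^{-1})_{cb}x_{ac}=\sum_cx_{cb}(L^{-1})_{ac}=\sum_cL_{cb}y_{ac}=\sum_cy_{cb}L_{ac}=\delta_{ab}1$ for all $a,b$. **The algebra $\mathfrak A(w_\sigma)$.** Let $Q=\Lambda\times X$ be the quiver over $\Lambda$ with source $\mathfrak s(\lambda,x)=\lambda$ and target $\mathfrak t(\lambda,x)=\lambda\deg(x)$, and $Q^{(m)}$ its set of paths of length $m$ ($Q^{(0)}=\Lambda$). Let $\mathfrak G(Q)$ be the algebra with basis $\mathbf e\genfrac[]{0pt}{}{p}{q}$ $(p,q\in Q^{(m)},\,m\ge0)$, product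 $\mathbf e\genfrac[]{0pt}{}{p}{q}\mathbf e\genfrac[]{0pt}{}{p'}{q'}=\delta_{\mathfrak t(p),\mathfrak s(p')}\delta_{\mathfrak t(q),\mathfrak s(q')}\mathbf e\genfrac[]{0pt}{}{pp'}{qq'}$ and unit $\sum_{\lambda,\mu\in\Lambda}\mathbf e\genfrac[]{0pt}{}{\lambda}{\mu}$. For composable pairs put $w\big((\lambda,a),(\lambda',b)\,\big|\,(\mu,c),(\mu',d)\big)=\delta_{\lambda,\mu}\,\sigma^{ba}_{dc}(\lambda)$. Then $\mathfrak A(w_\sigma)$ is the quotient of $R\otimes R^{op}\otimes\mathfrak G(Q)$ by the two-sided ideal generated by $$\sum_{(x,y)\in Q^{(2)}}w(x,y|a,b)\otimes1\otimes\mathbf e\genfrac[]{0pt}{}{x}{c}\mathbf e\genfrac[]{0pt}{}{y}{d}-\sum_{(x,y)\in Q^{(2)}}1\otimes w(c,d|x,y)\otimes\mathbf e\genfrac[]{0pt}{}{a}{x}\mathbf e\genfrac[]{0pt}{}{b}{y}\qquad((a,b),(c,d)\in Q^{(2)}).$$ Put $s(f)=\sum_{\lambda,\mu}f(\lambda)\otimes1\otimes\mathbf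 e\genfrac[]{0pt}{}{\lambda}{\mu}$ and $t(f)=\sum_{\lambda,\mu}1\otimes f(\lambda)\otimes\mathbf e\genfrac[]{0pt}{}{\mu}{\lambda}$, with the bimodule structure as before. The map $\Delta_M:\mathfrak A(w_\sigma)\to\mathfrak A(w_\sigma)\otimes_M\mathfrak A(w_\sigma)$ is induced by $r\otimes r'\otimes\mathbf e\genfrac[]{0pt}{}{p}{q}\mapsto\sum_{u\in Q^{(m)}}(r\otimes1\otimes\mathbf e\genfrac[]{0pt}{}{p}{u})\otimes(1\otimes r'\otimes\mathbf e\genfrac[]{0pt}{}{u}{q})$, and $\pi:\mathfrak A(w_\sigma)\to M$ by $r\otimes r'\otimes\mathbf e\genfrac[]{0pt}{}{p}{q}\mapsto\delta_{p,q}(rr')_M\delta_{\mathfrak s(q)}$. Both $A_\sigma$ and $\mathfrak A(w_\sigma)$ carry $\Delta(a)=\sum_{\lambda\in\Lambda}t(e^{(1)}_M\delta_\lambda)a_{[1]}\otimes s(e^{(2)}_M\delta_\lambda)a_{[2]}$, where $\Delta_M(a)=a_{[1]}\otimes a_{[2]}$, and $\varepsilon(a)=\sum_{\lambda\in\Lambda}\psi(\pi(a)(\lambda))$.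 Finally, $\Phi:\mathfrak A(w_\sigma)\to A_\sigma$ is the algebra map $$r\otimes r'\otimes\mathbf e\genfrac[]{0pt}{}{p}{q}\mapsto(r_M\otimes r'_M)(\delta_{\mathfrak s(p)}\otimes\delta_{\mathfrak s(q)})L_{x_1y_1}\cdots L_{x_my_m}$$ for $p=((\lambda_1,x_1),\dots,(\lambda_m,x_m))$ and $q=((\mu_1,y_1),\dots,(\mu_m,y_m))$. **Theorem.** Suppose that $\sigma$ is rigid. Then $(\mathfrak A(w_\sigma),\Delta,\varepsilon)$ is a weak bialgebra, $(A_\sigma,\Delta,\varepsilon)$ is a weak Hopf algebra, $\Phi$ is a weak bialgebra homomorphism, and the pair $(A_\sigma,\Phi)$ has the following universal property. For every $K$-algebra $A$ and every algebra map $f^+:\mathfrak A(w_\sigma)\to A$ that has an antipode $f^-$, there is a unique algebra map $F:A_\sigma\to A$ with $F\circ\Phi=f^+$. If moreover $A$ has a weak bialgebra structure $(A,\Delta,\varepsilon)$ and $f^+$ is a weak bialgebra homomorphism, then $F$ is a weak bialgebra homomorphism. -/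

import Mathlib

set_option maxSynthPendingDepth 3
set_option linter.unusedSectionVars false
set_option linter.unusedSimpArgs false

open scoped TensorProduct

noncomputable section

namespace FaceClosure

/-! ### Algebras presented by generators of a two-sided ideal -/

section Presented

variable (K : Type*) [Field K] {B : Type*} [Ring B] [Algebra K B]

/-- The quotient of the `K`-algebra `B` by the two-sided ideal generated by the set `s`. -/
def PresAlg (_K : Type*) {B : Type*} [Ring B] (s : Set B) : Type _ :=
  B ⧸ (TwoSidedIdeal.span s).asIdeal

variable (s : Set B)

instance : Ring (PresAlg K s) := inferInstanceAs (Ring (B ⧸ (TwoSidedIdeal.span s).asIdeal))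

instance : Algebra K (PresAlg K s) :=
  inferInstanceAs (Algebra K (B ⧸ (TwoSidedIdeal.span s).asIdeal))

/-- The projection `B → B / (s)`. -/
def PresAlg.mk : B →ₐ[K] PresAlg K s := Ideal.Quotient.mkₐ K (TwoSidedIdeal.span s).asIdeal

theorem PresAlg.mk_surjective : Function.Surjective (PresAlg.mk K s) :=
  Ideal.Quotient.mkₐ_surjective K _

variable {s} in
theorem PresAlg.mk_eq_zero_of_mem {x : B} (hx : x ∈ s) : PresAlg.mk K s x = 0 :=
  Ideal.Quotient.eq_zero_iff_mem.2 (TwoSidedIdeal.subset_span hx)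

variable {K s}

/-- The `K`-linear map on `B / (s)` induced by a `K`-linear map that vanishes on the ideal. -/
def PresAlg.linLift {N : Type*} [AddCommGroup N] [Module K N] (f : B →ₗ[K] N)
    (h : ∀ x ∈ TwoSidedIdeal.span s, f x = 0) : PresAlg K s →ₗ[K] N :=
  (((TwoSidedIdeal.span s).asIdeal.restrictScalars K).liftQ f
      (fun x hx => h x hx)).comp
    (Submodule.Quotient.restrictScalarsEquiv K (TwoSidedIdeal.span s).asIdeal).symm.toLinearMap

theorem PresAlg.linLift_mk {N : Type*} [AddCommGroup N] [Module K N] (f : B →ₗ[K] N)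
    (h : ∀ x ∈ TwoSidedIdeal.span s, f x = 0) (x : B) :
    PresAlg.linLift f h (PresAlg.mk K s x) = f x := rfl

/-- The algebra map on `B / (s)` induced by an algebra map that vanishes on the generators. -/
def PresAlg.algLift {C : Type*} [Ring C] [Algebra K C] (f : B →ₐ[K] C)
    (h : ∀ x ∈ s, f x = 0) : PresAlg K s →ₐ[K] C :=
  Ideal.Quotient.liftₐ (TwoSidedIdeal.span s).asIdeal f (fun x hx => by
    have : TwoSidedIdeal.span s ≤ TwoSidedIdeal.ker f :=
      TwoSidedIdeal.span_le.2 fun y hy => (TwoSidedIdeal.mem_ker f).2 (h y hy)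
    exact (TwoSidedIdeal.mem_ker f).1 (this hx))

theorem PresAlg.algLift_mk {C : Type*} [Ring C] [Algebra K C] (f : B →ₐ[K] C)
    (h : ∀ x ∈ s, f x = 0) (x : B) : PresAlg.algLift f h (PresAlg.mk K s x) = f x := rfl

end Presented

/-! ### Weak bialgebras -/

section Weak

variable {K : Type*} [Field K] {B : Type*} [Ring B] [Algebra K B]

/-- `(B, Δ, ε)` is a weak bialgebra. -/
structure IsWeakBialgebra (Δ : B →ₗ[K] B ⊗[K] B) (ε : B →ₗ[K] K) : Prop where
  coassoc : ∀ a : B, TensorProduct.assoc K B B B (Δ.rTensor B (Δ a)) = Δ.lTensor B (Δ a)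
  counit_left : ∀ a : B, TensorProduct.lid K B (ε.rTensor B (Δ a)) = a
  counit_right : ∀ a : B, TensorProduct.rid K B (ε.lTensor B (Δ a)) = a
  comul_mul : ∀ a b : B, Δ (a * b) = Δ a * Δ b
  /-- `(Δ(1) ⊗ 1)(1 ⊗ Δ(1)) = 1₍₁₎ ⊗ 1₍₂₎ ⊗ 1₍₃₎` -/
  comul_one : Algebra.TensorProduct.assoc K K K B B B (Δ 1 ⊗ₜ[K] (1 : B)) * ((1 : B) ⊗ₜ[K] Δ 1)
    = Δ.lTensor B (Δ 1)
  /-- `(1 ⊗ Δ(1))(Δ(1) ⊗ 1) = 1₍₁₎ ⊗ 1₍₂₎ ⊗ 1₍₃₎` -/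
  comul_one' : ((1 : B) ⊗ₜ[K] Δ 1) * Algebra.TensorProduct.assoc K K K B B B (Δ 1 ⊗ₜ[K] (1 : B))
    = Δ.lTensor B (Δ 1)
  /-- `ε(a b₍₁₎) ε(b₍₂₎ c) = ε(a b c)` -/
  counit_mul : ∀ a b c : B,
    LinearMap.mul' K K (TensorProduct.map (ε ∘ₗ LinearMap.mulLeft K a)
      (ε ∘ₗ LinearMap.mulRight K c) (Δ b)) = ε (a * b * c)
  /-- `ε(a b₍₂₎) ε(b₍₁₎ c) = ε(a b c)` -/
  counit_mul' : ∀ a b c : B,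
    LinearMap.mul' K K (TensorProduct.map (ε ∘ₗ LinearMap.mulRight K c)
      (ε ∘ₗ LinearMap.mulLeft K a) (Δ b)) = ε (a * b * c)

/-- The source counital map `ε_s(a) = 1₍₁₎ ε(a 1₍₂₎)`. -/
def sourceCounit (Δ : B →ₗ[K] B ⊗[K] B) (ε : B →ₗ[K] K) : B →ₗ[K] B where
  toFun a := TensorProduct.rid K B ((ε ∘ₗ LinearMap.mulLeft K a).lTensor B (Δ 1))
  map_add' a b := by
    rw [← map_add, ← LinearMap.add_apply, ← LinearMap.lTensor_add, ← LinearMap.comp_add]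
    congr 4
    ext x; simp [add_mul]
  map_smul' c a := by
    rw [RingHom.id_apply, ← map_smul, ← LinearMap.smul_apply, ← LinearMap.lTensor_smul,
      ← LinearMap.comp_smul]
    congr 4
    ext x; simp

/-- The target counital map `ε_t(a) = ε(1₍₁₎ a) 1₍₂₎`. -/
def targetCounit (Δ : B →ₗ[K] B ⊗[K] B) (ε : B →ₗ[K] K) : B →ₗ[K] B where
  toFun a := TensorProduct.lid K B ((ε ∘ₗ LinearMap.mulRight K a).rTensor B (Δ 1))
  map_add' a b := by
    rw [← map_add, ← LinearMap.add_apply, ← LinearMap.rTensor_add, ← LinearMap.comp_add]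
    congr 4
    ext x; simp [mul_add]
  map_smul' c a := by
    rw [RingHom.id_apply, ← map_smul, ← LinearMap.smul_apply, ← LinearMap.rTensor_smul,
      ← LinearMap.comp_smul]
    congr 4
    ext x; simp

/-- The convolution product `(f ⋆ g)(c) = f(c₍₁₎) g(c₍₂₎)` on `Hom_K(C, A)`. -/
def conv {C A : Type*} [AddCommGroup C] [Module K C] [Ring A] [Algebra K A]
    (Δ : C →ₗ[K] C ⊗[K] C) (f g : C →ₗ[K] A) : C →ₗ[K] A :=
  LinearMap.mul' K A ∘ₗ TensorProduct.map f g ∘ₗ Δ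

/-- `fm` is an antipode of the algebra map `fp : B → A`: it is the
`(fp ∘ ε_s, fp ∘ ε_t)`-generalized inverse of `fp` for the convolution product. -/
structure IsAntipodeOf {A : Type*} [Ring A] [Algebra K A] (Δ : B →ₗ[K] B ⊗[K] B)
    (ε : B →ₗ[K] K) (fp : B →ₐ[K] A) (fm : B →ₗ[K] A) : Prop where
  pos_neg : conv Δ fp.toLinearMap fm = fp.toLinearMap ∘ₗ targetCounit Δ ε
  neg_pos : conv Δ fm fp.toLinearMap = fp.toLinearMap ∘ₗ sourceCounit Δ ε
  pos_neg_pos : conv Δ (conv Δ fp.toLinearMap fm) fp.toLinearMap = fp.toLinearMap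
  neg_pos_neg : conv Δ (conv Δ fm fp.toLinearMap) fm = fm

/-- `S` makes the weak bialgebra `(B, Δ, ε)` a weak Hopf algebra. -/
structure IsWeakHopfAntipode (Δ : B →ₗ[K] B ⊗[K] B) (ε : B →ₗ[K] K) (S : B →ₗ[K] B) : Prop where
  left : conv Δ S LinearMap.id = sourceCounit Δ ε
  right : conv Δ LinearMap.id S = targetCounit Δ ε
  mid : conv Δ (conv Δ S LinearMap.id) S = S

/-- The algebra map `f` is a homomorphism of weak bialgebras `(B, Δ, ε) → (B', Δ', ε')`,
that is, it is also a homomorphism of coalgebras. -/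
structure IsWeakBialgHom {B' : Type*} [Ring B'] [Algebra K B'] (Δ : B →ₗ[K] B ⊗[K] B)
    (ε : B →ₗ[K] K) (Δ' : B' →ₗ[K] B' ⊗[K] B') (ε' : B' →ₗ[K] K) (f : B →ₐ[K] B') : Prop where
  comul : ∀ a : B, Δ' (f a) = TensorProduct.map f.toLinearMap f.toLinearMap (Δ a)
  counit : ∀ a : B, ε' (f a) = ε a

end Weak

/-! ### Frobenius-separable algebras and the passage from `A ⊗_L A` to `A ⊗_K A` -/

/-- An idempotent Frobenius system `(ψ, e⁽¹⁾ ⊗ e⁽²⁾)` on the `K`-algebra `L`. -/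
structure FrobeniusSystem (K L : Type*) [Field K] [Ring L] [Algebra K L] where
  ψ : L →ₗ[K] K
  e : L ⊗[K] L
  /-- `ψ(l e⁽¹⁾) e⁽²⁾ = l` -/
  left : ∀ l : L, TensorProduct.lid K L ((ψ ∘ₗ LinearMap.mulLeft K l).rTensor L e) = l
  /-- `e⁽¹⁾ ψ(e⁽²⁾ l) = l` -/
  right : ∀ l : L, TensorProduct.rid K L ((ψ ∘ₗ LinearMap.mulRight K l).lTensor L e) = l
  /-- `e⁽¹⁾ e⁽²⁾ = 1` -/
  idem : LinearMap.mul' K L e = 1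

section Frobenius

variable {K L : Type*} [Field K] [Ring L] [Algebra K L]

theorem FrobeniusSystem.casimir (F : FrobeniusSystem K L) (l : L) :
    (l ⊗ₜ[K] (1 : L)) * F.e = F.e * ((1 : L) ⊗ₜ[K] l) := by
  obtain ⟨n, x, y, he⟩ : ∃ (n : ℕ) (x y : Fin n → L), F.e = ∑ i, x i ⊗ₜ[K] y i := by
    obtain ⟨S, hS⟩ := TensorProduct.exists_finset F.e
    refine ⟨S.card, fun i => (S.equivFin.symm i).1.1, fun i => (S.equivFin.symm i).1.2, ?_⟩
    rw [hS, ← Finset.sum_coe_sort]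
    exact (Equiv.sum_comp S.equivFin.symm (fun i : S => i.1.1 ⊗ₜ[K] i.1.2)).symm
  have hl : ∀ l, ∑ i, F.ψ (l * x i) • y i = l := fun l => by
    have := F.left l
    simpa [he, map_sum] using this
  have hr : ∀ l, ∑ i, F.ψ (y i * l) • x i = l := fun l => by
    have := F.right l
    simpa [he, map_sum] using this
  rw [he, Finset.mul_sum, Finset.sum_mul]
  simp only [Algebra.TensorProduct.tmul_mul_tmul, one_mul, mul_one]
  calc ∑ i, (l * x i) ⊗ₜ[K] y i
      = ∑ i, (∑ j, F.ψ (y j * (l * x i)) • x j) ⊗ₜ[K] y i := by simp only [hr]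
    _ = ∑ j, x j ⊗ₜ[K] ∑ i, F.ψ ((y j * l) * x i) • y i := by
        simp only [TensorProduct.sum_tmul, TensorProduct.tmul_sum, TensorProduct.smul_tmul,
          mul_assoc]
        exact Finset.sum_comm
    _ = _ := by simp only [hl]

variable {A : Type*} [Ring A] [Algebra K A]

/-- For algebra maps `s : L → A` and `t : Lᵒᵖ → A`, the right ideal of `A ⊗_K A` generated by
all `t(l) ⊗ 1 - 1 ⊗ s(l)`. -/
def balIdeal (s : L →ₐ[K] A) (t : Lᵐᵒᵖ →ₐ[K] A) : Submodule K (A ⊗[K] A) :=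
  Submodule.span K {z | ∃ (l : L) (y : A ⊗[K] A),
    z = (t (MulOpposite.op l) ⊗ₜ[K] (1 : A) - (1 : A) ⊗ₜ[K] s l) * y}

/-- The tensor product `A ⊗_L A` of the bimodule `l · a · l' = s(l) t(l') a` with itself. -/
abbrev BalTensor (s : L →ₐ[K] A) (t : Lᵐᵒᵖ →ₐ[K] A) : Type _ := (A ⊗[K] A) ⧸ balIdeal s t

/-- The element `t(e⁽¹⁾) ⊗ s(e⁽²⁾)` of `A ⊗_K A`. -/
def FrobeniusSystem.unitElt (F : FrobeniusSystem K L) (s : L →ₐ[K] A) (t : Lᵐᵒᵖ →ₐ[K] A) :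
    A ⊗[K] A :=
  TensorProduct.map (t.toLinearMap ∘ₗ (MulOpposite.opLinearEquiv K).toLinearMap) s.toLinearMap F.e

theorem FrobeniusSystem.unitElt_mul (F : FrobeniusSystem K L) (s : L →ₐ[K] A)
    (t : Lᵐᵒᵖ →ₐ[K] A) (l : L) :
    F.unitElt s t * (t (MulOpposite.op l) ⊗ₜ[K] (1 : A)) =
      F.unitElt s t * ((1 : A) ⊗ₜ[K] s l) := by
  set m := TensorProduct.map (t.toLinearMap ∘ₗ (MulOpposite.opLinearEquiv K).toLinearMap)
    s.toLinearMap with hm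
  have h1 : ∀ z : L ⊗[K] L,
      m z * (t (MulOpposite.op l) ⊗ₜ[K] (1 : A)) = m ((l ⊗ₜ[K] (1 : L)) * z) := fun z => by
    induction z with
    | zero => simp
    | tmul a b => simp [hm]
    | add a b ha hb => simp only [map_add, add_mul, mul_add, ha, hb]
  have h2 : ∀ z : L ⊗[K] L,
      m z * ((1 : A) ⊗ₜ[K] s l) = m (z * ((1 : L) ⊗ₜ[K] l)) := fun z => by
    induction z with
    | zero => simp
    | tmul a b => simp [hm]
    | add a b ha hb => simp only [map_add, add_mul, ha, hb]
  change m F.e * _ = m F.e * _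
  rw [h1, h2, F.casimir]

/-- The map `A ⊗_L A → A ⊗_K A`, `a ⊗ b ↦ t(e⁽¹⁾) a ⊗ s(e⁽²⁾) b`. -/
def FrobeniusSystem.section' (F : FrobeniusSystem K L) (s : L →ₐ[K] A) (t : Lᵐᵒᵖ →ₐ[K] A) :
    BalTensor s t →ₗ[K] A ⊗[K] A :=
  (balIdeal s t).liftQ (LinearMap.mulLeft K (F.unitElt s t)) (by
    refine Submodule.span_le.2 ?_
    rintro _ ⟨l, y, rfl⟩
    simp only [SetLike.mem_coe, LinearMap.mem_ker, LinearMap.mulLeft_apply, ← mul_assoc, mul_sub,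
      sub_mul, F.unitElt_mul, sub_self])

/-- The idempotent Frobenius system on the algebra of maps `Λ → L`: `ψ(f) = ∑_λ ψ(f(λ))` and
`e = ∑_λ e⁽¹⁾ δ_λ ⊗ e⁽²⁾ δ_λ`. -/
def FrobeniusSystem.pi (F : FrobeniusSystem K L) (Λ : Type*) [Fintype Λ] [DecidableEq Λ] :
    FrobeniusSystem K (Λ → L) where
  ψ := ∑ i : Λ, F.ψ ∘ₗ LinearMap.proj i
  e := ∑ i : Λ, TensorProduct.map (LinearMap.single K (fun _ => L) i)
    (LinearMap.single K (fun _ => L) i) F.e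
  left f := by
    rw [map_sum, map_sum]
    have key : ∀ (i : Λ) (z : L ⊗[K] L), TensorProduct.lid K (Λ → L)
        (((∑ i : Λ, F.ψ ∘ₗ LinearMap.proj i) ∘ₗ LinearMap.mulLeft K f).rTensor (Λ → L)
          (TensorProduct.map (LinearMap.single K (fun _ => L) i)
            (LinearMap.single K (fun _ => L) i) z)) =
        LinearMap.single K (fun _ => L) i (TensorProduct.lid K L
          ((F.ψ ∘ₗ LinearMap.mulLeft K (f i)).rTensor L z)) := fun i z => by
      induction z with
      | zero => simp
      | tmul a b =>
        simp only [TensorProduct.map_tmul, LinearMap.rTensor_tmul, TensorProduct.lid_tmul,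
          LinearMap.comp_apply, LinearMap.mulLeft_apply, LinearMap.sum_apply, map_smul,
          LinearMap.proj_apply, LinearMap.single_apply, Pi.mul_apply]
        congr 1
        rw [Finset.sum_eq_single i]
        · simp
        · intro j _ hj; simp [Pi.single_eq_of_ne hj]
        · simp
      | add a b ha hb => simp only [map_add, ha, hb]
    simp only [key, F.left]
    exact LinearMap.sum_single_apply (fun _ => L) f
  right f := by
    rw [map_sum, map_sum]
    have key : ∀ (i : Λ) (z : L ⊗[K] L), TensorProduct.rid K (Λ → L)
        (((∑ i : Λ, F.ψ ∘ₗ LinearMap.proj i) ∘ₗ LinearMap.mulRight K f).lTensor (Λ → L)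
          (TensorProduct.map (LinearMap.single K (fun _ => L) i)
            (LinearMap.single K (fun _ => L) i) z)) =
        LinearMap.single K (fun _ => L) i (TensorProduct.rid K L
          ((F.ψ ∘ₗ LinearMap.mulRight K (f i)).lTensor L z)) := fun i z => by
      induction z with
      | zero => simp
      | tmul a b =>
        simp only [TensorProduct.map_tmul, LinearMap.lTensor_tmul, TensorProduct.rid_tmul,
          LinearMap.comp_apply, LinearMap.mulRight_apply, LinearMap.sum_apply, map_smul,
          LinearMap.proj_apply, LinearMap.single_apply, Pi.mul_apply]
        congr 1
        rw [Finset.sum_eq_single i]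
        · simp
        · intro j _ hj; simp [Pi.single_eq_of_ne hj]
        · simp
      | add a b ha hb => simp only [map_add, ha, hb]
    simp only [key, F.right]
    exact LinearMap.sum_single_apply (fun _ => L) f
  idem := by
    rw [map_sum]
    have key : ∀ (i : Λ) (z : L ⊗[K] L), LinearMap.mul' K (Λ → L)
          (TensorProduct.map (LinearMap.single K (fun _ => L) i)
            (LinearMap.single K (fun _ => L) i) z) =
        LinearMap.single K (fun _ => L) i (LinearMap.mul' K L z) := fun i z => by
      induction z with
      | zero => simp
      | tmul a b => simp [Pi.single_mul]
      | add a b ha hb => simp only [map_add, ha, hb]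
    simp only [key, F.idem]
    exact LinearMap.sum_single_apply (fun _ => L) 1

end Frobenius

/-! ### The algebra `A_σ` -/

/-- The data `(deg, σ)`: `deg a` acts on `Λ` from the right by `λ · deg a = deg a λ`, and
`σ a b c d` is `σ^{ab}_{cd} : Λ → R`. -/
structure SigmaDatum (Λ X R : Type*) [Ring R] where
  deg : X → Equiv.Perm Λ
  σ : X → X → X → X → Λ → R
  central : ∀ a b c d l, σ a b c d l ∈ Subring.center R
  /-- `λ deg(d) deg(b) ≠ λ deg(c) deg(a)` implies `σ^{bd}_{ac}(λ) = 0`. -/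
  invariant : ∀ a b c d l, deg b (deg d l) ≠ deg a (deg c l) → σ b d a c l = 0

/-- The generators of the free algebra: the elements of `M_Λ(R) ⊗ M_Λ(R)ᵒᵖ` and the symbols
`L_{ab}` and `(L⁻¹)_{ab}`. -/
inductive Gen (K Λ X R : Type*) [Field K] [Ring R] [Algebra K R] : Type _
  | scal : ((Λ → R) ⊗[K] (Λ → R)ᵐᵒᵖ) → Gen K Λ X R
  | L : X → X → Gen K Λ X R
  | Linv : X → X → Gen K Λ X R

section ASigma

variable {K : Type*} [Field K] {R : Type*} [Ring R] [Algebra K R] {Λ X : Type*}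

/-- `T_α(f)(λ) = f(λ α)`. -/
def shift (K : Type*) [Field K] {R : Type*} [Ring R] [Algebra K R] {Λ : Type*}
    (α : Equiv.Perm Λ) : (Λ → R) →ₐ[K] (Λ → R) where
  toFun f l := f (α l)
  map_one' := rfl
  map_mul' _ _ := rfl
  map_zero' := rfl
  map_add' _ _ := rfl
  commutes' _ := rfl

theorem shift_apply (α : Equiv.Perm Λ) (f : Λ → R) (l : Λ) : shift K α f l = f (α l) := rfl

/-- The element `f ⊗ g` of `M_Λ(R) ⊗ M_Λ(R)ᵒᵖ` as a generator of the free algebra. -/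
def gScal (ξ : (Λ → R) ⊗[K] (Λ → R)ᵐᵒᵖ) : FreeAlgebra K (Gen K Λ X R) :=
  FreeAlgebra.ι K (Gen.scal ξ)

variable (K R Λ) in
/-- The generator `L_{ab}`. -/
def gL (a b : X) : FreeAlgebra K (Gen K Λ X R) := FreeAlgebra.ι K (Gen.L a b)

variable (K R Λ) in
/-- The generator `(L⁻¹)_{ab}`. -/
def gLinv (a b : X) : FreeAlgebra K (Gen K Λ X R) := FreeAlgebra.ι K (Gen.Linv a b)

/-- `f ⊗ 1` -/
def inl (K : Type*) [Field K] [Algebra K R] (f : Λ → R) : (Λ → R) ⊗[K] (Λ → R)ᵐᵒᵖ := f ⊗ₜ[K] 1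

/-- `1 ⊗ f` -/
def inr (K : Type*) [Field K] [Algebra K R] (f : Λ → R) : (Λ → R) ⊗[K] (Λ → R)ᵐᵒᵖ :=
  1 ⊗ₜ[K] MulOpposite.op f

variable [Fintype X] [DecidableEq X]

variable (K) in
/-- The generators of the ideal `I_σ`. -/
inductive SigmaRel (D : SigmaDatum Λ X R) : FreeAlgebra K (Gen K Λ X R) → Prop
  | add (ξ ξ' : (Λ → R) ⊗[K] (Λ → R)ᵐᵒᵖ) : SigmaRel D (gScal ξ + gScal ξ' - gScal (ξ + ξ'))
  | smul (c : K) (ξ : (Λ → R) ⊗[K] (Λ → R)ᵐᵒᵖ) : SigmaRel D (c • gScal ξ - gScal (c • ξ))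
  | mul (ξ ξ' : (Λ → R) ⊗[K] (Λ → R)ᵐᵒᵖ) : SigmaRel D (gScal ξ * gScal ξ' - gScal (ξ * ξ'))
  | L_Linv (a b : X) : SigmaRel D ((∑ c, gL K R Λ a c * gLinv K R Λ c b) - if a = b then 1 else 0)
  | Linv_L (a b : X) : SigmaRel D ((∑ c, gLinv K R Λ a c * gL K R Λ c b) - if a = b then 1 else 0)
  | L_left (f : Λ → R) (a b : X) : SigmaRel D
      (gScal (inl K (shift K (D.deg a) f)) * gL K R Λ a b - gL K R Λ a b * gScal (inl K f))
  | L_right (f : Λ → R) (a b : X) : SigmaRel D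
      (gScal (inr K (shift K (D.deg b) f)) * gL K R Λ a b - gL K R Λ a b * gScal (inr K f))
  | Linv_left (f : Λ → R) (a b : X) : SigmaRel D
      (gScal (inl K f) * gLinv K R Λ a b - gLinv K R Λ a b * gScal (inl K (shift K (D.deg b) f)))
  | Linv_right (f : Λ → R) (a b : X) : SigmaRel D
      (gScal (inr K f) * gLinv K R Λ a b - gLinv K R Λ a b * gScal (inr K (shift K (D.deg a) f)))
  | exch (a b c d : X) : SigmaRel D
      ((∑ x, ∑ y, gScal (inl K (D.σ x y a c)) * gL K R Λ y d * gL K R Λ x b) -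
        ∑ x, ∑ y, gScal (inr K (D.σ b d x y)) * gL K R Λ c y * gL K R Λ a x)
  | one : SigmaRel D (1 - gScal 1)

/-- The algebra `A_σ`. -/
def ASigma (K : Type*) [Field K] [Algebra K R] (D : SigmaDatum Λ X R) : Type _ :=
  PresAlg K {z | SigmaRel K D z}

variable (D : SigmaDatum Λ X R)

instance : Ring (ASigma K D) := inferInstanceAs (Ring (PresAlg K {z | SigmaRel K D z}))

instance : Algebra K (ASigma K D) := inferInstanceAs (Algebra K (PresAlg K {z | SigmaRel K D z}))

namespace ASigma

/-- The projection of the free algebra onto `A_σ`. -/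
def mk : FreeAlgebra K (Gen K Λ X R) →ₐ[K] ASigma K D := PresAlg.mk K {z | SigmaRel K D z}

variable {D} in
theorem mk_rel {z : FreeAlgebra K (Gen K Λ X R)} (h : SigmaRel K D z) : mk D z = 0 :=
  PresAlg.mk_eq_zero_of_mem K h

/-- The class of `L_{ab}`. -/
def L (K : Type*) [Field K] [Algebra K R] (D : SigmaDatum Λ X R) (a b : X) : ASigma K D :=
  mk D (gL K R Λ a b)

/-- The class of `(L⁻¹)_{ab}`. -/
def Linv (K : Type*) [Field K] [Algebra K R] (D : SigmaDatum Λ X R) (a b : X) : ASigma K D :=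
  mk D (gLinv K R Λ a b)

/-- `ξ ↦ ξ + I_σ`, an algebra map `M_Λ(R) ⊗ M_Λ(R)ᵒᵖ → A_σ`. -/
def scal (K : Type*) [Field K] [Algebra K R] (D : SigmaDatum Λ X R) :
    (Λ → R) ⊗[K] (Λ → R)ᵐᵒᵖ →ₐ[K] ASigma K D :=
  AlgHom.ofLinearMap
    { toFun := fun ξ => mk D (gScal ξ)
      map_add' := fun ξ ξ' => by
        have := mk_rel (SigmaRel.add (D := D) ξ ξ')
        rw [map_sub, map_add, sub_eq_zero] at this
        exact this.symm
      map_smul' := fun c ξ => by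
        have := mk_rel (SigmaRel.smul (D := D) c ξ)
        rw [map_sub, map_smul, sub_eq_zero] at this
        exact this.symm }
    (by
      have := mk_rel (SigmaRel.one (K := K) (D := D))
      rw [map_sub, map_one, sub_eq_zero] at this
      exact this.symm)
    (fun ξ ξ' => by
      have := mk_rel (SigmaRel.mul (D := D) ξ ξ')
      rw [map_sub, map_mul, sub_eq_zero] at this
      exact this.symm)

/-- The source map `s(f) = f ⊗ 1 + I_σ`. -/
def src (K : Type*) [Field K] [Algebra K R] (D : SigmaDatum Λ X R) : (Λ → R) →ₐ[K] ASigma K D :=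
  (scal K D).comp Algebra.TensorProduct.includeLeft

/-- The target map `t(f) = 1 ⊗ f + I_σ`. -/
def tgt (K : Type*) [Field K] [Algebra K R] (D : SigmaDatum Λ X R) :
    (Λ → R)ᵐᵒᵖ →ₐ[K] ASigma K D :=
  (scal K D).comp Algebra.TensorProduct.includeRight

theorem mk_inl (f : Λ → R) : mk D (gScal (inl K f)) = src K D f := rfl

theorem mk_inr (f : Λ → R) : mk D (gScal (inr K f)) = tgt K D (MulOpposite.op f) := rfl

theorem src_tgt_comm (f : Λ → R) (g : (Λ → R)ᵐᵒᵖ) :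
    src K D f * tgt K D g = tgt K D g * src K D f := by
  simp only [src, tgt, AlgHom.comp_apply, ← map_mul]
  simp

theorem L_mul_Linv (a b : X) : ∑ c, L K D a c * Linv K D c b = if a = b then 1 else 0 := by
  have := mk_rel (SigmaRel.L_Linv (K := K) (D := D) a b)
  rw [map_sub, sub_eq_zero, map_sum] at this
  simp only [map_mul] at this
  rw [apply_ite (mk D), map_one, map_zero] at this
  exact this

theorem Linv_mul_L (a b : X) : ∑ c, Linv K D a c * L K D c b = if a = b then 1 else 0 := by
  have := mk_rel (SigmaRel.Linv_L (K := K) (D := D) a b)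
  rw [map_sub, sub_eq_zero, map_sum] at this
  simp only [map_mul] at this
  rw [apply_ite (mk D), map_one, map_zero] at this
  exact this

theorem L_mul_src (f : Λ → R) (a b : X) :
    L K D a b * src K D f = src K D (shift K (D.deg a) f) * L K D a b := by
  have := mk_rel (SigmaRel.L_left (K := K) (D := D) f a b)
  rw [map_sub, map_mul, map_mul, sub_eq_zero] at this
  exact this.symm

theorem L_mul_tgt (f : Λ → R) (a b : X) : L K D a b * tgt K D (MulOpposite.op f) =
    tgt K D (MulOpposite.op (shift K (D.deg b) f)) * L K D a b := by
  have := mk_rel (SigmaRel.L_right (K := K) (D := D) f a b)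
  rw [map_sub, map_mul, map_mul, sub_eq_zero] at this
  exact this.symm

theorem src_mul_Linv (f : Λ → R) (a b : X) :
    src K D f * Linv K D a b = Linv K D a b * src K D (shift K (D.deg b) f) := by
  have := mk_rel (SigmaRel.Linv_left (K := K) (D := D) f a b)
  rw [map_sub, map_mul, map_mul, sub_eq_zero] at this
  exact this

theorem tgt_mul_Linv (f : Λ → R) (a b : X) : tgt K D (MulOpposite.op f) * Linv K D a b =
    Linv K D a b * tgt K D (MulOpposite.op (shift K (D.deg a) f)) := by
  have := mk_rel (SigmaRel.Linv_right (K := K) (D := D) f a b)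
  rw [map_sub, map_mul, map_mul, sub_eq_zero] at this
  exact this

theorem exchange (a b c d : X) :
    ∑ x, ∑ y, src K D (D.σ x y a c) * L K D y d * L K D x b =
      ∑ x, ∑ y, tgt K D (MulOpposite.op (D.σ b d x y)) * L K D c y * L K D a x := by
  have := mk_rel (SigmaRel.exch (K := K) (D := D) a b c d)
  rw [map_sub, sub_eq_zero] at this
  simp only [map_sum, map_mul] at this
  exact this

theorem Linv_mul_src (f : Λ → R) (a b : X) :
    Linv K D a b * src K D f = src K D (shift K (D.deg b)⁻¹ f) * Linv K D a b := by
  rw [src_mul_Linv]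
  congr 2
  ext l
  simp [shift_apply]

theorem Linv_mul_tgt (f : Λ → R) (a b : X) : Linv K D a b * tgt K D (MulOpposite.op f) =
    tgt K D (MulOpposite.op (shift K (D.deg a)⁻¹ f)) * Linv K D a b := by
  rw [tgt_mul_Linv]
  congr 3
  ext l
  simp [shift_apply]

/-- The algebra map `Δ̄ : K⟨ΛX⟩ → A_σ ⊗_K A_σ`. -/
def comulFree : FreeAlgebra K (Gen K Λ X R) →ₐ[K] ASigma K D ⊗[K] ASigma K D :=
  FreeAlgebra.lift K fun g => match g with
    | .scal ξ => Algebra.TensorProduct.map (src K D) (tgt K D) ξ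
    | .L a b => ∑ c, L K D a c ⊗ₜ[K] L K D c b
    | .Linv a b => ∑ c, Linv K D c b ⊗ₜ[K] Linv K D a c

theorem comulFree_scal (ξ : (Λ → R) ⊗[K] (Λ → R)ᵐᵒᵖ) :
    comulFree D (gScal ξ) = Algebra.TensorProduct.map (src K D) (tgt K D) ξ := by
  simp [comulFree, gScal]

theorem comulFree_L (a b : X) :
    comulFree D (gL K R Λ a b) = ∑ c, L K D a c ⊗ₜ[K] L K D c b := by
  simp [comulFree, gL]

theorem comulFree_Linv (a b : X) :
    comulFree D (gLinv K R Λ a b) = ∑ c, Linv K D c b ⊗ₜ[K] Linv K D a c := by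
  simp [comulFree, gLinv]

end ASigma

end ASigma

section BalIdeal

variable {K L : Type*} [Field K] [Ring L] [Algebra K L] {A : Type*} [Ring A] [Algebra K A]
  {s : L →ₐ[K] A} {t : Lᵐᵒᵖ →ₐ[K] A}

theorem balIdeal_gen_mem (l : L) (y : A ⊗[K] A) :
    (t (MulOpposite.op l) ⊗ₜ[K] (1 : A) - (1 : A) ⊗ₜ[K] s l) * y ∈ balIdeal s t :=
  Submodule.subset_span ⟨l, y, rfl⟩

theorem balIdeal_mul_mem {z : A ⊗[K] A} (hz : z ∈ balIdeal s t) (y : A ⊗[K] A) :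
    z * y ∈ balIdeal s t := by
  induction hz using Submodule.span_induction with
  | mem x h =>
    obtain ⟨l, y', rfl⟩ := h
    rw [mul_assoc]
    exact balIdeal_gen_mem _ _
  | zero => simp
  | add a b _ _ ha hb => rw [add_mul]; exact add_mem ha hb
  | smul c a _ ha => rw [smul_mul_assoc]; exact Submodule.smul_mem _ _ ha

/-- An element `x` satisfying `x (t(l) ⊗ 1 - 1 ⊗ s(l)) ∈ I₂` for all `l` multiplies `I₂` into
itself. -/
theorem mul_balIdeal_mem {x : A ⊗[K] A}
    (hx : ∀ l, x * (t (MulOpposite.op l) ⊗ₜ[K] (1 : A) - (1 : A) ⊗ₜ[K] s l) ∈ balIdeal s t)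
    {z : A ⊗[K] A} (hz : z ∈ balIdeal s t) : x * z ∈ balIdeal s t := by
  induction hz using Submodule.span_induction with
  | mem z h =>
    obtain ⟨l, y', rfl⟩ := h
    rw [← mul_assoc]
    exact balIdeal_mul_mem (hx l) _
  | zero => simp
  | add a b _ _ ha hb => rw [mul_add]; exact add_mem ha hb
  | smul c a _ ha => rw [mul_smul_comm]; exact Submodule.smul_mem _ _ ha

/-- If a multiplicative linear map into `A ⊗ A` sends a set into `I₂` and its values multiply `I₂`
into itself, it sends the two-sided ideal generated by the set into `I₂`. -/
theorem map_span_mem_balIdeal {B : Type*} [Ring B] [Algebra K B] (f : B →ₗ[K] A ⊗[K] A)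
    (hf : ∀ x y, f (x * y) = f x * f y) {S : Set B} (hS : ∀ x ∈ S, f x ∈ balIdeal s t)
    (h : ∀ (b : B) (z : A ⊗[K] A), z ∈ balIdeal s t → f b * z ∈ balIdeal s t) :
    ∀ x ∈ TwoSidedIdeal.span S, f x ∈ balIdeal s t := by
  let J : TwoSidedIdeal B := TwoSidedIdeal.mk' {x | f x ∈ balIdeal s t}
    (by simp) (fun ha hb => by simpa using add_mem ha hb) (fun ha => by simpa using ha)
    (fun {x y} hy => by simpa [hf] using h x _ hy)
    (fun {x y} hx => by simpa [hf] using balIdeal_mul_mem hx _)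
  have hJ : TwoSidedIdeal.span S ≤ J := TwoSidedIdeal.span_le.2 fun x hx => by
    simpa [J] using hS x hx
  intro x hx
  simpa [J] using hJ hx

end BalIdeal

namespace ASigma

variable {K : Type*} [Field K] {R : Type*} [Ring R] [Algebra K R] {Λ X : Type*}
  [Fintype X] [DecidableEq X] (D : SigmaDatum Λ X R)

theorem comulFree_mul_mem (b : FreeAlgebra K (Gen K Λ X R)) (z : ASigma K D ⊗[K] ASigma K D)
    (hz : z ∈ balIdeal (src K D) (tgt K D)) :
    comulFree D b * z ∈ balIdeal (src K D) (tgt K D) := by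
  induction b using FreeAlgebra.induction generalizing z with
  | grade0 c =>
    rw [AlgHom.commutes, ← Algebra.smul_def]
    exact Submodule.smul_mem _ _ hz
  | grade1 g =>
    cases g with
    | scal ξ =>
      change comulFree D (gScal ξ) * z ∈ _
      rw [comulFree_scal]
      induction ξ with
      | zero => simp
      | add a b ha hb => rw [map_add, add_mul]; exact add_mem ha hb
      | tmul f g =>
        refine mul_balIdeal_mem (fun l => ?_) hz
        rw [Algebra.TensorProduct.map_tmul]
        have : (src K D f ⊗ₜ[K] tgt K D g) *
            (tgt K D (MulOpposite.op l) ⊗ₜ[K] (1 : ASigma K D) - 1 ⊗ₜ[K] src K D l) =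
            (tgt K D (MulOpposite.op l) ⊗ₜ[K] (1 : ASigma K D) - 1 ⊗ₜ[K] src K D l) *
              (src K D f ⊗ₜ[K] tgt K D g) := by
          simp [mul_sub, sub_mul, src_tgt_comm]
        rw [this]
        exact balIdeal_gen_mem _ _
    | L a b =>
      change comulFree D (gL K R Λ a b) * z ∈ _
      rw [comulFree_L]
      refine mul_balIdeal_mem (fun l => ?_) hz
      rw [Finset.sum_mul]
      refine Submodule.sum_mem _ fun c _ => ?_
      have : (L K D a c ⊗ₜ[K] L K D c b) *
          (tgt K D (MulOpposite.op l) ⊗ₜ[K] (1 : ASigma K D) - 1 ⊗ₜ[K] src K D l) =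
          (tgt K D (MulOpposite.op (shift K (D.deg c) l)) ⊗ₜ[K] (1 : ASigma K D) -
            1 ⊗ₜ[K] src K D (shift K (D.deg c) l)) * (L K D a c ⊗ₜ[K] L K D c b) := by
        simp [mul_sub, sub_mul, L_mul_src, L_mul_tgt]
      rw [this]
      exact balIdeal_gen_mem _ _
    | Linv a b =>
      change comulFree D (gLinv K R Λ a b) * z ∈ _
      rw [comulFree_Linv]
      refine mul_balIdeal_mem (fun l => ?_) hz
      rw [Finset.sum_mul]
      refine Submodule.sum_mem _ fun c _ => ?_
      have : (Linv K D c b ⊗ₜ[K] Linv K D a c) *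
          (tgt K D (MulOpposite.op l) ⊗ₜ[K] (1 : ASigma K D) - 1 ⊗ₜ[K] src K D l) =
          (tgt K D (MulOpposite.op (shift K (D.deg c)⁻¹ l)) ⊗ₜ[K] (1 : ASigma K D) -
            1 ⊗ₜ[K] src K D (shift K (D.deg c)⁻¹ l)) * (Linv K D c b ⊗ₜ[K] Linv K D a c) := by
        simp [mul_sub, sub_mul, Linv_mul_src, Linv_mul_tgt]
      rw [this]
      exact balIdeal_gen_mem _ _
  | mul x y hx hy => rw [map_mul, mul_assoc]; exact hx _ (hy _ hz)
  | add x y hx hy => rw [map_add, add_mul]; exact add_mem (hx _ hz) (hy _ hz)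

theorem sum_swap₄ {X : Type*} [Fintype X] {N : Type*} [AddCommMonoid N] (f : X → X → X → X → N) :
    ∑ x, ∑ y, ∑ v, ∑ u, f x y v u = ∑ v, ∑ u, ∑ x, ∑ y, f x y v u := by
  have h : ∀ g : X → X → N, ∑ x, ∑ y, g x y = ∑ p : X × X, g p.1 p.2 := fun g =>
    (Fintype.sum_prod_type' g).symm
  simp only [h]
  exact Finset.sum_comm

theorem comulFree_rel {z : FreeAlgebra K (Gen K Λ X R)} (h : SigmaRel K D z) :
    comulFree D z ∈ balIdeal (src K D) (tgt K D) := by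
  have zero : ∀ {x y : ASigma K D ⊗[K] ASigma K D}, x = y →
      x - y ∈ balIdeal (src K D) (tgt K D) := fun h => by simp [h]
  cases h with
  | add ξ ξ' => rw [map_sub]; apply zero; simp only [map_add, comulFree_scal]
  | smul c ξ => rw [map_sub]; apply zero; simp only [map_smul, comulFree_scal]
  | mul ξ ξ' => rw [map_sub]; apply zero; simp only [map_mul, comulFree_scal]
  | one => rw [map_sub]; apply zero; simp only [map_one, comulFree_scal]
  | L_left f a b =>
    rw [map_sub]; apply zero
    simp [map_mul, comulFree_scal, comulFree_L, inl, Finset.mul_sum, Finset.sum_mul, L_mul_src]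
  | L_right f a b =>
    rw [map_sub]; apply zero
    simp [map_mul, comulFree_scal, comulFree_L, inr, Finset.mul_sum, Finset.sum_mul, L_mul_tgt]
  | Linv_left f a b =>
    rw [map_sub]; apply zero
    simp [map_mul, comulFree_scal, comulFree_Linv, inl, Finset.mul_sum, Finset.sum_mul,
      src_mul_Linv]
  | Linv_right f a b =>
    rw [map_sub]; apply zero
    simp [map_mul, comulFree_scal, comulFree_Linv, inr, Finset.mul_sum, Finset.sum_mul,
      tgt_mul_Linv]
  | L_Linv a b =>
    rw [map_sub]; apply zero
    rw [apply_ite (comulFree D), map_one, map_zero]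
    simp only [map_sum, map_mul, comulFree_L, comulFree_Linv, Finset.sum_mul_sum,
      Algebra.TensorProduct.tmul_mul_tmul]
    calc ∑ c, ∑ d, ∑ e, (L K D a d * Linv K D e b) ⊗ₜ[K] (L K D d c * Linv K D c e)
        = ∑ d, ∑ e, (L K D a d * Linv K D e b) ⊗ₜ[K] ∑ c, (L K D d c * Linv K D c e) := by
          rw [Finset.sum_comm]
          refine Finset.sum_congr rfl fun d _ => ?_
          rw [Finset.sum_comm]
          simp only [TensorProduct.tmul_sum]
      _ = ∑ d, (L K D a d * Linv K D d b) ⊗ₜ[K] (1 : ASigma K D) := by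
          refine Finset.sum_congr rfl fun d _ => ?_
          simp only [L_mul_Linv]
          rw [Finset.sum_eq_single d]
          · simp
          · intro e _ he; simp [he.symm]
          · simp
      _ = _ := by
          rw [← TensorProduct.sum_tmul, L_mul_Linv]
          split_ifs
          · rfl
          · simp
  | Linv_L a b =>
    rw [map_sub]; apply zero
    rw [apply_ite (comulFree D), map_one, map_zero]
    simp only [map_sum, map_mul, comulFree_L, comulFree_Linv, Finset.sum_mul_sum,
      Algebra.TensorProduct.tmul_mul_tmul]
    calc ∑ c, ∑ d, ∑ e, (Linv K D d c * L K D c e) ⊗ₜ[K] (Linv K D a d * L K D e b)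
        = ∑ d, ∑ e, (∑ c, Linv K D d c * L K D c e) ⊗ₜ[K] (Linv K D a d * L K D e b) := by
          rw [Finset.sum_comm]
          refine Finset.sum_congr rfl fun d _ => ?_
          rw [Finset.sum_comm]
          simp only [TensorProduct.sum_tmul]
      _ = ∑ d, (1 : ASigma K D) ⊗ₜ[K] (Linv K D a d * L K D d b) := by
          refine Finset.sum_congr rfl fun d _ => ?_
          simp only [Linv_mul_L]
          rw [Finset.sum_eq_single d]
          · simp
          · intro e _ he; simp [he.symm]
          · simp
      _ = _ := by
          rw [← TensorProduct.tmul_sum, Linv_mul_L]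
          split_ifs
          · rfl
          · simp
  | exch a b c d =>
    have h1 : comulFree D (∑ x, ∑ y,
        gScal (inl K (D.σ x y a c)) * gL K R Λ y d * gL K R Λ x b) =
        ∑ v, ∑ u, ∑ x, ∑ y, (tgt K D (MulOpposite.op (D.σ v u x y)) ⊗ₜ[K] (1 : ASigma K D)) *
          ((L K D c y * L K D a x) ⊗ₜ[K] (L K D u d * L K D v b)) := by
      have : ∀ u v, ∑ x, ∑ y, (tgt K D (MulOpposite.op (D.σ v u x y)) ⊗ₜ[K] (1 : ASigma K D)) *
          ((L K D c y * L K D a x) ⊗ₜ[K] (L K D u d * L K D v b)) =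
          ∑ x, ∑ y, (src K D (D.σ x y a c) * L K D y u * L K D x v) ⊗ₜ[K]
            (L K D u d * L K D v b) := fun u v => by
        simp only [← TensorProduct.sum_tmul]
        rw [exchange]
        simp [TensorProduct.sum_tmul, mul_assoc]
      simp only [this]
      simp only [map_sum, map_mul, comulFree_scal, comulFree_L, inl,
        Algebra.TensorProduct.map_tmul, map_one, Finset.mul_sum, Finset.sum_mul,
        Algebra.TensorProduct.tmul_mul_tmul, one_mul]
      exact sum_swap₄ _
    have h2 : comulFree D (∑ x, ∑ y,
        gScal (inr K (D.σ b d x y)) * gL K R Λ c y * gL K R Λ a x) =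
        ∑ v, ∑ u, ∑ x, ∑ y, ((1 : ASigma K D) ⊗ₜ[K] src K D (D.σ v u x y)) *
          ((L K D c y * L K D a x) ⊗ₜ[K] (L K D u d * L K D v b)) := by
      have : ∀ x y, ∑ v, ∑ u, ((1 : ASigma K D) ⊗ₜ[K] src K D (D.σ v u x y)) *
          ((L K D c y * L K D a x) ⊗ₜ[K] (L K D u d * L K D v b)) =
          ∑ v, ∑ u, (L K D c y * L K D a x) ⊗ₜ[K]
            (tgt K D (MulOpposite.op (D.σ b d v u)) * L K D y u * L K D x v) := fun x y => by
        simp only [← TensorProduct.tmul_sum]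
        rw [← exchange]
        simp [TensorProduct.tmul_sum, mul_assoc]
      rw [sum_swap₄ (fun v u x y => ((1 : ASigma K D) ⊗ₜ[K] src K D (D.σ v u x y)) *
          ((L K D c y * L K D a x) ⊗ₜ[K] (L K D u d * L K D v b)))]
      simp only [this]
      simp only [map_sum, map_mul, comulFree_scal, comulFree_L, inr,
        Algebra.TensorProduct.map_tmul, map_one, Finset.mul_sum, Finset.sum_mul,
        Algebra.TensorProduct.tmul_mul_tmul, one_mul]
      exact sum_swap₄ _
    rw [map_sub, h1, h2]
    simp only [← Finset.sum_sub_distrib, ← sub_mul]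
    exact Submodule.sum_mem _ fun v _ => Submodule.sum_mem _ fun u _ => Submodule.sum_mem _
      fun x _ => Submodule.sum_mem _ fun y _ => balIdeal_gen_mem _ _

/-- The comultiplication `Δ_L : A_σ → A_σ ⊗_L A_σ`, `L = M_Λ(R)`, of the left bialgebroid. -/
def comulL : ASigma K D →ₗ[K] BalTensor (src K D) (tgt K D) :=
  PresAlg.linLift ((balIdeal (src K D) (tgt K D)).mkQ ∘ₗ (comulFree D).toLinearMap) (fun x hx => by
    have := map_span_mem_balIdeal (comulFree D).toLinearMap (map_mul (comulFree D))
      (fun _ h => comulFree_rel D h) (comulFree_mul_mem D) x hx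
    simpa using this)

/-- The algebra map `K⟨ΛX⟩ → End_K(M_Λ(R))`: `f ⊗ g` acts by `h ↦ f h g`, `L_{ab}` by
`δ_{ab} T_{deg a}` and `(L⁻¹)_{ab}` by `δ_{ab} T_{(deg a)⁻¹}`. -/
def actFree : FreeAlgebra K (Gen K Λ X R) →ₐ[K] Module.End K (Λ → R) :=
  FreeAlgebra.lift K fun g => match g with
    | .scal ξ => AlgHom.mulLeftRight K (Λ → R) ξ
    | .L a b => if a = b then (shift K (D.deg a)).toLinearMap else 0
    | .Linv a b => if a = b then (shift K (D.deg a)⁻¹).toLinearMap else 0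

theorem actFree_scal (ξ : (Λ → R) ⊗[K] (Λ → R)ᵐᵒᵖ) :
    actFree D (gScal ξ) = AlgHom.mulLeftRight K (Λ → R) ξ := by
  simp [actFree, gScal]

theorem actFree_L (a b : X) : actFree D (gL K R Λ a b) =
    if a = b then (shift K (D.deg a)).toLinearMap else 0 := by
  simp [actFree, gL]

theorem actFree_Linv (a b : X) : actFree D (gLinv K R Λ a b) =
    if a = b then (shift K (D.deg a)⁻¹).toLinearMap else 0 := by
  simp [actFree, gLinv]

theorem actFree_rel (z : FreeAlgebra K (Gen K Λ X R)) (h : SigmaRel K D z) : actFree D z = 0 := by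
  cases h with
  | add ξ ξ' => rw [map_sub, sub_eq_zero]; simp only [map_add, actFree_scal]
  | smul c ξ => rw [map_sub, sub_eq_zero]; simp only [map_smul, actFree_scal]
  | mul ξ ξ' => rw [map_sub, sub_eq_zero]; simp only [map_mul, actFree_scal]
  | one => rw [map_sub, sub_eq_zero]; simp only [map_one, actFree_scal]
  | L_Linv a b =>
    rw [map_sub, sub_eq_zero, apply_ite (actFree D), map_one, map_zero]
    simp only [map_sum, map_mul, actFree_L, actFree_Linv, ite_mul, zero_mul,
      Finset.sum_ite_eq, Finset.mem_univ, if_true]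
    split_ifs with hab
    · ext f l; simp [shift_apply]
    · simp
  | Linv_L a b =>
    rw [map_sub, sub_eq_zero, apply_ite (actFree D), map_one, map_zero]
    simp only [map_sum, map_mul, actFree_L, actFree_Linv, ite_mul, zero_mul,
      Finset.sum_ite_eq, Finset.mem_univ, if_true]
    split_ifs with hab
    · ext f l; simp [shift_apply]
    · simp
  | L_left f a b =>
    rw [map_sub, sub_eq_zero]
    simp only [map_mul, actFree_L, actFree_scal]
    split_ifs with hab
    · ext g l; simp [inl, shift_apply]
    · simp
  | L_right f a b =>
    rw [map_sub, sub_eq_zero]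
    simp only [map_mul, actFree_L, actFree_scal]
    split_ifs with hab
    · subst hab; ext g l; simp [inr, shift_apply]
    · simp
  | Linv_left f a b =>
    rw [map_sub, sub_eq_zero]
    simp only [map_mul, actFree_Linv, actFree_scal]
    split_ifs with hab
    · subst hab; ext g l; simp [inl, shift_apply]
    · simp
  | Linv_right f a b =>
    rw [map_sub, sub_eq_zero]
    simp only [map_mul, actFree_Linv, actFree_scal]
    split_ifs with hab
    · ext g l; simp [inr, shift_apply]
    · simp
  | exch a b c d =>
    rw [map_sub, sub_eq_zero]
    simp only [map_sum, map_mul, actFree_L, actFree_scal]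
    simp only [mul_ite, ite_mul, mul_zero, zero_mul, Finset.sum_ite_eq, Finset.sum_ite_eq',
      Finset.mem_univ, if_true]
    ext g l
    have hc := Subring.mem_center_iff.1 (D.central b d a c l)
    by_cases hl : D.deg b (D.deg d l) = D.deg a (D.deg c l)
    · simp [inl, inr, shift_apply, hc, hl]
    · simp [inl, inr, shift_apply, D.invariant a b c d l hl]

/-- The algebra map `χ : A_σ → End_K(M_Λ(R))`. -/
def act : ASigma K D →ₐ[K] Module.End K (Λ → R) := PresAlg.algLift (actFree D) (actFree_rel D)

/-- The counit `π(a) = χ(a)(1)` of the left bialgebroid `A_σ`. -/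
def counitL : ASigma K D →ₗ[K] (Λ → R) := LinearMap.applyₗ 1 ∘ₗ (act D).toLinearMap

variable [Fintype Λ] [DecidableEq Λ] (F : FrobeniusSystem K R)

/-- The comultiplication `Δ(a) = t(e⁽¹⁾) a_{[1]} ⊗ s(e⁽²⁾) a_{[2]}` of the weak bialgebra `A_σ`. -/
def comul : ASigma K D →ₗ[K] ASigma K D ⊗[K] ASigma K D :=
  (F.pi Λ).section' (src K D) (tgt K D) ∘ₗ comulL D

/-- The counit `ε = ψ ∘ π` of the weak bialgebra `A_σ`. -/
def counit : ASigma K D →ₗ[K] K := (F.pi Λ).ψ ∘ₗ counitL D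

end ASigma

/-! ### The algebra `𝔊(Q)` of a quiver -/

/-- A quiver over `Λ` with set of arrows `Q`. -/
structure LQuiver (Λ Q : Type*) where
  s : Q → Λ
  t : Q → Λ

namespace LQuiver

variable {Λ Q : Type*} (𝒬 : LQuiver Λ Q)

/-- The list of arrows is composable and starts at the given vertex. -/
def IsChain : Λ → List Q → Prop
  | _, [] => True
  | v, q :: l => 𝒬.s q = v ∧ IsChain (𝒬.t q) l

/-- The end point of a composable list of arrows starting at the given vertex. -/
def endpt : Λ → List Q → Λ
  | v, [] => v
  | _, q :: l => endpt (𝒬.t q) l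

theorem isChain_append {v : Λ} {l l' : List Q} :
    𝒬.IsChain v (l ++ l') ↔ 𝒬.IsChain v l ∧ 𝒬.IsChain (𝒬.endpt v l) l' := by
  induction l generalizing v with
  | nil => simp [IsChain, endpt]
  | cons q l ih => simp [IsChain, endpt, ih, and_assoc]

theorem endpt_append {v : Λ} {l l' : List Q} :
    𝒬.endpt v (l ++ l') = 𝒬.endpt (𝒬.endpt v l) l' := by
  induction l generalizing v with
  | nil => rfl
  | cons q l ih => simp [endpt, ih]

/-- A path in the quiver. The paths with `m` arrows form the fibre product `Q^{(m)}`; for `m = 0`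
such a path is a vertex, and for `m > 0` its starting vertex is determined by the first arrow. -/
@[ext]
structure QPath where
  src : Λ
  arrows : List Q
  chain : 𝒬.IsChain src arrows

namespace QPath

variable {𝒬}

instance [DecidableEq Λ] [DecidableEq Q] : DecidableEq 𝒬.QPath := fun p q =>
  decidable_of_iff (p.src = q.src ∧ p.arrows = q.arrows) QPath.ext_iff.symm

/-- The number of arrows of a path. -/
def length (p : 𝒬.QPath) : ℕ := p.arrows.length

/-- The target of a path. -/
def tgt (p : 𝒬.QPath) : Λ := 𝒬.endpt p.src p.arrows

variable (𝒬) in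
/-- The path of length `0` at a vertex. -/
def vertex (v : Λ) : 𝒬.QPath := ⟨v, [], trivial⟩

variable (𝒬) in
/-- The path of length `1` given by an arrow. -/
def arrow (q : Q) : 𝒬.QPath := ⟨𝒬.s q, [q], rfl, trivial⟩

/-- The concatenation of paths. -/
def append (p p' : 𝒬.QPath) (h : p.tgt = p'.src) : 𝒬.QPath :=
  ⟨p.src, p.arrows ++ p'.arrows, 𝒬.isChain_append.2 ⟨p.chain, by
    have := p'.chain; rw [← h] at this; exact this⟩⟩

theorem append_src (p p' : 𝒬.QPath) (h : p.tgt = p'.src) : (p.append p' h).src = p.src := rfl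

theorem append_tgt (p p' : 𝒬.QPath) (h : p.tgt = p'.src) : (p.append p' h).tgt = p'.tgt := by
  simp only [tgt, append, endpt_append]
  rw [← h]; rfl

theorem append_length (p p' : 𝒬.QPath) (h : p.tgt = p'.src) :
    (p.append p' h).length = p.length + p'.length := by
  simp [append, length]

instance [Fintype Λ] [Fintype Q] (m : ℕ) : Fintype {u : 𝒬.QPath // u.length = m} :=
  Fintype.ofInjective
    (fun u => ((u.1.src, ⟨u.1.arrows, u.2⟩) : Λ × List.Vector Q m))
    (fun u v h => by
      exact Subtype.ext (QPath.ext (congrArg Prod.fst h)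
        (congrArg (fun x => x.2.1) h)))

theorem vertex_length (v v' : Λ) : (vertex 𝒬 v).length = (vertex 𝒬 v').length := rfl

theorem arrow_length (q q' : Q) : (arrow 𝒬 q).length = (arrow 𝒬 q').length := rfl

theorem append_inj {p q p' q' : 𝒬.QPath} {h : p.tgt = p'.src} {h' : q.tgt = q'.src}
    (hl : p.length = q.length) : p.append p' h = q.append q' h' ↔ p = q ∧ p' = q' := by
  constructor
  · intro he
    have h1 := congrArg QPath.src he
    have h2 := List.append_inj (congrArg QPath.arrows he) hl
    have hpq : p = q := QPath.ext h1 h2.1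
    subst hpq
    exact ⟨rfl, QPath.ext (h.symm.trans h') h2.2⟩
  · rintro ⟨rfl, rfl⟩; rfl

/-- A sum over the paths of length `m + n` is a sum over composable pairs. -/
theorem sum_append [Fintype Λ] [Fintype Q] [DecidableEq Λ] {N : Type*} [AddCommMonoid N]
    (m n : ℕ) (f : 𝒬.QPath → N) :
    ∑ w : {u : 𝒬.QPath // u.length = m + n}, f w.1 =
      ∑ u : {u : 𝒬.QPath // u.length = m}, ∑ v : {u : 𝒬.QPath // u.length = n},
        if h : u.1.tgt = v.1.src then f (u.1.append v.1 h) else 0 := by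
  rw [← Fintype.sum_prod_type' (fun (u : {u : 𝒬.QPath // u.length = m})
    (v : {u : 𝒬.QPath // u.length = n}) =>
    if h : u.1.tgt = v.1.src then f (u.1.append v.1 h) else 0)]
  rw [Finset.sum_dite, Finset.sum_const_zero, add_zero]
  symm
  refine Finset.sum_bij
    (fun x _ => (⟨x.1.1.1.append x.1.2.1 (by simpa using (Finset.mem_filter.1 x.2).2), by
      rw [append_length, x.1.1.2, x.1.2.2]⟩ : {u : 𝒬.QPath // u.length = m + n}))
    (fun _ _ => Finset.mem_univ _) ?_ ?_ (fun _ _ => rfl)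
  · rintro ⟨⟨u, v⟩, h1⟩ _ ⟨⟨u', v'⟩, h2⟩ _ he
    have := (append_inj (h := (Finset.mem_filter.1 h1).2) (h' := (Finset.mem_filter.1 h2).2)
      (u.2.trans u'.2.symm)).1 (congrArg Subtype.val he)
    apply Subtype.ext
    exact Prod.ext (Subtype.ext this.1) (Subtype.ext this.2)
  · rintro ⟨w, hw⟩ _
    have hc := w.chain
    rw [← List.take_append_drop m w.arrows, isChain_append] at hc
    have hw' : w.arrows.length = m + n := hw
    let u : 𝒬.QPath := ⟨w.src, w.arrows.take m, hc.1⟩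
    let v : 𝒬.QPath := ⟨𝒬.endpt w.src (w.arrows.take m), w.arrows.drop m, hc.2⟩
    have hu : u.length = m := by simp [u, length, hw']
    have hv : v.length = n := by simp [v, length, hw']
    refine ⟨⟨(⟨u, hu⟩, ⟨v, hv⟩), Finset.mem_filter.2 ⟨Finset.mem_univ _, rfl⟩⟩,
      Finset.mem_attach _ _, ?_⟩
    apply Subtype.ext
    exact QPath.ext rfl (List.take_append_drop m w.arrows)

theorem sum_arrow [Fintype Λ] [Fintype Q] {N : Type*} [AddCommMonoid N] (n : ℕ) (hn : n = 1)
    (f : {u : 𝒬.QPath // u.length = n} → N) :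
    ∑ u, f u = ∑ q : Q, f ⟨arrow 𝒬 q, hn.symm⟩ := by
  subst hn
  symm
  refine Fintype.sum_bijective (fun q : Q => (⟨arrow 𝒬 q, rfl⟩ : {u : 𝒬.QPath // u.length = 1}))
    ⟨fun q q' h => ?_, fun u => ?_⟩ _ _ (fun _ => rfl)
  · have := congrArg (fun x => x.1.arrows) h
    simpa [arrow] using this
  · obtain ⟨⟨v, l, hc⟩, hl⟩ := u
    obtain ⟨q, rfl⟩ := List.length_eq_one_iff.1 hl
    exact ⟨q, Subtype.ext (QPath.ext hc.1 rfl)⟩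

end QPath

/-- The fibre product `Q^{(2)}` of composable pairs of arrows. -/
abbrev Comp2 : Type _ := {x : Q × Q // 𝒬.t x.1 = 𝒬.s x.2}

variable {𝒬} in
theorem QPath.arrow_comp (x : 𝒬.Comp2) : (arrow 𝒬 x.1.1).tgt = (arrow 𝒬 x.1.2).src := x.2

/-- Pairs of paths of the same length, the index set of the basis of `𝔊(Q)`. -/
abbrev PathPair : Type _ := {pq : 𝒬.QPath × 𝒬.QPath // pq.1.length = pq.2.length}

/-- The vector space `𝔊(Q)` with basis `e[p; q]`, `p, q ∈ Q^{(m)}`, `m ≥ 0`. -/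
def FaceAlg (K : Type*) [Field K] {Λ Q : Type*} (𝒬 : LQuiver Λ Q) : Type _ := 𝒬.PathPair →₀ K

namespace FaceAlg

variable (K : Type*) [Field K]

instance : AddCommGroup (FaceAlg K 𝒬) := inferInstanceAs (AddCommGroup (𝒬.PathPair →₀ K))

instance : Module K (FaceAlg K 𝒬) := inferInstanceAs (Module K (𝒬.PathPair →₀ K))

variable {𝒬}

/-- The basis element `e[p; q]`. -/
def e (p q : 𝒬.QPath) (h : p.length = q.length) : FaceAlg K 𝒬 := Finsupp.single ⟨(p, q), h⟩ 1

variable {K}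

/-- The linear map with prescribed values on the basis. -/
def lin {N : Type*} [AddCommGroup N] [Module K N] (g : 𝒬.PathPair → N) : FaceAlg K 𝒬 →ₗ[K] N :=
  Finsupp.linearCombination K g

@[simp]
theorem lin_e {N : Type*} [AddCommGroup N] [Module K N] (g : 𝒬.PathPair → N) (p q : 𝒬.QPath)
    (h : p.length = q.length) : lin g (e K p q h) = g ⟨(p, q), h⟩ :=
  (Finsupp.linearCombination_single K 1 (⟨(p, q), h⟩ : 𝒬.PathPair)).trans (one_smul K _)

theorem induction_e {P : FaceAlg K 𝒬 → Prop} (x : FaceAlg K 𝒬) (h0 : P 0)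
    (hadd : ∀ x y, P x → P y → P (x + y)) (hsmul : ∀ (c : K) x, P x → P (c • x))
    (he : ∀ p q h, P (e K p q h)) : P x := by
  induction x using Finsupp.induction_linear with
  | zero => exact h0
  | add x y hx hy => exact hadd x y hx hy
  | single a c =>
    have : (Finsupp.single a c : 𝒬.PathPair →₀ K) = c • Finsupp.single a 1 := by simp
    rw [this]
    exact hsmul c _ (he a.1.1 a.1.2 a.2)

variable [DecidableEq Λ]

variable (K) in
/-- The product of two basis elements:
`e[p; q] e[p'; q'] = δ_{t(p), s(p')} δ_{t(q), s(q')} e[p p'; q q']`. -/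
def mulBasis (a b : 𝒬.PathPair) : FaceAlg K 𝒬 :=
  if h : a.1.1.tgt = b.1.1.src ∧ a.1.2.tgt = b.1.2.src then
    e K (a.1.1.append b.1.1 h.1) (a.1.2.append b.1.2 h.2)
      (by rw [QPath.append_length, QPath.append_length, a.2, b.2])
  else 0

instance : Mul (FaceAlg K 𝒬) := ⟨fun x y => lin (fun a => lin (fun b => mulBasis K a b)) x y⟩

theorem mul_def (x y : FaceAlg K 𝒬) :
    x * y = lin (fun a => lin (fun b => mulBasis K a b)) x y := rfl

theorem e_mul_e (p q p' q' : 𝒬.QPath) (h : p.length = q.length) (h' : p'.length = q'.length) :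
    e K p q h * e K p' q' h' =
      if c : p.tgt = p'.src ∧ q.tgt = q'.src then
        e K (p.append p' c.1) (q.append q' c.2)
          (by rw [QPath.append_length, QPath.append_length, h, h'])
      else 0 := by
  rw [mul_def, lin_e, lin_e]; rfl

variable [Fintype Λ]

instance : One (FaceAlg K 𝒬) :=
  ⟨∑ v : Λ, ∑ v' : Λ, e K (QPath.vertex 𝒬 v) (QPath.vertex 𝒬 v') (QPath.vertex_length v v')⟩

theorem one_def : (1 : FaceAlg K 𝒬) =
    ∑ v : Λ, ∑ v' : Λ, e K (QPath.vertex 𝒬 v) (QPath.vertex 𝒬 v') (QPath.vertex_length v v') := rfl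

theorem add_mul_aux (x y z : FaceAlg K 𝒬) : (x + y) * z = x * z + y * z := by
  simp only [mul_def, map_add, LinearMap.add_apply]

theorem mul_add_aux (x y z : FaceAlg K 𝒬) : x * (y + z) = x * y + x * z := by
  simp only [mul_def, map_add]

theorem smul_mul_aux (c : K) (x y : FaceAlg K 𝒬) : (c • x) * y = c • (x * y) := by
  simp only [mul_def, map_smul, LinearMap.smul_apply]

theorem mul_smul_aux (c : K) (x y : FaceAlg K 𝒬) : x * (c • y) = c • (x * y) := by
  simp only [mul_def, map_smul]

theorem zero_mul_aux (x : FaceAlg K 𝒬) : 0 * x = 0 := by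
  simp only [mul_def, map_zero, LinearMap.zero_apply]

theorem mul_zero_aux (x : FaceAlg K 𝒬) : x * 0 = 0 := by
  simp only [mul_def, map_zero]

theorem sum_mul_aux {ι : Type*} (s : Finset ι) (f : ι → FaceAlg K 𝒬) (x : FaceAlg K 𝒬) :
    (∑ i ∈ s, f i) * x = ∑ i ∈ s, f i * x := by
  simp only [mul_def, map_sum, LinearMap.sum_apply]

theorem mul_sum_aux {ι : Type*} (s : Finset ι) (f : ι → FaceAlg K 𝒬) (x : FaceAlg K 𝒬) :
    x * (∑ i ∈ s, f i) = ∑ i ∈ s, x * f i := by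
  simp only [mul_def, map_sum]

theorem mul_assoc_aux (x y z : FaceAlg K 𝒬) : x * y * z = x * (y * z) := by
  induction x using induction_e with
  | h0 => simp only [zero_mul_aux]
  | hadd a b ha hb => simp only [add_mul_aux, ha, hb]
  | hsmul c a ha => simp only [smul_mul_aux, ha]
  | he p q h =>
  induction y using induction_e with
  | h0 => simp only [zero_mul_aux, mul_zero_aux]
  | hadd a b ha hb => simp only [add_mul_aux, mul_add_aux, ha, hb]
  | hsmul c a ha => simp only [smul_mul_aux, mul_smul_aux, ha]
  | he p' q' h' =>
  induction z using induction_e with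
  | h0 => simp only [mul_zero_aux]
  | hadd a b ha hb => simp only [mul_add_aux, ha, hb]
  | hsmul c a ha => simp only [mul_smul_aux, ha]
  | he p'' q'' h'' =>
  by_cases c1 : p.tgt = p'.src ∧ q.tgt = q'.src
  · by_cases c2 : p'.tgt = p''.src ∧ q'.tgt = q''.src
    · rw [e_mul_e, dif_pos c1, e_mul_e, dif_pos (by simpa [QPath.append_tgt] using c2),
        e_mul_e, dif_pos c2, e_mul_e, dif_pos (by simpa [QPath.append] using c1)]
      congr 1 <;> simp [QPath.append, List.append_assoc]
    · rw [e_mul_e, dif_pos c1, e_mul_e, dif_neg (by simpa [QPath.append_tgt] using c2),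
        e_mul_e, dif_neg c2, mul_zero_aux]
  · rw [e_mul_e, dif_neg c1, zero_mul_aux]
    by_cases c2 : p'.tgt = p''.src ∧ q'.tgt = q''.src
    · rw [e_mul_e, dif_pos c2, e_mul_e, dif_neg (by simpa [QPath.append] using c1)]
    · rw [e_mul_e, dif_neg c2, mul_zero_aux]

theorem vertex_mul_e (v v' : Λ) (p q : 𝒬.QPath) (h : p.length = q.length) :
    e K (QPath.vertex 𝒬 v) (QPath.vertex 𝒬 v') (QPath.vertex_length v v') * e K p q h =
      if v = p.src ∧ v' = q.src then e K p q h else 0 := by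
  rw [e_mul_e]
  by_cases c : v = p.src ∧ v' = q.src
  · obtain ⟨rfl, rfl⟩ := c
    rw [dif_pos ⟨rfl, rfl⟩, if_pos ⟨rfl, rfl⟩]
    congr 1
  · rw [if_neg c]
    exact dif_neg c

theorem e_mul_vertex (v v' : Λ) (p q : 𝒬.QPath) (h : p.length = q.length) :
    e K p q h * e K (QPath.vertex 𝒬 v) (QPath.vertex 𝒬 v') (QPath.vertex_length v v') =
      if p.tgt = v ∧ q.tgt = v' then e K p q h else 0 := by
  rw [e_mul_e]
  by_cases c : p.tgt = v ∧ q.tgt = v'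
  · obtain ⟨rfl, rfl⟩ := c
    rw [dif_pos ⟨rfl, rfl⟩, if_pos ⟨rfl, rfl⟩]
    congr 1 <;> simp [QPath.append, QPath.vertex]
  · rw [if_neg c]
    exact dif_neg c

theorem one_mul_aux (x : FaceAlg K 𝒬) : 1 * x = x := by
  induction x using induction_e with
  | h0 => rw [mul_zero_aux]
  | hadd a b ha hb => rw [mul_add_aux, ha, hb]
  | hsmul c a ha => rw [mul_smul_aux, ha]
  | he p q h =>
    simp only [one_def, sum_mul_aux, vertex_mul_e]
    rw [Finset.sum_eq_single p.src]
    · simp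
    · intro b _ hb; simp [hb]
    · simp

theorem mul_one_aux (x : FaceAlg K 𝒬) : x * 1 = x := by
  induction x using induction_e with
  | h0 => rw [zero_mul_aux]
  | hadd a b ha hb => rw [add_mul_aux, ha, hb]
  | hsmul c a ha => rw [smul_mul_aux, ha]
  | he p q h =>
    simp only [one_def, mul_sum_aux, e_mul_vertex]
    rw [Finset.sum_eq_single p.tgt]
    · simp
    · intro b _ hb; simp [hb.symm]
    · simp

instance : Ring (FaceAlg K 𝒬) :=
  { (inferInstance : AddCommGroup (FaceAlg K 𝒬)), (inferInstance : Mul (FaceAlg K 𝒬)),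
    (inferInstance : One (FaceAlg K 𝒬)) with
    left_distrib := mul_add_aux
    right_distrib := add_mul_aux
    zero_mul := zero_mul_aux
    mul_zero := mul_zero_aux
    mul_assoc := mul_assoc_aux
    one_mul := one_mul_aux
    mul_one := mul_one_aux }

instance : Algebra K (FaceAlg K 𝒬) := Algebra.ofModule smul_mul_aux mul_smul_aux

theorem lin_mul {B : Type*} [Ring B] [Algebra K B] (g : 𝒬.PathPair → B)
    (hg : ∀ a b, lin g (mulBasis K a b) = g a * g b) (x y : FaceAlg K 𝒬) :
    lin g (x * y) = lin g x * lin g y := by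
  induction x using induction_e with
  | h0 => simp
  | hadd a b ha hb => simp only [add_mul, map_add, ha, hb]
  | hsmul c a ha => simp only [smul_mul_assoc, map_smul, ha]
  | he p q h =>
  induction y using induction_e with
  | h0 => simp
  | hadd a b ha hb => simp only [mul_add, map_add, ha, hb]
  | hsmul c a ha => simp only [mul_smul_comm, map_smul, ha]
  | he p' q' h' =>
    rw [lin_e, lin_e, ← hg, mul_def, lin_e, lin_e]

/-- The algebra map out of `𝔊(Q)` with prescribed values on the basis. -/
def algHom {B : Type*} [Ring B] [Algebra K B] (g : 𝒬.PathPair → B)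
    (hg : ∀ a b, lin g (mulBasis K a b) = g a * g b)
    (h1 : ∑ v : Λ, ∑ v' : Λ, g ⟨(QPath.vertex 𝒬 v, QPath.vertex 𝒬 v'), QPath.vertex_length v v'⟩ = 1) :
    FaceAlg K 𝒬 →ₐ[K] B :=
  AlgHom.ofLinearMap (lin g) (by simp [one_def, h1]) (lin_mul g hg)

@[simp]
theorem algHom_e {B : Type*} [Ring B] [Algebra K B] (g : 𝒬.PathPair → B)
    (hg : ∀ a b, lin g (mulBasis K a b) = g a * g b)
    (h1 : ∑ v : Λ, ∑ v' : Λ, g ⟨(QPath.vertex 𝒬 v, QPath.vertex 𝒬 v'), QPath.vertex_length v v'⟩ = 1)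
    (p q : 𝒬.QPath) (h : p.length = q.length) :
    algHom g hg h1 (e K p q h) = g ⟨(p, q), h⟩ := lin_e g p q h

variable [Fintype Q]

/-- The map `e[p; q] ↦ ∑_{u ∈ Q^{(m)}} e[p; u] ⊗ e[u; q]` on `𝔊(Q)`. -/
def comul (K : Type*) [Field K] (𝒬 : LQuiver Λ Q) : FaceAlg K 𝒬 →ₗ[K] FaceAlg K 𝒬 ⊗[K] FaceAlg K 𝒬 :=
  lin fun a => ∑ u : {u : 𝒬.QPath // u.length = a.1.1.length},
    e K a.1.1 u.1 u.2.symm ⊗ₜ[K] e K u.1 a.1.2 (u.2.trans a.2)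

theorem comul_e (p q : 𝒬.QPath) (h : p.length = q.length) :
    comul K 𝒬 (e K p q h) = ∑ u : {u : 𝒬.QPath // u.length = p.length},
      e K p u.1 u.2.symm ⊗ₜ[K] e K u.1 q (u.2.trans h) := by
  rw [comul, lin_e]

theorem comul_mul (x y : FaceAlg K 𝒬) : comul K 𝒬 (x * y) = comul K 𝒬 x * comul K 𝒬 y := by
  refine lin_mul _ ?_ x y
  rintro ⟨⟨p, q⟩, h⟩ ⟨⟨p', q'⟩, h'⟩
  dsimp only at h h' ⊢
  have hq : ∀ {n m} (hmn : n = m) (f : {u : 𝒬.QPath // u.length = n} → FaceAlg K 𝒬 ⊗[K] FaceAlg K 𝒬),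
      ∑ u, f u = ∑ u : {u : 𝒬.QPath // u.length = m}, f ⟨u.1, u.2.trans hmn.symm⟩ := by
    rintro n _ rfl f; rfl
  simp only [Finset.sum_mul_sum, Algebra.TensorProduct.tmul_mul_tmul, e_mul_e, mulBasis]
  by_cases c : p.tgt = p'.src ∧ q.tgt = q'.src
  · rw [dif_pos c, lin_e]
    dsimp only
    rw [hq (QPath.append_length p p' c.1)]
    let E : 𝒬.QPath → FaceAlg K 𝒬 ⊗[K] FaceAlg K 𝒬 := fun w =>
      if hw : w.length = p.length + p'.length then
        e K (p.append p' c.1) w (by rw [QPath.append_length, hw]) ⊗ₜ[K]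
          e K w (q.append q' c.2) (by rw [QPath.append_length, hw, h, h'])
      else 0
    calc _ = ∑ w : {u : 𝒬.QPath // u.length = p.length + p'.length}, E w.1 := by
          refine Finset.sum_congr rfl fun w _ => ?_
          simp only [E]
          rw [dif_pos w.2]
      _ = _ := by
          rw [QPath.sum_append]
          refine Finset.sum_congr rfl fun u _ => Finset.sum_congr rfl fun v _ => ?_
          by_cases huv : u.1.tgt = v.1.src
          · rw [dif_pos huv, dif_pos ⟨c.1, huv⟩, dif_pos ⟨huv, c.2⟩]
            simp only [E]
            rw [dif_pos (by rw [QPath.append_length, u.2, v.2])]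
          · rw [dif_neg huv, dif_neg (fun hh => huv hh.2)]
            simp
  · rw [dif_neg c, map_zero]
    symm
    refine Finset.sum_eq_zero fun u _ => Finset.sum_eq_zero fun v _ => ?_
    by_cases c1 : p.tgt = p'.src
    · rw [dif_neg (c := _ ∧ q.tgt = q'.src) (fun hh => c ⟨c1, hh.2⟩), TensorProduct.tmul_zero]
    · rw [dif_neg (fun hh => c1 hh.1), TensorProduct.zero_tmul]

end FaceAlg

end LQuiver

/-! ### The algebra `𝔄(w)` -/

/-- A family `w` with values in `R`, where `w (a, b) (c, d)` has `a` on top, `b` on the right, `c` on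
the left and `d` at the bottom, for `(a, b), (c, d) ∈ Q^{(2)}`. The values are central in `R`, and
they vanish unless `s(a) = s(c)` and `t(b) = t(d)`. -/
structure FaceWeights {Λ Q : Type*} (𝒬 : LQuiver Λ Q) (R : Type*) [Ring R] where
  w : 𝒬.Comp2 → 𝒬.Comp2 → R
  central : ∀ ab cd, w ab cd ∈ Subring.center R
  vanish : ∀ ab cd : 𝒬.Comp2,
    𝒬.s ab.1.1 ≠ 𝒬.s cd.1.1 ∨ 𝒬.t ab.1.2 ≠ 𝒬.t cd.1.2 → w ab cd = 0

/-- The algebra `ℌ(Q) = R ⊗ Rᵒᵖ ⊗ 𝔊(Q)`. -/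
abbrev HFace (K R : Type*) [Field K] [Ring R] [Algebra K R] {Λ Q : Type*} [Fintype Λ]
    [DecidableEq Λ] (𝒬 : LQuiver Λ Q) : Type _ := (R ⊗[K] Rᵐᵒᵖ) ⊗[K] LQuiver.FaceAlg K 𝒬

namespace HFace

open LQuiver LQuiver.FaceAlg

variable (K R : Type*) [Field K] [Ring R] [Algebra K R] {Λ Q : Type*} [Fintype Λ] [DecidableEq Λ]
  (𝒬 : LQuiver Λ Q)

/-- `e[p; q]` for arrows `p`, `q`. -/
def eA {Λ Q : Type*} (𝒬 : LQuiver Λ Q) (p q : Q) : FaceAlg K 𝒬 :=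
  e K (QPath.arrow 𝒬 p) (QPath.arrow 𝒬 q) (QPath.arrow_length p q)

/-- `e[p; q]` for vertices `p`, `q`. -/
def eV {Λ Q : Type*} (𝒬 : LQuiver Λ Q) (p q : Λ) : FaceAlg K 𝒬 :=
  e K (QPath.vertex 𝒬 p) (QPath.vertex 𝒬 q) (QPath.vertex_length p q)

/-- `f ↦ ∑_{λ, μ} f(λ) ⊗ 1 ⊗ e[λ; μ]` as a linear map. -/
def srcLin : (Λ → R) →ₗ[K] HFace K R 𝒬 where
  toFun f := ∑ v : Λ, ∑ v' : Λ, (f v ⊗ₜ[K] (1 : Rᵐᵒᵖ)) ⊗ₜ[K] eV K 𝒬 v v'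
  map_add' f g := by simp only [Pi.add_apply, TensorProduct.add_tmul, Finset.sum_add_distrib]
  map_smul' c f := by
    simp only [Pi.smul_apply, ← TensorProduct.smul_tmul', Finset.smul_sum, RingHom.id_apply]

/-- `f ↦ ∑_{λ, μ} 1 ⊗ f(λ) ⊗ e[μ; λ]` as a linear map. -/
def tgtLin : (Λ → R)ᵐᵒᵖ →ₗ[K] HFace K R 𝒬 where
  toFun f := ∑ v : Λ, ∑ v' : Λ, ((1 : R) ⊗ₜ[K] MulOpposite.op (f.unop v)) ⊗ₜ[K] eV K 𝒬 v' v
  map_add' f g := by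
    simp only [MulOpposite.unop_add, Pi.add_apply, MulOpposite.op_add, TensorProduct.add_tmul,
      TensorProduct.tmul_add, Finset.sum_add_distrib]
  map_smul' c f := by
    simp only [MulOpposite.unop_smul, Pi.smul_apply, MulOpposite.op_smul, TensorProduct.tmul_smul,
      ← TensorProduct.smul_tmul', Finset.smul_sum, RingHom.id_apply]

variable {K R 𝒬}

theorem srcLin_apply (f : Λ → R) : srcLin K R 𝒬 f =
    ∑ v : Λ, ∑ v' : Λ, (f v ⊗ₜ[K] (1 : Rᵐᵒᵖ)) ⊗ₜ[K] eV K 𝒬 v v' := rfl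

theorem tmul_mul_src (z : R ⊗[K] Rᵐᵒᵖ) (p q : 𝒬.QPath) (h : p.length = q.length) (f : Λ → R) :
    (z ⊗ₜ[K] e K p q h) * srcLin K R 𝒬 f = (z * (f p.tgt ⊗ₜ[K] 1)) ⊗ₜ[K] e K p q h := by
  simp only [srcLin, LinearMap.coe_mk, AddHom.coe_mk, Finset.mul_sum, eV,
    Algebra.TensorProduct.tmul_mul_tmul, e_mul_vertex]
  rw [Finset.sum_eq_single p.tgt]
  · rw [← TensorProduct.tmul_sum]; simp
  · intro b _ hb; simp [hb.symm]
  · simp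

theorem src_mul_tmul (z : R ⊗[K] Rᵐᵒᵖ) (p q : 𝒬.QPath) (h : p.length = q.length) (f : Λ → R) :
    srcLin K R 𝒬 f * (z ⊗ₜ[K] e K p q h) = ((f p.src ⊗ₜ[K] 1) * z) ⊗ₜ[K] e K p q h := by
  simp only [srcLin, LinearMap.coe_mk, AddHom.coe_mk, Finset.sum_mul, eV,
    Algebra.TensorProduct.tmul_mul_tmul, vertex_mul_e]
  rw [Finset.sum_eq_single p.src]
  · rw [← TensorProduct.tmul_sum]; simp
  · intro b _ hb; simp [hb]
  · simp

theorem tgtLin_apply (f : (Λ → R)ᵐᵒᵖ) : tgtLin K R 𝒬 f =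
    ∑ v : Λ, ∑ v' : Λ, ((1 : R) ⊗ₜ[K] MulOpposite.op (f.unop v)) ⊗ₜ[K] eV K 𝒬 v' v := rfl

theorem tmul_mul_tgt (z : R ⊗[K] Rᵐᵒᵖ) (p q : 𝒬.QPath) (h : p.length = q.length)
    (f : (Λ → R)ᵐᵒᵖ) : (z ⊗ₜ[K] e K p q h) * tgtLin K R 𝒬 f =
      (z * (1 ⊗ₜ[K] MulOpposite.op (f.unop q.tgt))) ⊗ₜ[K] e K p q h := by
  simp only [tgtLin, LinearMap.coe_mk, AddHom.coe_mk, Finset.mul_sum, eV,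
    Algebra.TensorProduct.tmul_mul_tmul, e_mul_vertex]
  rw [Finset.sum_eq_single q.tgt]
  · rw [← TensorProduct.tmul_sum]; simp
  · intro b _ hb; simp [hb.symm]
  · simp

theorem tgt_mul_tmul (z : R ⊗[K] Rᵐᵒᵖ) (p q : 𝒬.QPath) (h : p.length = q.length)
    (f : (Λ → R)ᵐᵒᵖ) : tgtLin K R 𝒬 f * (z ⊗ₜ[K] e K p q h) =
      ((1 ⊗ₜ[K] MulOpposite.op (f.unop q.src)) * z) ⊗ₜ[K] e K p q h := by
  simp only [tgtLin, LinearMap.coe_mk, AddHom.coe_mk, Finset.sum_mul, eV,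
    Algebra.TensorProduct.tmul_mul_tmul, vertex_mul_e]
  rw [Finset.sum_eq_single q.src]
  · rw [← TensorProduct.tmul_sum]; simp
  · intro b _ hb; simp [hb]
  · simp

theorem srcLin_const (r : R) :
    srcLin K R 𝒬 (fun _ => r) = (r ⊗ₜ[K] 1) ⊗ₜ[K] (1 : FaceAlg K 𝒬) := by
  simp only [srcLin, LinearMap.coe_mk, AddHom.coe_mk, eV, one_def, TensorProduct.tmul_sum]

theorem tgtLin_const (r : R) : tgtLin K R 𝒬 (MulOpposite.op fun _ => r) =
    (1 ⊗ₜ[K] MulOpposite.op r) ⊗ₜ[K] (1 : FaceAlg K 𝒬) := by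
  simp only [tgtLin, LinearMap.coe_mk, AddHom.coe_mk, eV, one_def, TensorProduct.tmul_sum]
  exact Finset.sum_comm

variable (K R 𝒬)

/-- The algebra map `f ↦ ∑_{λ, μ} f(λ) ⊗ 1 ⊗ e[λ; μ]`. -/
def src : (Λ → R) →ₐ[K] HFace K R 𝒬 :=
  AlgHom.ofLinearMap (srcLin K R 𝒬) (srcLin_const 1) (fun f g => by
    rw [srcLin_apply (f * g), srcLin_apply f, Finset.sum_mul]
    simp only [Finset.sum_mul, eV, tmul_mul_src]
    simp [QPath.tgt, QPath.vertex, endpt])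

/-- The algebra map `f ↦ ∑_{λ, μ} 1 ⊗ f(λ) ⊗ e[μ; λ]`. -/
def tgt : (Λ → R)ᵐᵒᵖ →ₐ[K] HFace K R 𝒬 :=
  AlgHom.ofLinearMap (tgtLin K R 𝒬) (tgtLin_const 1) (fun f g => by
    rw [tgtLin_apply (f * g), tgtLin_apply f, Finset.sum_mul]
    simp only [Finset.sum_mul, eV, tmul_mul_tgt]
    simp [QPath.tgt, QPath.vertex, endpt])

variable {R 𝒬} [Fintype Q]

/-- The generators of the ideal `ℑ_w`, indexed by `(a, b), (c, d) ∈ Q^{(2)}`. -/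
def gen (W : FaceWeights 𝒬 R) (ab cd : 𝒬.Comp2) : HFace K R 𝒬 :=
  (∑ xy : 𝒬.Comp2, (W.w xy ab ⊗ₜ[K] (1 : Rᵐᵒᵖ)) ⊗ₜ[K]
      (eA K 𝒬 xy.1.1 cd.1.1 * eA K 𝒬 xy.1.2 cd.1.2)) -
    ∑ xy : 𝒬.Comp2, ((1 : R) ⊗ₜ[K] MulOpposite.op (W.w cd xy)) ⊗ₜ[K]
      (eA K 𝒬 ab.1.1 xy.1.1 * eA K 𝒬 ab.1.2 xy.1.2)

end HFace

open LQuiver LQuiver.FaceAlg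

section AFace

variable {K R : Type*} [Field K] [Ring R] [Algebra K R] {Λ Q : Type*} [Fintype Λ] [DecidableEq Λ]
  [Fintype Q] {𝒬 : LQuiver Λ Q}

/-- The algebra `𝔄(w)`. -/
def AFace (K : Type*) [Field K] [Algebra K R] (W : FaceWeights 𝒬 R) : Type _ :=
  PresAlg K {z | ∃ ab cd, z = HFace.gen K W ab cd}

variable (W : FaceWeights 𝒬 R)

instance : Ring (AFace K W) :=
  inferInstanceAs (Ring (PresAlg K {z | ∃ ab cd, z = HFace.gen K W ab cd}))

instance : Algebra K (AFace K W) :=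
  inferInstanceAs (Algebra K (PresAlg K {z | ∃ ab cd, z = HFace.gen K W ab cd}))

namespace AFace

/-- The projection `ℌ(Q) → 𝔄(w)`. -/
def mk : HFace K R 𝒬 →ₐ[K] AFace K W := PresAlg.mk K {z | ∃ ab cd, z = HFace.gen K W ab cd}

/-- The source map `s(f) = ∑_{λ, μ} f(λ) ⊗ 1 ⊗ e[λ; μ] + ℑ_w`. -/
def src (K : Type*) [Field K] [Algebra K R] (W : FaceWeights 𝒬 R) : (Λ → R) →ₐ[K] AFace K W :=
  (mk W).comp (HFace.src K R 𝒬)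

/-- The target map `t(f) = ∑_{λ, μ} 1 ⊗ f(λ) ⊗ e[μ; λ] + ℑ_w`. -/
def tgt (K : Type*) [Field K] [Algebra K R] (W : FaceWeights 𝒬 R) :
    (Λ → R)ᵐᵒᵖ →ₐ[K] AFace K W :=
  (mk W).comp (HFace.tgt K R 𝒬)

/-- The class of `z ⊗ 1`, `z ∈ R ⊗ Rᵒᵖ`. -/
def scal (K : Type*) [Field K] [Algebra K R] (W : FaceWeights 𝒬 R) :
    R ⊗[K] Rᵐᵒᵖ →ₐ[K] AFace K W :=
  (mk W).comp Algebra.TensorProduct.includeLeft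

/-- The class of `1 ⊗ 1 ⊗ x`, `x ∈ 𝔊(Q)`. -/
def face (K : Type*) [Field K] [Algebra K R] (W : FaceWeights 𝒬 R) :
    FaceAlg K 𝒬 →ₐ[K] AFace K W :=
  (mk W).comp Algebra.TensorProduct.includeRight

theorem mk_tmul (z : R ⊗[K] Rᵐᵒᵖ) (x : FaceAlg K 𝒬) :
    mk W (z ⊗ₜ[K] x) = scal K W z * face K W x := by
  simp only [scal, face, AlgHom.comp_apply, ← map_mul]
  simp

theorem scal_face_comm (z : R ⊗[K] Rᵐᵒᵖ) (x : FaceAlg K 𝒬) :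
    face K W x * scal K W z = scal K W z * face K W x := by
  simp only [scal, face, AlgHom.comp_apply, ← map_mul]
  simp

theorem src_const (r : R) : src K W (fun _ => r) = scal K W (r ⊗ₜ[K] 1) :=
  congrArg (mk W) (HFace.srcLin_const r)

theorem tgt_const (r : R) :
    tgt K W (MulOpposite.op fun _ => r) = scal K W (1 ⊗ₜ[K] MulOpposite.op r) :=
  congrArg (mk W) (HFace.tgtLin_const r)

theorem mk_mul_src (z : R ⊗[K] Rᵐᵒᵖ) (p q : 𝒬.QPath) (h : p.length = q.length) (f : Λ → R) :
    mk W (z ⊗ₜ[K] e K p q h) * src K W f = mk W ((z * (f p.tgt ⊗ₜ[K] 1)) ⊗ₜ[K] e K p q h) :=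
  (map_mul (mk W) _ _).symm.trans (congrArg (mk W) (HFace.tmul_mul_src z p q h f))

theorem mk_mul_tgt (z : R ⊗[K] Rᵐᵒᵖ) (p q : 𝒬.QPath) (h : p.length = q.length)
    (f : (Λ → R)ᵐᵒᵖ) : mk W (z ⊗ₜ[K] e K p q h) * tgt K W f =
      mk W ((z * (1 ⊗ₜ[K] MulOpposite.op (f.unop q.tgt))) ⊗ₜ[K] e K p q h) :=
  (map_mul (mk W) _ _).symm.trans (congrArg (mk W) (HFace.tmul_mul_tgt z p q h f))

theorem relation (ab cd : 𝒬.Comp2) :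
    ∑ xy : 𝒬.Comp2, scal K W (W.w xy ab ⊗ₜ[K] (1 : Rᵐᵒᵖ)) *
      face K W (HFace.eA K 𝒬 xy.1.1 cd.1.1 * HFace.eA K 𝒬 xy.1.2 cd.1.2) =
    ∑ xy : 𝒬.Comp2, scal K W ((1 : R) ⊗ₜ[K] MulOpposite.op (W.w cd xy)) *
      face K W (HFace.eA K 𝒬 ab.1.1 xy.1.1 * HFace.eA K 𝒬 ab.1.2 xy.1.2) := by
  have : mk W (HFace.gen K W ab cd) = 0 :=
    PresAlg.mk_eq_zero_of_mem K ⟨ab, cd, rfl⟩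
  rw [HFace.gen, map_sub, sub_eq_zero, map_sum, map_sum] at this
  simpa only [mk_tmul] using this

/-- `r ⊗ r' ↦ (r ⊗ 1 ⊗ 1) ⊗ (1 ⊗ r' ⊗ 1)`. -/
def comulScal : R ⊗[K] Rᵐᵒᵖ →ₐ[K] AFace K W ⊗[K] AFace K W :=
  Algebra.TensorProduct.map ((scal K W).comp Algebra.TensorProduct.includeLeft)
    ((scal K W).comp Algebra.TensorProduct.includeRight)

/-- The map `e[p; q] ↦ ∑_u e[p; u] ⊗ e[u; q]` from `𝔊(Q)` to `𝔄(w) ⊗ 𝔄(w)`. -/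
def comulFace : FaceAlg K 𝒬 →ₗ[K] AFace K W ⊗[K] AFace K W :=
  TensorProduct.map (face K W).toLinearMap (face K W).toLinearMap ∘ₗ FaceAlg.comul K 𝒬

/-- The linear map `∇̄ : ℌ(Q) → 𝔄(w) ⊗ 𝔄(w)`. -/
def comulH : HFace K R 𝒬 →ₗ[K] AFace K W ⊗[K] AFace K W :=
  LinearMap.mul' K _ ∘ₗ TensorProduct.map (comulScal W).toLinearMap (comulFace W)

/-- `∇̄(r ⊗ r' ⊗ e[p; q]) = ∑_u (r ⊗ 1 ⊗ e[p; u]) ⊗ (1 ⊗ r' ⊗ e[u; q])`. -/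
theorem comulH_apply (r : R) (r' : Rᵐᵒᵖ) (p q : 𝒬.QPath) (h : p.length = q.length) :
    comulH W ((r ⊗ₜ[K] r') ⊗ₜ[K] e K p q h) =
      ∑ u : {u : 𝒬.QPath // u.length = p.length},
        mk W ((r ⊗ₜ[K] 1) ⊗ₜ[K] e K p u.1 u.2.symm) ⊗ₜ[K]
          mk W ((1 ⊗ₜ[K] r') ⊗ₜ[K] e K u.1 q (u.2.trans h)) := by
  simp [comulH, comulScal, comulFace, FaceAlg.comul_e, Finset.mul_sum, mk_tmul]

theorem comulScal_comm (z : R ⊗[K] Rᵐᵒᵖ) (x : FaceAlg K 𝒬) :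
    comulFace W x * comulScal W z = comulScal W z * comulFace W x := by
  rw [comulFace, LinearMap.comp_apply]
  generalize FaceAlg.comul K 𝒬 x = y
  induction z with
  | zero => simp
  | add a b ha hb => simp only [map_add, mul_add, add_mul, ha, hb]
  | tmul r r' =>
    induction y with
    | zero => simp
    | add a b ha hb => simp only [map_add, mul_add, add_mul, ha, hb]
    | tmul a b => simp [comulScal, scal_face_comm]

theorem comulFace_mul (x y : FaceAlg K 𝒬) :
    comulFace W (x * y) = comulFace W x * comulFace W y := by
  simp only [comulFace, LinearMap.comp_apply, FaceAlg.comul_mul]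
  exact map_mul (Algebra.TensorProduct.map (face K W) (face K W)) _ _

theorem comulH_tmul (z : R ⊗[K] Rᵐᵒᵖ) (x : FaceAlg K 𝒬) :
    comulH W (z ⊗ₜ[K] x) = comulScal W z * comulFace W x := by
  simp [comulH]

theorem comulH_mul (x y : HFace K R 𝒬) : comulH W (x * y) = comulH W x * comulH W y := by
  induction x using TensorProduct.induction_on with
  | zero => simp
  | add a b ha hb => simp only [map_add, add_mul, ha, hb]
  | tmul z a =>
    induction y using TensorProduct.induction_on with
    | zero => simp
    | add a b ha hb => simp only [map_add, mul_add, ha, hb]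
    | tmul z' a' =>
      rw [Algebra.TensorProduct.tmul_mul_tmul, comulH_tmul, comulH_tmul, comulH_tmul, map_mul,
        comulFace_mul, mul_assoc, mul_assoc, ← mul_assoc (comulFace W a), comulScal_comm,
        mul_assoc]

theorem comulH_mul_mem (b : HFace K R 𝒬) (z : AFace K W ⊗[K] AFace K W)
    (hz : z ∈ balIdeal (src K W) (tgt K W)) :
    comulH W b * z ∈ balIdeal (src K W) (tgt K W) := by
  induction b using TensorProduct.induction_on with
  | zero => simp
  | add a b ha hb => rw [map_add, add_mul]; exact add_mem ha hb
  | tmul ξ x =>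
  induction x using induction_e with
  | h0 => simp
  | hadd a b ha hb => rw [TensorProduct.tmul_add, map_add, add_mul]; exact add_mem ha hb
  | hsmul c a ha =>
    rw [TensorProduct.tmul_smul, map_smul, smul_mul_assoc]; exact Submodule.smul_mem _ _ ha
  | he p q h =>
  induction ξ with
  | zero => simp
  | add a b ha hb => rw [TensorProduct.add_tmul, map_add, add_mul]; exact add_mem ha hb
  | tmul r r' =>
    refine mul_balIdeal_mem (fun l => ?_) hz
    rw [comulH_apply, Finset.sum_mul]
    refine Submodule.sum_mem _ fun u _ => ?_
    have : (mk W ((r ⊗ₜ[K] 1) ⊗ₜ[K] e K p u.1 u.2.symm) ⊗ₜ[K]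
          mk W ((1 ⊗ₜ[K] r') ⊗ₜ[K] e K u.1 q (u.2.trans h))) *
        (tgt K W (MulOpposite.op l) ⊗ₜ[K] (1 : AFace K W) - 1 ⊗ₜ[K] src K W l) =
        (tgt K W (MulOpposite.op fun _ => l u.1.tgt) ⊗ₜ[K] (1 : AFace K W) -
          1 ⊗ₜ[K] src K W (fun _ => l u.1.tgt)) *
        (mk W ((r ⊗ₜ[K] 1) ⊗ₜ[K] e K p u.1 u.2.symm) ⊗ₜ[K]
          mk W ((1 ⊗ₜ[K] r') ⊗ₜ[K] e K u.1 q (u.2.trans h))) := by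
      simp only [mul_sub, sub_mul, Algebra.TensorProduct.tmul_mul_tmul, mk_mul_src, mk_mul_tgt,
        src_const, tgt_const, one_mul, mul_one, MulOpposite.unop_op]
      simp only [mk_tmul, ← mul_assoc, ← map_mul, Algebra.TensorProduct.tmul_mul_tmul, one_mul,
        mul_one]
    rw [this]
    exact balIdeal_gen_mem _ _

theorem sum_comp2 {Λ Q : Type*} [DecidableEq Λ] [Fintype Q] {𝒬 : LQuiver Λ Q} {N : Type*} [AddCommMonoid N] (f : Q → Q → N)
    (hf : ∀ x y, 𝒬.t x ≠ 𝒬.s y → f x y = 0) :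
    ∑ x, ∑ y, f x y = ∑ xy : 𝒬.Comp2, f xy.1.1 xy.1.2 := by
  rw [← Fintype.sum_prod_type' f,
    ← Finset.sum_filter_of_ne (p := fun x : Q × Q => 𝒬.t x.1 = 𝒬.s x.2)
      (fun x _ hx => by_contra fun h => hx (hf x.1 x.2 h))]
  exact Finset.sum_subtype _ (fun x => by simp) (fun x : Q × Q => f x.1 x.2)

theorem eA_mul_eq_zero (x y a b : Q) (h : 𝒬.t x ≠ 𝒬.s y) :
    HFace.eA K 𝒬 x a * HFace.eA K 𝒬 y b = 0 := by
  rw [HFace.eA, HFace.eA, e_mul_e]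
  exact dif_neg fun c => h c.1

theorem comulFace_eA (x a : Q) : comulFace W (HFace.eA K 𝒬 x a) =
    ∑ u : Q, face K W (HFace.eA K 𝒬 x u) ⊗ₜ[K] face K W (HFace.eA K 𝒬 u a) := by
  rw [comulFace, LinearMap.comp_apply, HFace.eA, FaceAlg.comul_e, QPath.sum_arrow (QPath.arrow 𝒬 x).length rfl]
  simp [HFace.eA]

theorem comulFace_eA_mul (x y a b : Q) :
    comulFace W (HFace.eA K 𝒬 x a * HFace.eA K 𝒬 y b) =
    ∑ uv : 𝒬.Comp2, face K W (HFace.eA K 𝒬 x uv.1.1 * HFace.eA K 𝒬 y uv.1.2) ⊗ₜ[K]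
      face K W (HFace.eA K 𝒬 uv.1.1 a * HFace.eA K 𝒬 uv.1.2 b) := by
  rw [comulFace_mul, comulFace_eA, comulFace_eA, Finset.sum_mul_sum]
  rw [← sum_comp2 (𝒬 := 𝒬) (fun u v => face K W (HFace.eA K 𝒬 x u * HFace.eA K 𝒬 y v) ⊗ₜ[K]
      face K W (HFace.eA K 𝒬 u a * HFace.eA K 𝒬 v b)) (fun u v huv => by
        rw [eA_mul_eq_zero u v a b huv, map_zero, TensorProduct.tmul_zero])]
  simp

theorem comulH_gen (ab cd : 𝒬.Comp2) :
    comulH W (HFace.gen K W ab cd) ∈ balIdeal (src K W) (tgt K W) := by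
  have h1 : ∑ xy : 𝒬.Comp2, comulScal W (W.w xy ab ⊗ₜ[K] (1 : Rᵐᵒᵖ)) *
      comulFace W (HFace.eA K 𝒬 xy.1.1 cd.1.1 * HFace.eA K 𝒬 xy.1.2 cd.1.2) =
      ∑ uv : 𝒬.Comp2, ∑ xy : 𝒬.Comp2,
        (tgt K W (MulOpposite.op fun _ => W.w uv xy) ⊗ₜ[K] (1 : AFace K W)) *
        (face K W (HFace.eA K 𝒬 ab.1.1 xy.1.1 * HFace.eA K 𝒬 ab.1.2 xy.1.2) ⊗ₜ[K]
          face K W (HFace.eA K 𝒬 uv.1.1 cd.1.1 * HFace.eA K 𝒬 uv.1.2 cd.1.2)) := by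
    simp only [comulFace_eA_mul, Finset.mul_sum]
    rw [Finset.sum_comm]
    refine Finset.sum_congr rfl fun uv _ => ?_
    simp only [comulScal, Algebra.TensorProduct.map_tmul, map_one,
      Algebra.TensorProduct.tmul_mul_tmul, one_mul, ← TensorProduct.sum_tmul, AlgHom.comp_apply,
      Algebra.TensorProduct.includeLeft_apply, tgt_const, relation]
  have h2 : ∑ xy : 𝒬.Comp2, comulScal W ((1 : R) ⊗ₜ[K] MulOpposite.op (W.w cd xy)) *
      comulFace W (HFace.eA K 𝒬 ab.1.1 xy.1.1 * HFace.eA K 𝒬 ab.1.2 xy.1.2) =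
      ∑ uv : 𝒬.Comp2, ∑ xy : 𝒬.Comp2,
        ((1 : AFace K W) ⊗ₜ[K] src K W (fun _ => W.w uv xy)) *
        (face K W (HFace.eA K 𝒬 ab.1.1 xy.1.1 * HFace.eA K 𝒬 ab.1.2 xy.1.2) ⊗ₜ[K]
          face K W (HFace.eA K 𝒬 uv.1.1 cd.1.1 * HFace.eA K 𝒬 uv.1.2 cd.1.2)) := by
    simp only [comulFace_eA_mul, Finset.mul_sum]
    rw [Finset.sum_comm]
    conv_rhs => rw [Finset.sum_comm]
    refine Finset.sum_congr rfl fun uv _ => ?_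
    simp only [comulScal, Algebra.TensorProduct.map_tmul, map_one,
      Algebra.TensorProduct.tmul_mul_tmul, one_mul, ← TensorProduct.tmul_sum, AlgHom.comp_apply,
      Algebra.TensorProduct.includeRight_apply, src_const, relation]
  rw [HFace.gen, map_sub, map_sum, map_sum]
  simp only [comulH_tmul]
  rw [h1, h2]
  simp only [← Finset.sum_sub_distrib, ← sub_mul]
  exact Submodule.sum_mem _ fun _ _ => Submodule.sum_mem _ fun _ _ => balIdeal_gen_mem _ _

/-- The comultiplication `Δ_L : 𝔄(w) → 𝔄(w) ⊗_L 𝔄(w)`, `L = M_Λ(R)`, of the left bialgebroid. -/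
def comulL : AFace K W →ₗ[K] BalTensor (src K W) (tgt K W) :=
  PresAlg.linLift (s := {z | ∃ ab cd, z = HFace.gen K W ab cd}) ((balIdeal (src K W) (tgt K W)).mkQ ∘ₗ comulH W) (fun x hx => by
    have := map_span_mem_balIdeal (comulH W) (comulH_mul W)
      (S := {z | ∃ ab cd, z = HFace.gen K W ab cd})
      (by rintro _ ⟨ab, cd, rfl⟩; exact comulH_gen W ab cd) (comulH_mul_mem W) x hx
    simpa using this)

variable [DecidableEq Q]

/-- The algebra map `𝔊(Q) → End_K(M_Λ(R))`, `e[p; q] ↦ (f ↦ δ_{p,q} f(t(q)) δ_{s(q)})`. -/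
def actFace (K R : Type*) [Field K] [Ring R] [Algebra K R] (𝒬 : LQuiver Λ Q) :
    FaceAlg K 𝒬 →ₐ[K] Module.End K (Λ → R) :=
  FaceAlg.algHom
    (fun a => if a.1.1 = a.1.2 then
      LinearMap.single K (fun _ => R) a.1.2.src ∘ₗ LinearMap.proj a.1.2.tgt else 0)
    (by
      rintro ⟨⟨p, q⟩, h⟩ ⟨⟨p', q'⟩, h'⟩
      dsimp only at h h' ⊢
      rw [mulBasis]
      dsimp only
      by_cases c1 : p = q
      · subst c1
        by_cases c2 : p' = q'
        · subst c2
          by_cases c : p.tgt = p'.src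
          · rw [dif_pos ⟨c, c⟩, lin_e, if_pos rfl, if_pos rfl, if_pos rfl]
            refine LinearMap.ext fun f => funext fun l => ?_
            simp [QPath.append_tgt, c, QPath.append_src]
          · rw [dif_neg (fun hh => c hh.1), map_zero, if_pos rfl, if_pos rfl]
            refine LinearMap.ext fun f => funext fun l => ?_
            simp [Pi.single_eq_of_ne c]
        · rw [if_neg c2, mul_zero]
          split_ifs with c
          · rw [lin_e, if_neg (fun hh => c2 ((QPath.append_inj h).1 hh).2)]
          · simp
      · rw [if_neg c1, zero_mul]
        split_ifs with c
        · rw [lin_e, if_neg (fun hh => c1 ((QPath.append_inj h).1 hh).1)]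
        · simp)
    (by
      have : ∀ v v' : Λ, QPath.vertex 𝒬 v = QPath.vertex 𝒬 v' ↔ v = v' := fun v v' =>
        ⟨fun h => congrArg QPath.src h, fun h => congrArg _ h⟩
      simp only [this, Finset.sum_ite_eq, Finset.mem_univ, if_true]
      refine LinearMap.ext fun f => funext fun l => ?_
      simp [QPath.vertex, QPath.tgt, endpt, Pi.single_apply])

/-- The map sending `r ⊗ r'` to the endomorphism `f ↦ r f r'` of `M_Λ(R)`. -/
def actScal (K R Λ : Type*) [Field K] [Ring R] [Algebra K R] :
    R ⊗[K] Rᵐᵒᵖ →ₐ[K] Module.End K (Λ → R) :=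
  (AlgHom.mulLeftRight K (Λ → R)).comp (Algebra.TensorProduct.map
    (Pi.constAlgHom K Λ R) ((AlgHom.op (Pi.constAlgHom K Λ R))))

theorem actScal_apply (r : R) (r' : Rᵐᵒᵖ) (f : Λ → R) (l : Λ) :
    actScal K R Λ (r ⊗ₜ[K] r') f l = r * f l * r'.unop := by
  simp [actScal]

/-- The algebra map `ℌ(Q) → End_K(M_Λ(R))`,
`r ⊗ r' ⊗ e[p; q] ↦ (f ↦ δ_{p,q} (r f(t(q)) r') δ_{s(q)})`. -/
def actH (K R : Type*) [Field K] [Ring R] [Algebra K R] (𝒬 : LQuiver Λ Q) :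
    HFace K R 𝒬 →ₐ[K] Module.End K (Λ → R) :=
  Algebra.TensorProduct.lift (actScal K R Λ) (actFace K R 𝒬) (fun z x => by
    change _ * _ = _ * _
    induction x using induction_e with
    | h0 => simp
    | hadd a b ha hb => simp only [map_add, mul_add, add_mul, ha, hb]
    | hsmul c a ha => simp only [map_smul, mul_smul_comm, smul_mul_assoc, ha]
    | he p q h =>
    induction z with
    | zero => simp
    | add a b ha hb => simp only [map_add, mul_add, add_mul, ha, hb]
    | tmul r r' =>
      rw [actFace, algHom_e]
      dsimp only
      split_ifs
      · refine LinearMap.ext fun f => funext fun l => ?_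
        simp only [Module.End.mul_apply, actScal_apply, LinearMap.comp_apply,
          LinearMap.proj_apply, LinearMap.single_apply]
        by_cases hl : l = q.src
        · subst hl; simp
        · simp [Pi.single_eq_of_ne hl]
      · simp)

theorem actH_apply (r : R) (r' : Rᵐᵒᵖ) (p q : 𝒬.QPath) (h : p.length = q.length) (f : Λ → R) :
    actH K R 𝒬 ((r ⊗ₜ[K] r') ⊗ₜ[K] e K p q h) f =
      if p = q then Pi.single q.src (r * f q.tgt * r'.unop) else 0 := by
  rw [actH, Algebra.TensorProduct.lift_tmul, actFace, algHom_e]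
  dsimp only
  split_ifs
  · ext l
    simp only [Module.End.mul_apply, actScal_apply, LinearMap.comp_apply,
      LinearMap.proj_apply, LinearMap.single_apply]
    by_cases hl : l = q.src
    · subst hl; simp
    · simp [Pi.single_eq_of_ne hl]
  · simp

theorem eA_mul_eA (x y : 𝒬.Comp2) : HFace.eA K 𝒬 x.1.1 y.1.1 * HFace.eA K 𝒬 x.1.2 y.1.2 =
    e K ((QPath.arrow 𝒬 x.1.1).append (QPath.arrow 𝒬 x.1.2) (QPath.arrow_comp x))
      ((QPath.arrow 𝒬 y.1.1).append (QPath.arrow 𝒬 y.1.2) (QPath.arrow_comp y))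
      (by rw [QPath.append_length, QPath.append_length]; rfl) := by
  rw [HFace.eA, HFace.eA, e_mul_e]
  exact dif_pos ⟨QPath.arrow_comp x, QPath.arrow_comp y⟩

theorem actH_gen (ab cd : 𝒬.Comp2) : actH K R 𝒬 (HFace.gen K W ab cd) = 0 := by
  have inj : ∀ x y : 𝒬.Comp2, (QPath.arrow 𝒬 x.1.1).append (QPath.arrow 𝒬 x.1.2) (QPath.arrow_comp x) =
      (QPath.arrow 𝒬 y.1.1).append (QPath.arrow 𝒬 y.1.2) (QPath.arrow_comp y) ↔ x = y := fun x y => by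
    rw [QPath.append_inj (QPath.arrow_length _ _), Subtype.ext_iff, Prod.ext_iff]
    constructor
    · rintro ⟨h1, h2⟩
      exact ⟨by simpa [QPath.arrow] using congrArg QPath.arrows h1,
        by simpa [QPath.arrow] using congrArg QPath.arrows h2⟩
    · rintro ⟨h1, h2⟩
      rw [h1, h2]; exact ⟨rfl, rfl⟩
  have src_eq : ∀ x : 𝒬.Comp2,
      ((QPath.arrow 𝒬 x.1.1).append (QPath.arrow 𝒬 x.1.2) (QPath.arrow_comp x)).src = 𝒬.s x.1.1 := fun _ => rfl
  have tgt_eq : ∀ x : 𝒬.Comp2,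
      ((QPath.arrow 𝒬 x.1.1).append (QPath.arrow 𝒬 x.1.2) (QPath.arrow_comp x)).tgt = 𝒬.t x.1.2 := fun _ => rfl
  rw [HFace.gen, map_sub, sub_eq_zero, map_sum, map_sum]
  refine LinearMap.ext fun f => ?_
  simp only [LinearMap.sum_apply, eA_mul_eA, actH_apply, inj, src_eq, tgt_eq]
  simp only [Finset.sum_ite_eq, Finset.sum_ite_eq', Finset.mem_univ, if_true,
    MulOpposite.unop_one, MulOpposite.unop_op, mul_one, one_mul]
  by_cases hw : W.w cd ab = 0
  · simp [hw]
  · have h1 : 𝒬.s cd.1.1 = 𝒬.s ab.1.1 := by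
      by_contra hne; exact hw (W.vanish cd ab (Or.inl hne))
    have h2 : 𝒬.t cd.1.2 = 𝒬.t ab.1.2 := by
      by_contra hne; exact hw (W.vanish cd ab (Or.inr hne))
    rw [h1, h2, Subring.mem_center_iff.1 (W.central cd ab)]

/-- The algebra map `ζ : 𝔄(w) → End_K(M_Λ(R))`. -/
def act : AFace K W →ₐ[K] Module.End K (Λ → R) :=
  PresAlg.algLift (actH K R 𝒬) (by rintro _ ⟨ab, cd, rfl⟩; exact actH_gen W ab cd)

/-- The counit `π(a) = ζ(a)(1)` of the left bialgebroid `𝔄(w)`. -/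
def counitL : AFace K W →ₗ[K] (Λ → R) := LinearMap.applyₗ 1 ∘ₗ (act W).toLinearMap

variable (F : FrobeniusSystem K R)

/-- The comultiplication `Δ(a) = t(e⁽¹⁾) a_{[1]} ⊗ s(e⁽²⁾) a_{[2]}` of the weak bialgebra `𝔄(w)`. -/
def comul : AFace K W →ₗ[K] AFace K W ⊗[K] AFace K W :=
  (F.pi Λ).section' (src K W) (tgt K W) ∘ₗ comulL W

/-- The counit `ε = ψ ∘ π` of the weak bialgebra `𝔄(w)`. -/
def counit : AFace K W →ₗ[K] K := (F.pi Λ).ψ ∘ₗ counitL W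

end AFace

end AFace

/-! ### The algebra `𝔄(w_σ)` and the map `Φ : 𝔄(w_σ) → A_σ` -/

section Phi

open LQuiver LQuiver.FaceAlg

variable {K : Type*} [Field K] {R : Type*} [Ring R] [Algebra K R] {Λ X : Type*}

/-- The quiver over `Λ` with arrows `Q = Λ × X`, `s(λ, x) = λ` and `t(λ, x) = λ deg(x)`. -/
def sigmaQuiver (D : SigmaDatum Λ X R) : LQuiver Λ (Λ × X) where
  s q := q.1
  t q := D.deg q.2 q.1

/-- The family `σ` is rigid. -/
def ASigma.IsRigid [Fintype X] [DecidableEq X] (K : Type*) [Field K] [Algebra K R]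
    (D : SigmaDatum Λ X R) : Prop :=
  ∃ x y : X → X → ASigma K D, ∀ a b : X,
    ∑ c, ASigma.Linv K D c b * x a c = (if a = b then 1 else 0) ∧
    ∑ c, x c b * ASigma.Linv K D a c = (if a = b then 1 else 0) ∧
    ∑ c, ASigma.L K D c b * y a c = (if a = b then 1 else 0) ∧
    ∑ c, y c b * ASigma.L K D a c = (if a = b then 1 else 0)

variable [DecidableEq Λ]

/-- The family `w_σ`: its value with `(λ, a)` on top, `(λ', b)` on the right, `(μ, c)` on the left
and `(μ', d)` at the bottom is `δ_{λ, μ} σ^{ba}_{dc}(λ)`. -/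
def sigmaWeights (D : SigmaDatum Λ X R) : FaceWeights (sigmaQuiver D) R where
  w ab cd := if ab.1.1.1 = cd.1.1.1 then D.σ ab.1.2.2 ab.1.1.2 cd.1.2.2 cd.1.1.2 ab.1.1.1 else 0
  central ab cd := by
    split_ifs
    · exact D.central _ _ _ _ _
    · exact Subring.zero_mem _
  vanish := by
    rintro ⟨⟨⟨l, a⟩, ⟨l', b⟩⟩, h⟩ ⟨⟨⟨m, c⟩, ⟨m', d⟩⟩, h'⟩ hne
    dsimp only [sigmaQuiver] at h h' hne ⊢
    split_ifs with hlm
    · subst hlm h h'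
      exact D.invariant _ _ _ _ _ (hne.resolve_left (fun hh => hh rfl))
    · rfl

variable [Fintype X] [DecidableEq X]

namespace ASigma

variable (D : SigmaDatum Λ X R)

/-- The element `δ_v ⊗ δ_{v'} + I_σ`. -/
def dd (K : Type*) [Field K] [Algebra K R] (D : SigmaDatum Λ X R) (v v' : Λ) : ASigma K D :=
  src K D (Pi.single v 1) * tgt K D (MulOpposite.op (Pi.single v' 1))

/-- The product `L_{x₁y₁} ⋯ L_{xₘyₘ}` for lists `(λ₁, x₁), …` and `(μ₁, y₁), …`. -/
def prodL (K : Type*) [Field K] [Algebra K R] (D : SigmaDatum Λ X R) (l l' : List (Λ × X)) :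
    ASigma K D :=
  (List.zipWith (fun a b => L K D a.2 b.2) l l').prod

theorem prodL_append {l l' : List (Λ × X)} (h : l.length = l'.length) (m m' : List (Λ × X)) :
    prodL K D (l ++ m) (l' ++ m') = prodL K D l l' * prodL K D m m' := by
  rw [prodL, List.zipWith_append h, List.prod_append]; rfl

theorem dd_mul_dd (v v' u u' : Λ) :
    dd K D v v' * dd K D u u' = if v = u ∧ v' = u' then dd K D v v' else 0 := by
  have h : ∀ a b : Λ, (Pi.single a 1 * Pi.single b 1 : Λ → R) =
      if a = b then Pi.single a 1 else 0 := fun a b => by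
    split_ifs with c
    · subst c; rw [← Pi.single_mul, one_mul]
    · ext l
      by_cases hl : l = a
      · subst hl; simp [Pi.single_eq_of_ne c]
      · simp [Pi.single_eq_of_ne hl]
  have e : dd K D v v' * dd K D u u' = src K D (Pi.single v 1 * Pi.single u 1) *
      tgt K D (MulOpposite.op (Pi.single u' 1 * Pi.single v' 1)) := by
    rw [dd, dd, MulOpposite.op_mul, map_mul, map_mul, mul_assoc, mul_assoc,
      ← mul_assoc (tgt K D _) (src K D _), ← src_tgt_comm, mul_assoc]
  rw [e, h, h]
  by_cases c1 : v = u
  · by_cases c2 : v' = u'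
    · rw [if_pos c1, if_pos c2.symm, if_pos ⟨c1, c2⟩, dd, c2]
    · have c3 : ¬(v = u ∧ v' = u') := fun hh => c2 hh.2
      have c4 : ¬(u' = v') := fun hh => c2 hh.symm
      rw [if_neg c4, if_neg c3, MulOpposite.op_zero, map_zero, mul_zero]
  · have c3 : ¬(v = u ∧ v' = u') := fun hh => c1 hh.1
    rw [if_neg c1, if_neg c3, map_zero, zero_mul]

theorem L_mul_dd (a b : X) (v v' : Λ) :
    L K D a b * dd K D (D.deg a v) (D.deg b v') = dd K D v v' * L K D a b := by
  have h : ∀ (α : Equiv.Perm Λ) (v : Λ),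
      shift K α (Pi.single (α v) (1 : R)) = Pi.single v 1 := fun α v => by
    ext l
    simp [shift_apply, Pi.single_apply]
  rw [dd, ← mul_assoc, L_mul_src, mul_assoc, L_mul_tgt, h, h, dd, mul_assoc]

/-- Moving `δ_{t(p)} ⊗ δ_{t(q)}` to the left through the product attached to `p` and `q`. -/
theorem prodL_mul_dd {l l' : List (Λ × X)} (hl : l.length = l'.length) (v v' : Λ)
    (h : (sigmaQuiver D).IsChain v l) (h' : (sigmaQuiver D).IsChain v' l') :
    prodL K D l l' * dd K D ((sigmaQuiver D).endpt v l) ((sigmaQuiver D).endpt v' l') =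
      dd K D v v' * prodL K D l l' := by
  induction l generalizing l' v v' with
  | nil =>
    obtain rfl : l' = [] := List.eq_nil_of_length_eq_zero hl.symm
    simp [prodL, endpt]
  | cons q l ih =>
    cases l' with
    | nil => simp at hl
    | cons q' l' =>
      have hc : ∀ (x y : List (Λ × X)),
          prodL K D (q :: x) (q' :: y) = L K D q.2 q'.2 * prodL K D x y := fun x y => by
        simp [prodL]
      obtain ⟨h1, h2⟩ := h
      obtain ⟨h1', h2'⟩ := h'
      rw [hc, endpt, endpt, mul_assoc, ih (by simpa using hl) _ _ h2 h2', ← mul_assoc,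
        ← mul_assoc]
      congr 1
      subst h1 h1'
      exact L_mul_dd D q.2 q'.2 q.1 q'.1

/-- `(δ_{s(p)} ⊗ δ_{s(q)}) L_{x₁y₁} ⋯ L_{xₘyₘ} + I_σ`. -/
def phiBasis (K : Type*) [Field K] [Algebra K R] (D : SigmaDatum Λ X R)
    (a : (sigmaQuiver D).PathPair) : ASigma K D :=
  dd K D a.1.1.src a.1.2.src * prodL K D a.1.1.arrows a.1.2.arrows

theorem phiBasis_mul (a b : (sigmaQuiver D).PathPair) :
    lin (phiBasis K D) (mulBasis K a b) = phiBasis K D a * phiBasis K D b := by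
  obtain ⟨⟨p, q⟩, h⟩ := a
  obtain ⟨⟨p', q'⟩, h'⟩ := b
  dsimp only at h h'
  have key : phiBasis K D ⟨(p, q), h⟩ * phiBasis K D ⟨(p', q'), h'⟩ =
      prodL K D p.arrows q.arrows * (dd K D p.tgt q.tgt * dd K D p'.src q'.src) *
        prodL K D p'.arrows q'.arrows := by
    simp only [phiBasis]
    rw [← prodL_mul_dd D h p.src q.src p.chain q.chain]
    simp only [mul_assoc]
    rfl
  rw [key, dd_mul_dd, mulBasis]
  dsimp only
  by_cases c : p.tgt = p'.src ∧ q.tgt = q'.src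
  · rw [dif_pos c, if_pos c, lin_e]
    simp only [phiBasis, QPath.append]
    rw [prodL_append D h, ← mul_assoc]
    congr 1
    exact (prodL_mul_dd D h p.src q.src p.chain q.chain).symm
  · rw [dif_neg c, if_neg c, map_zero, mul_zero, zero_mul]

variable [Fintype Λ]

theorem sum_dd : ∑ v : Λ, ∑ v' : Λ, dd K D v v' = 1 := by
  have h : ∑ v : Λ, (Pi.single v 1 : Λ → R) = 1 := by
    ext l; simp [Finset.sum_apply, Pi.single_apply]
  simp only [dd, ← Finset.mul_sum, ← Finset.sum_mul, ← map_sum]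
  have h2 : ∑ v : Λ, MulOpposite.op (Pi.single v 1 : Λ → R) = 1 := by
    rw [← MulOpposite.op_one, ← h]
    exact (map_sum (MulOpposite.opAddEquiv (α := Λ → R)) _ _).symm
  rw [h, h2, map_one, map_one, one_mul]

/-- `e[p; q] ↦ (δ_{s(p)} ⊗ δ_{s(q)}) L_{x₁y₁} ⋯ L_{xₘyₘ} + I_σ` as an algebra map. -/
def phiFace (K : Type*) [Field K] [Algebra K R] (D : SigmaDatum Λ X R) :
    FaceAlg K (sigmaQuiver D) →ₐ[K] ASigma K D :=
  algHom (phiBasis K D) (phiBasis_mul D) (by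
    simp only [phiBasis, QPath.vertex, prodL, List.zipWith_nil_left, List.prod_nil, mul_one]
    exact sum_dd D)

/-- `r ⊗ r' ↦ r_M ⊗ r'_M + I_σ`, where `r_M` is the constant map with value `r`. -/
def phiScal (K : Type*) [Field K] [Algebra K R] (D : SigmaDatum Λ X R) :
    R ⊗[K] Rᵐᵒᵖ →ₐ[K] ASigma K D :=
  (scal K D).comp (Algebra.TensorProduct.map (Pi.constAlgHom K Λ R)
    (AlgHom.op (Pi.constAlgHom K Λ R)))

theorem phiScal_tmul (r : R) (r' : Rᵐᵒᵖ) : phiScal K D (r ⊗ₜ[K] r') =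
    src K D (fun _ => r) * tgt K D (MulOpposite.op fun _ => r'.unop) := by
  simp only [src, tgt, AlgHom.comp_apply, ← map_mul, phiScal]
  congr 1
  simp
  rfl

theorem const_comm_dd (r : R) (r' : Rᵐᵒᵖ) (v v' : Λ) :
    phiScal K D (r ⊗ₜ[K] r') * dd K D v v' = dd K D v v' * phiScal K D (r ⊗ₜ[K] r') := by
  have h : ∀ (r : R) (v : Λ),
      (fun _ => r : Λ → R) * Pi.single v 1 = Pi.single v 1 * (fun _ => r) := fun r v => by
    ext l
    by_cases hl : l = v
    · subst hl; simp
    · simp [Pi.single_eq_of_ne hl]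
  have e : ∀ (f g f' g' : Λ → R),
      src K D f * tgt K D (MulOpposite.op g) * (src K D f' * tgt K D (MulOpposite.op g')) =
        src K D (f * f') * tgt K D (MulOpposite.op (g' * g)) := fun f g f' g' => by
    rw [MulOpposite.op_mul, map_mul, map_mul, mul_assoc, mul_assoc,
      ← mul_assoc (tgt K D _) (src K D _), ← src_tgt_comm, mul_assoc]
  rw [phiScal_tmul, dd, e, e, h, h]

theorem const_comm_prodL (r : R) (r' : Rᵐᵒᵖ) (l l' : List (Λ × X)) :
    phiScal K D (r ⊗ₜ[K] r') * prodL K D l l' = prodL K D l l' * phiScal K D (r ⊗ₜ[K] r') := by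
  rw [prodL]
  refine Commute.list_prod_right _ _ fun z hz => ?_
  obtain ⟨a, b, rfl⟩ : ∃ a b, z = L K D a b := by
    clear r r'
    induction l generalizing l' with
    | nil => simp at hz
    | cons q l ih =>
      cases l' with
      | nil => simp at hz
      | cons q' l' =>
        rw [List.zipWith_cons_cons, List.mem_cons] at hz
        rcases hz with hz | hz
        · exact ⟨_, _, hz⟩
        · exact ih _ hz
  change _ * _ = _ * _
  rw [phiScal_tmul, ← mul_assoc, L_mul_src, mul_assoc (src K D _) (L K D a b), L_mul_tgt,
    ← mul_assoc]
  rfl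

/-- The algebra map `ℌ(Q) → A_σ`,
`r ⊗ r' ⊗ e[p; q] ↦ (r_M ⊗ r'_M)(δ_{s(p)} ⊗ δ_{s(q)}) L_{x₁y₁} ⋯ L_{xₘyₘ} + I_σ`. -/
def phiH (K : Type*) [Field K] [Algebra K R] (D : SigmaDatum Λ X R) :
    HFace K R (sigmaQuiver D) →ₐ[K] ASigma K D :=
  Algebra.TensorProduct.lift (phiScal K D) (phiFace K D) (fun z x => by
    change _ * _ = _ * _
    induction x using induction_e with
    | h0 => simp
    | hadd a b ha hb => simp only [map_add, mul_add, add_mul, ha, hb]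
    | hsmul c a ha => simp only [map_smul, mul_smul_comm, smul_mul_assoc, ha]
    | he p q h =>
    induction z with
    | zero => simp
    | add a b ha hb => simp only [map_add, mul_add, add_mul, ha, hb]
    | tmul r r' =>
      rw [phiFace, algHom_e, phiBasis, ← mul_assoc, const_comm_dd, mul_assoc, const_comm_prodL,
        mul_assoc])

theorem phiH_apply (r : R) (r' : Rᵐᵒᵖ) (p q : (sigmaQuiver D).QPath) (h : p.length = q.length) :
    phiH K D ((r ⊗ₜ[K] r') ⊗ₜ[K] e K p q h) =
      src K D (fun _ => r) * tgt K D (MulOpposite.op fun _ => r'.unop) *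
        (src K D (Pi.single p.src 1) * tgt K D (MulOpposite.op (Pi.single q.src 1)) *
          (List.zipWith (fun a b => L K D a.2 b.2) p.arrows q.arrows).prod) := by
  rw [phiH, Algebra.TensorProduct.lift_tmul, phiFace, algHom_e, phiScal_tmul]
  rfl

theorem sum_comp2_sigma {N : Type*} [AddCommMonoid N] (f : Λ → X → X → N) :
    ∑ xy : (sigmaQuiver D).Comp2, f xy.1.1.1 xy.1.1.2 xy.1.2.2 = ∑ l, ∑ x, ∑ y, f l x y := by
  symm
  have : ∀ g : Λ × X × X → N, ∑ l, ∑ x, ∑ y, g (l, x, y) = ∑ z, g z := fun g => by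
    simp only [Fintype.sum_prod_type]
  rw [this fun z => f z.1 z.2.1 z.2.2]
  refine Fintype.sum_bijective (fun z : Λ × X × X =>
    (⟨((z.1, z.2.1), (D.deg z.2.1 z.1, z.2.2)), rfl⟩ : (sigmaQuiver D).Comp2))
    ⟨fun z z' h => ?_, ?_⟩ _ _ (fun _ => rfl)
  · exact Prod.ext (congrArg (fun u : (sigmaQuiver D).Comp2 => u.1.1.1) h)
      (Prod.ext (congrArg (fun u : (sigmaQuiver D).Comp2 => u.1.1.2) h)
        (congrArg (fun u : (sigmaQuiver D).Comp2 => u.1.2.2) h))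
  · rintro ⟨⟨⟨l, x⟩, ⟨l', y⟩⟩, h⟩
    exact ⟨(l, x, y), Subtype.ext (Prod.ext rfl (Prod.ext h rfl))⟩

theorem phiFace_eA_mul (x y : (sigmaQuiver D).Comp2) :
    phiFace K D (HFace.eA K _ x.1.1 y.1.1 * HFace.eA K _ x.1.2 y.1.2) =
      dd K D x.1.1.1 y.1.1.1 * (L K D x.1.1.2 y.1.1.2 * L K D x.1.2.2 y.1.2.2) := by
  rw [AFace.eA_mul_eA, phiFace, algHom_e, phiBasis]
  simp [QPath.append, QPath.arrow, prodL, sigmaQuiver]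

theorem phiH_gen (ab cd : (sigmaQuiver D).Comp2) :
    phiH K D (HFace.gen K (sigmaWeights D) ab cd) = 0 := by
  have single : ∀ (f : Λ → R) (m : Λ), (fun _ => f m : Λ → R) * Pi.single m 1 =
      Pi.single m 1 * f := fun f m => by
    ext l
    by_cases hl : l = m
    · subst hl; simp
    · simp [Pi.single_eq_of_ne hl]
  have single' : ∀ (f : Λ → R) (m : Λ), Pi.single m 1 * (fun _ => f m : Λ → R) =
      f * Pi.single m 1 := fun f m => by
    ext l
    by_cases hl : l = m
    · subst hl; simp
    · simp [Pi.single_eq_of_ne hl]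
  have hs : ∀ (f : Λ → R) (m n : Λ), phiScal K D (f m ⊗ₜ[K] (1 : Rᵐᵒᵖ)) * dd K D m n =
      dd K D m n * src K D f := fun f m n => by
    have e1 : tgt K D (MulOpposite.op fun _ => (1 : R)) = 1 := map_one (tgt K D)
    rw [phiScal_tmul, MulOpposite.unop_one, e1, mul_one, dd, ← mul_assoc, ← map_mul, single,
      map_mul, mul_assoc, src_tgt_comm, mul_assoc]
  have ht : ∀ (f : Λ → R) (m n : Λ),
      phiScal K D ((1 : R) ⊗ₜ[K] MulOpposite.op (f n)) * dd K D m n =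
      dd K D m n * tgt K D (MulOpposite.op f) := fun f m n => by
    have e1 : src K D (fun _ => (1 : R)) = 1 := map_one (src K D)
    rw [phiScal_tmul, MulOpposite.unop_op, e1, one_mul, dd, ← mul_assoc, ← src_tgt_comm,
      mul_assoc, mul_assoc, ← map_mul, ← map_mul, ← MulOpposite.op_mul, ← MulOpposite.op_mul,
      single']
  rw [HFace.gen, map_sub, sub_eq_zero, map_sum, map_sum]
  simp only [phiH, Algebra.TensorProduct.lift_tmul, phiFace_eA_mul]
  obtain ⟨⟨⟨m, a⟩, ⟨m', b⟩⟩, hab⟩ := ab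
  obtain ⟨⟨⟨n, c⟩, ⟨n', d⟩⟩, hcd⟩ := cd
  dsimp only [sigmaWeights]
  rw [sum_comp2_sigma D (fun l x y =>
      phiScal K D ((if l = m then D.σ y x b a l else 0) ⊗ₜ[K] (1 : Rᵐᵒᵖ)) *
        (dd K D l n * (L K D x c * L K D y d))),
    sum_comp2_sigma D (fun l x y =>
      phiScal K D ((1 : R) ⊗ₜ[K] MulOpposite.op (if n = l then D.σ d c y x n else 0)) *
        (dd K D m l * (L K D a x * L K D b y)))]
  rw [Finset.sum_eq_single m, Finset.sum_eq_single n]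
  · simp only [if_true]
    simp only [← mul_assoc, hs, ht]
    simp only [mul_assoc, ← Finset.mul_sum]
    congr 1
    have := exchange (K := K) D b d a c
    simp only [mul_assoc] at this
    rw [Finset.sum_comm, this, Finset.sum_comm]
  · intro l _ hl
    simp [hl.symm]
  · simp
  · intro l _ hl
    simp [hl]
  · simp

/-- The algebra map `Φ : 𝔄(w_σ) → A_σ`,
`r ⊗ r' ⊗ e[p; q] ↦ (r_M ⊗ r'_M)(δ_{s(p)} ⊗ δ_{s(q)}) L_{x₁y₁} ⋯ L_{xₘyₘ} + I_σ`. -/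
def Phi (K : Type*) [Field K] [Algebra K R] (D : SigmaDatum Λ X R) :
    AFace K (sigmaWeights D) →ₐ[K] ASigma K D :=
  PresAlg.algLift (phiH K D) (by rintro _ ⟨ab, cd, rfl⟩; exact phiH_gen D ab cd)

end ASigma

end Phi

end FaceClosure

end

open FaceClosure

noncomputable section

namespace FaceClosure

/-! ### Dual bases and transposes for a Frobenius system -/

section FrobeniusDual

variable {K L : Type*} [Field K] [Ring L] [Algebra K L] (F : FrobeniusSystem K L)

/-! Write `L` for the base algebra of maps from Λ to R and E = t(e⁽¹⁾) ⊗ s(e⁽²⁾). The two algebras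
have the same shape. Each carries commuting maps s and t out of `L` and its opposite, an action χ on
`L`, and a multiplicative but nonunital Δ with Δ(1) = E (`IsLiftedComul`). Each is generated by s, t
and matrices M with Δ(M_ab) = E · ∑_c M_ac ⊗ M_cb that commute with s and t up to automorphisms of
`L` (`IsMatCorep`). In A_σ these matrices are L and the transpose of L⁻¹; in 𝔄(w_σ) it is ℓ_ab = ∑
e[(λ,a); (μ,b)].

Each identity is therefore put in a form stable under sums and products and checked on generators.
Stability under products comes from a free parameter l in `L`: one proves s(χ(a₍₁₎)(l)) a₍₂₎ = a
s(l) for all l, not only for l = 1, and product rules then compose the operators χ(a). The factor E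
disappears whenever the legs are multiplied together, because e⁽¹⁾e⁽²⁾ = 1. With ε = ψ(χ(·)(1)), the
axioms of a weak bialgebra become statements about χ (`IsLiftedComul.isWeakBialgebra`).

For antipodes, the nondegenerate form ψ(xy) gives transposes and the Nakayama automorphism θ, and
then ε_t(a) = s(χ(a)(1)) and ε_s(a) = t(χ(a)ᵀ(1)). The antipode of A_σ sends s(f) to t(θ(f)), t(g)
to s(g), L to L⁻¹, and L⁻¹ to the matrix x supplied by rigidity. That this respects the relations
rests on an exchange relation for L⁻¹, obtained by multiplying the one for L by inverses on both
sides (`ASigma.Linv_exchange`).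

For the universal property, Φ carries s, t, ℓ to s, t, L, so A_σ only adds an inverse of this
matrix. An antipode f⁻ of f⁺ is determined on multiples by s and t (`IsAntipodeOf.neg_tgt_mul`,
`IsAntipodeOf.neg_src_mul`, `IsAntipodeOf.neg_mul_src`), and these rules force f⁻(ℓ) to be the
two-sided inverse of f⁺(ℓ). So F(L⁻¹) = f⁻(ℓ) defines F, and it is unique because inverses are.
Comultiplicativity of F is uniqueness of inverses again, with the idempotent Δ_A(1) as unit. The
counit is not multiplicative and needs its own argument: under ε_A ∘ F a factor k standing before
t(l) may be replaced so that k t(l) becomes t(χ(k)(l)) (`ASigma.counit_comp`). -/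

theorem FrobeniusSystem.exists_dual :
    ∃ (n : ℕ) (x y : Fin n → L), F.e = ∑ i, x i ⊗ₜ[K] y i := by
  obtain ⟨S, hS⟩ := TensorProduct.exists_finset F.e
  refine ⟨S.card, fun i => (S.equivFin.symm i).1.1, fun i => (S.equivFin.symm i).1.2, ?_⟩
  rw [hS, ← Finset.sum_coe_sort]
  exact (Equiv.sum_comp S.equivFin.symm (fun i : S => i.1.1 ⊗ₜ[K] i.1.2)).symm

/-- The number of terms in a chosen expression `e = ∑ i, x i ⊗ y i`. -/
def FrobeniusSystem.dim : ℕ := F.exists_dual.choose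

/-- The left factors of a chosen expression `e = ∑ i, x i ⊗ y i`. -/
def FrobeniusSystem.x : Fin F.dim → L := F.exists_dual.choose_spec.choose

/-- The right factors of a chosen expression `e = ∑ i, x i ⊗ y i`. -/
def FrobeniusSystem.y : Fin F.dim → L := F.exists_dual.choose_spec.choose_spec.choose

theorem FrobeniusSystem.e_eq : F.e = ∑ i, F.x i ⊗ₜ[K] F.y i :=
  F.exists_dual.choose_spec.choose_spec.choose_spec

theorem FrobeniusSystem.sum_left (l : L) : ∑ i, F.ψ (l * F.x i) • F.y i = l := by
  have := F.left l
  simpa [F.e_eq, map_sum] using this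

theorem FrobeniusSystem.sum_right (l : L) : ∑ i, F.ψ (F.y i * l) • F.x i = l := by
  have := F.right l
  simpa [F.e_eq, map_sum] using this

theorem FrobeniusSystem.sum_mul : ∑ i, F.x i * F.y i = 1 := by
  have := F.idem
  simpa [F.e_eq, map_sum] using this

/-- Nondegeneracy of the form ψ(xy): the values ψ(y_i a) are the coordinates of a in the x_i. -/
theorem FrobeniusSystem.ext_right {a b : L} (h : ∀ l, F.ψ (l * a) = F.ψ (l * b)) : a = b := by
  rw [← F.sum_right a, ← F.sum_right b]
  simp only [h]

/-- The transpose of an endomorphism with respect to the form `(x, y) ↦ ψ(x y)`. -/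
def FrobeniusSystem.transpose (T : Module.End K L) : Module.End K L :=
  ∑ i, (F.ψ ∘ₗ LinearMap.mulLeft K (T (F.y i))).smulRight (F.x i)

theorem FrobeniusSystem.transpose_apply (T : Module.End K L) (l : L) :
    F.transpose T l = ∑ i, F.ψ (T (F.y i) * l) • F.x i := by
  simp [transpose]

/-- The transpose is built on the y_i, and the expansion z = ∑ ψ(z x_i) y_i extends its adjointness
to every z. By nondegeneracy this property characterizes it, so later computations never return to
the dual bases. -/
theorem FrobeniusSystem.form_transpose (T : Module.End K L) (z l : L) :
    F.ψ (z * F.transpose T l) = F.ψ (T z * l) := by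
  conv_rhs => rw [← F.sum_left z]
  simp only [transpose_apply, Finset.mul_sum, Finset.sum_mul, map_sum, mul_smul_comm, map_smul,
    smul_mul_assoc, smul_eq_mul, mul_comm]

theorem FrobeniusSystem.transpose_eq {T : Module.End K L} {l m : L}
    (h : ∀ z, F.ψ (T z * l) = F.ψ (z * m)) : F.transpose T l = m :=
  F.ext_right fun z => by rw [F.form_transpose, h]

theorem FrobeniusSystem.transpose_mul (T U : Module.End K L) (l : L) :
    F.transpose (T * U) l = F.transpose U (F.transpose T l) :=
  F.transpose_eq fun z => by rw [F.form_transpose, F.form_transpose]; rfl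

theorem FrobeniusSystem.transpose_add (T U : Module.End K L) (l : L) :
    F.transpose (T + U) l = F.transpose T l + F.transpose U l :=
  F.transpose_eq fun z => by
    rw [mul_add, map_add, F.form_transpose, F.form_transpose, LinearMap.add_apply, add_mul,
      map_add]

theorem FrobeniusSystem.transpose_zero (l : L) : F.transpose 0 l = 0 :=
  F.transpose_eq fun z => by simp

/-- The linear map `f ↦ e⁽¹⁾ ψ(f e⁽²⁾)`. -/
def FrobeniusSystem.nakayamaLin : L →ₗ[K] L :=
  ∑ i, (F.ψ ∘ₗ LinearMap.mulRight K (F.y i)).smulRight (F.x i)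

theorem FrobeniusSystem.form_nakayamaLin (z f : L) :
    F.ψ (z * F.nakayamaLin f) = F.ψ (f * z) := by
  conv_rhs => rw [← F.sum_left z]
  simp [nakayamaLin, Finset.mul_sum, mul_comm]

/-- The Nakayama automorphism `θ`, characterized by `ψ(f x) = ψ(x θ(f))`. -/
def FrobeniusSystem.nakayama : L →ₐ[K] L :=
  AlgHom.ofLinearMap F.nakayamaLin
    (F.ext_right fun z => by rw [F.form_nakayamaLin, one_mul, mul_one])
    (fun f g => F.ext_right fun z => by
      rw [F.form_nakayamaLin, ← mul_assoc z, F.form_nakayamaLin, ← mul_assoc,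
        F.form_nakayamaLin, mul_assoc])

theorem FrobeniusSystem.form_nakayama (z f : L) : F.ψ (z * F.nakayama f) = F.ψ (f * z) :=
  F.form_nakayamaLin z f

/-- A left factor reaches the right end of the argument of ψ only at the cost of θ, whereas the
transpose of a right multiplication is untwisted. This asymmetry is why the antipode has a θ on s(f)
but none on t(g). -/
theorem FrobeniusSystem.transpose_mulLeft (f l : L) :
    F.transpose (LinearMap.mulLeft K f) l = l * F.nakayama f :=
  F.transpose_eq fun z => by
    rw [← mul_assoc, F.form_nakayama]; simp [mul_assoc]

theorem FrobeniusSystem.transpose_mulRight (g l : L) :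
    F.transpose (LinearMap.mulRight K g) l = g * l :=
  F.transpose_eq fun z => by simp [mul_assoc]

/-- Needed so that θ leaves the weights σ alone when the antipode is applied to the exchange
relation. -/
theorem FrobeniusSystem.nakayama_of_central {c : L} (h : ∀ z, c * z = z * c) :
    F.nakayama c = c :=
  F.ext_right fun z => by rw [F.form_nakayama, h]

/-- An automorphism preserving ψ is orthogonal for the form ψ(xy). -/
theorem FrobeniusSystem.transpose_equiv (τ : L ≃ₐ[K] L) (h : ∀ l, F.ψ (τ l) = F.ψ l) (l : L) :
    F.transpose τ.toLinearMap l = τ.symm l :=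
  F.transpose_eq fun z => by
    rw [← h (z * τ.symm l), map_mul τ]; simp

theorem FrobeniusSystem.nakayama_equiv (τ : L ≃ₐ[K] L) (h : ∀ l, F.ψ (τ l) = F.ψ l) (l : L) :
    F.nakayama (τ l) = τ (F.nakayama l) :=
  F.ext_right fun z => by
    rw [F.form_nakayama, ← τ.apply_symm_apply z, ← map_mul τ, ← map_mul τ, h, h,
      F.form_nakayama]

/-- `θ(e⁽²⁾) e⁽¹⁾ = 1` -/
theorem FrobeniusSystem.sum_nakayama_mul : ∑ i, F.nakayama (F.y i) * F.x i = 1 := by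
  have h : ∀ l, F.nakayama l = ∑ j, F.ψ (l * F.y j) • F.x j := fun l => by
    conv_lhs => rw [← F.sum_right (F.nakayama l)]
    simp only [F.form_nakayama]
  -- Expand θ(y_i) in the x_j and exchange the sums: the inner sum over i is y_j, which leaves
  -- e⁽¹⁾e⁽²⁾ = 1.
  calc ∑ i, F.nakayama (F.y i) * F.x i
      = ∑ j, F.x j * ∑ i, F.ψ (F.y i * F.y j) • F.x i := by
        simp only [h, Finset.sum_mul, Finset.mul_sum]
        rw [Finset.sum_comm]
        simp only [smul_mul_assoc, mul_smul_comm]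
    _ = 1 := by simp only [F.sum_right, F.sum_mul]

end FrobeniusDual

/-! ### Comultiplications over a Frobenius-separable base -/

/-- The data `s : L → A`, `t : Lᵒᵖ → A`, `χ : A → End_K(L)` and `Δ : A → A ⊗ A` of a left
bialgebroid over `L` whose coproduct is lifted along `A ⊗ A → A ⊗_L A`: the images of `s` and
`t` commute, `χ` is the action on the base, `Δ` is multiplicative and `Δ(1) = t(e⁽¹⁾) ⊗ s(e⁽²⁾)`. -/
structure IsLiftedComul {K L A : Type*} [Field K] [Ring L] [Algebra K L] [Ring A] [Algebra K A]
    (F : FrobeniusSystem K L) (s : L →ₐ[K] A) (t : Lᵐᵒᵖ →ₐ[K] A)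
    (χ : A →ₐ[K] Module.End K L) (Δ : A →ₗ[K] A ⊗[K] A) : Prop where
  comm : ∀ f g, s f * t g = t g * s f
  act_src : ∀ f, χ (s f) = LinearMap.mulLeft K f
  act_tgt : ∀ g, χ (t (MulOpposite.op g)) = LinearMap.mulRight K g
  comul_mul : ∀ a b, Δ (a * b) = Δ a * Δ b
  comul_one : Δ 1 = F.unitElt s t
  comul_src : ∀ f, Δ (s f) = F.unitElt s t * (s f ⊗ₜ[K] (1 : A))
  comul_tgt : ∀ g, Δ (t g) = F.unitElt s t * ((1 : A) ⊗ₜ[K] t g)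

/-- `M` is a matrix corepresentation that is twisted-linear along the automorphisms `τ` of `L`. -/
structure IsMatCorep {K L A X : Type*} [Field K] [Ring L] [Algebra K L] [Ring A] [Algebra K A]
    [Fintype X] [DecidableEq X]
    (F : FrobeniusSystem K L) (s : L →ₐ[K] A) (t : Lᵐᵒᵖ →ₐ[K] A)
    (χ : A →ₐ[K] Module.End K L) (Δ : A →ₗ[K] A ⊗[K] A) (τ : X → L ≃ₐ[K] L)
    (M : X → X → A) : Prop where
  mul_src : ∀ a b f, M a b * s f = s (τ a f) * M a b
  mul_tgt : ∀ a b f, M a b * t (MulOpposite.op f) = t (MulOpposite.op (τ b f)) * M a b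
  act : ∀ a b, χ (M a b) = if a = b then (τ a).toLinearMap else 0
  comul : ∀ a b, Δ (M a b) = F.unitElt s t * ∑ c, M a c ⊗ₜ[K] M c b

section Lifted

variable {K L A X : Type*} [Field K] [Ring L] [Algebra K L] [Ring A] [Algebra K A]
    [Fintype X] [DecidableEq X]
    {F : FrobeniusSystem K L} {s : L →ₐ[K] A} {t : Lᵐᵒᵖ →ₐ[K] A}
    {χ : A →ₐ[K] Module.End K L} {Δ : A →ₗ[K] A ⊗[K] A}

theorem FrobeniusSystem.unitElt_eq (F : FrobeniusSystem K L) (s : L →ₐ[K] A) (t : Lᵐᵒᵖ →ₐ[K] A) :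
    F.unitElt s t = ∑ i, t (MulOpposite.op (F.x i)) ⊗ₜ[K] s (F.y i) := by
  simp [unitElt, F.e_eq]

/-- Since E (t(l) ⊗ 1) = E (1 ⊗ s(l)), left multiplication by E kills the generators, and the ideal
is a right ideal. -/
theorem FrobeniusSystem.unitElt_mul_balIdeal (F : FrobeniusSystem K L) (s : L →ₐ[K] A)
    (t : Lᵐᵒᵖ →ₐ[K] A) {z : A ⊗[K] A} (hz : z ∈ balIdeal s t) : F.unitElt s t * z = 0 := by
  induction hz using Submodule.span_induction with
  | mem x h =>
    obtain ⟨l, y, rfl⟩ := h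
    rw [← mul_assoc, mul_sub, F.unitElt_mul, sub_self, zero_mul]
  | zero => simp
  | add a b _ _ ha hb => rw [mul_add, ha, hb, add_zero]
  | smul c a _ ha => rw [mul_smul_comm, ha, smul_zero]

/-- An element that multiplies `I₂` into itself is absorbed by the unit element on the right. -/
theorem FrobeniusSystem.unitElt_mul_mul_unitElt (F : FrobeniusSystem K L) (s : L →ₐ[K] A)
    (t : Lᵐᵒᵖ →ₐ[K] A) {w : A ⊗[K] A} (hw : ∀ z ∈ balIdeal s t, w * z ∈ balIdeal s t) :
    F.unitElt s t * w * F.unitElt s t = F.unitElt s t * w := by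
  -- As w keeps the ideal stable and E kills it, E w does not distinguish t(l) ⊗ 1 from 1 ⊗ s(l)
  -- placed on its right.
  have h : ∀ l y, F.unitElt s t * w * ((t (MulOpposite.op l) ⊗ₜ[K] (1 : A)) * y) =
      F.unitElt s t * w * (((1 : A) ⊗ₜ[K] s l) * y) := fun l y => by
    have := F.unitElt_mul_balIdeal s t (hw _ (balIdeal_gen_mem l y))
    rwa [← mul_assoc, sub_mul, mul_sub, sub_eq_zero] at this
  have e : ∀ i, t (MulOpposite.op (F.x i)) ⊗ₜ[K] s (F.y i) =
      (t (MulOpposite.op (F.x i)) ⊗ₜ[K] (1 : A)) * ((1 : A) ⊗ₜ[K] s (F.y i)) := fun i => by simp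
  -- Moving every t(x_i) to the second leg turns the second copy of E into 1 ⊗ s(∑ x_i y_i) = 1 ⊗ 1.
  have e' : F.unitElt s t * w * ∑ i, t (MulOpposite.op (F.x i)) ⊗ₜ[K] s (F.y i) =
      F.unitElt s t * w := by
    simp only [e, Finset.mul_sum, h]
    simp only [← Finset.mul_sum, Algebra.TensorProduct.tmul_mul_tmul, ← map_mul, one_mul,
      ← TensorProduct.tmul_sum, ← map_sum, F.sum_mul, map_one]
    rw [← Algebra.TensorProduct.one_def, mul_one]
  rwa [← F.unitElt_eq s t] at e'

namespace IsLiftedComul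

theorem one_mul_comul (h : IsLiftedComul F s t χ Δ) (a : A) : F.unitElt s t * Δ a = Δ a := by
  rw [← h.comul_one, ← h.comul_mul, one_mul]

theorem comul_mul_one (h : IsLiftedComul F s t χ Δ) (a : A) : Δ a * F.unitElt s t = Δ a := by
  rw [← h.comul_one, ← h.comul_mul, mul_one]

theorem unitElt_src (h : IsLiftedComul F s t χ Δ) (f : L) : F.unitElt s t * (s f ⊗ₜ[K] (1 : A)) =
    (s f ⊗ₜ[K] (1 : A)) * F.unitElt s t := by
  simp [F.unitElt_eq, Finset.sum_mul, Finset.mul_sum, h.comm]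

theorem unitElt_tgt (h : IsLiftedComul F s t χ Δ) (g : Lᵐᵒᵖ) : F.unitElt s t * ((1 : A) ⊗ₜ[K] t g) =
    ((1 : A) ⊗ₜ[K] t g) * F.unitElt s t := by
  simp [F.unitElt_eq, Finset.sum_mul, Finset.mul_sum, h.comm]

theorem comul_src_mul (h : IsLiftedComul F s t χ Δ) (f : L) (a : A) :
    Δ (s f * a) = (s f ⊗ₜ[K] (1 : A)) * Δ a := by
  rw [h.comul_mul, h.comul_src, h.unitElt_src, mul_assoc, h.one_mul_comul]

theorem comul_tgt_mul (h : IsLiftedComul F s t χ Δ) (g : Lᵐᵒᵖ) (a : A) :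
    Δ (t g * a) = ((1 : A) ⊗ₜ[K] t g) * Δ a := by
  rw [h.comul_mul, h.comul_tgt, h.unitElt_tgt, mul_assoc, h.one_mul_comul]

theorem comul_mul_src (h : IsLiftedComul F s t χ Δ) (f : L) (a : A) :
    Δ (a * s f) = Δ a * (s f ⊗ₜ[K] (1 : A)) := by
  rw [h.comul_mul, h.comul_src, ← mul_assoc, h.comul_mul_one]

theorem rTensor_mul (h : IsLiftedComul F s t χ Δ) (z w : A ⊗[K] A) :
    Δ.rTensor A (z * w) = Δ.rTensor A z * Δ.rTensor A w := by
  induction z with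
  | zero => simp
  | add a b ha hb => simp only [add_mul, map_add, ha, hb]
  | tmul a b =>
    induction w with
    | zero => simp
    | add a b ha hb => simp only [mul_add, map_add, ha, hb]
    | tmul c d => simp [h.comul_mul]

theorem lTensor_mul (h : IsLiftedComul F s t χ Δ) (z w : A ⊗[K] A) :
    Δ.lTensor A (z * w) = Δ.lTensor A z * Δ.lTensor A w := by
  induction z with
  | zero => simp
  | add a b ha hb => simp only [add_mul, map_add, ha, hb]
  | tmul a b =>
    induction w with
    | zero => simp
    | add a b ha hb => simp only [mul_add, map_add, ha, hb]
    | tmul c d => simp [h.comul_mul]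

theorem lTensor_unitElt (h : IsLiftedComul F s t χ Δ) : Δ.lTensor A (F.unitElt s t) =
    ∑ i, ∑ j, t (MulOpposite.op (F.x i)) ⊗ₜ[K]
      ((s (F.y i) * t (MulOpposite.op (F.x j))) ⊗ₜ[K] s (F.y j)) := by
  conv_lhs => rw [F.unitElt_eq]
  simp only [map_sum, LinearMap.lTensor_tmul, h.comul_src, F.unitElt_eq, Finset.sum_mul,
    Algebra.TensorProduct.tmul_mul_tmul, mul_one, TensorProduct.tmul_sum, h.comm]

/-- Coassociativity at 1. Both sides are the sum of t(x_i) ⊗ s(y_i) t(x_j) ⊗ s(y_j), because images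
of s and t commute. -/
theorem assoc_rTensor_unitElt (h : IsLiftedComul F s t χ Δ) :
    Algebra.TensorProduct.assoc K K K A A A (Δ.rTensor A (F.unitElt s t)) =
      Δ.lTensor A (F.unitElt s t) := by
  rw [h.lTensor_unitElt]
  conv_lhs => rw [F.unitElt_eq]
  simp only [map_sum, LinearMap.rTensor_tmul, h.comul_tgt, F.unitElt_eq, Finset.sum_mul,
    Algebra.TensorProduct.tmul_mul_tmul, mul_one, TensorProduct.sum_tmul,
    Algebra.TensorProduct.assoc_tmul]
  exact Finset.sum_comm

/-- The map 1 ⊗ Δ is multiplicative but sends 1 ⊗ 1 to 1 ⊗ E, so applying it to E · 1 shows that the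
extra factor 1 ⊗ E is absorbed. This disposes of the copies of E that arise when Δ is iterated. -/
theorem lTensor_unitElt_mul (h : IsLiftedComul F s t χ Δ) :
    Δ.lTensor A (F.unitElt s t) * ((1 : A) ⊗ₜ[K] F.unitElt s t) =
    Δ.lTensor A (F.unitElt s t) := by
  conv_rhs => rw [← mul_one (F.unitElt s t), h.lTensor_mul, Algebra.TensorProduct.one_def,
    LinearMap.lTensor_tmul, h.comul_one]

theorem rTensor_unitElt_mul (h : IsLiftedComul F s t χ Δ) :
    Δ.rTensor A (F.unitElt s t) * (F.unitElt s t ⊗ₜ[K] (1 : A)) =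
    Δ.rTensor A (F.unitElt s t) := by
  conv_rhs => rw [← mul_one (F.unitElt s t), h.rTensor_mul, Algebra.TensorProduct.one_def,
    LinearMap.rTensor_tmul, h.comul_one]

end IsLiftedComul

/-- The map `a ⊗ b ↦ s(χ(a)(l)) b`. -/
def srcContract (s : L →ₐ[K] A) (χ : A →ₐ[K] Module.End K L) (l : L) : A ⊗[K] A →ₗ[K] A :=
  LinearMap.mul' K A ∘ₗ
    TensorProduct.map (s.toLinearMap ∘ₗ LinearMap.applyₗ l ∘ₗ χ.toLinearMap) LinearMap.id

/-- The map `a ⊗ b ↦ t(χ(b)(l)) a`. -/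
def tgtContract (t : Lᵐᵒᵖ →ₐ[K] A) (χ : A →ₐ[K] Module.End K L) (l : L) : A ⊗[K] A →ₗ[K] A :=
  LinearMap.mul' K A ∘ₗ TensorProduct.map (t.toLinearMap ∘ₗ
    (MulOpposite.opLinearEquiv K).toLinearMap ∘ₗ LinearMap.applyₗ l ∘ₗ χ.toLinearMap)
      LinearMap.id ∘ₗ (TensorProduct.comm K A A).toLinearMap

@[simp]
theorem srcContract_tmul (l : L) (a b : A) :
    srcContract s χ l (a ⊗ₜ[K] b) = s (χ a l) * b := by simp [srcContract]

@[simp]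
theorem tgtContract_tmul (l : L) (a b : A) :
    tgtContract t χ l (a ⊗ₜ[K] b) = t (MulOpposite.op (χ b l)) * a := by simp [tgtContract]

/-- Multiplicativity of χ converts a factor on the first leg into a change of the parameter l. -/
theorem srcContract_mul_tmul (l : L) (z : A ⊗[K] A) (a b : A) :
    srcContract s χ l (z * (a ⊗ₜ[K] b)) = srcContract s χ (χ a l) z * b := by
  induction z with
  | zero => simp
  | add a b ha hb => simp only [add_mul, map_add, ha, hb]
  | tmul c d => simp [mul_assoc]

theorem tgtContract_mul_tmul (l : L) (z : A ⊗[K] A) (a b : A) :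
    tgtContract t χ l (z * (a ⊗ₜ[K] b)) = tgtContract t χ (χ b l) z * a := by
  induction z with
  | zero => simp
  | add a b ha hb => simp only [add_mul, map_add, ha, hb]
  | tmul c d => simp [mul_assoc]

/-- The comultiplication is coassociative and counital at `a`. -/
structure IsCounitalAt (s : L →ₐ[K] A) (t : Lᵐᵒᵖ →ₐ[K] A) (χ : A →ₐ[K] Module.End K L)
    (Δ : A →ₗ[K] A ⊗[K] A) (a : A) : Prop where
  coassoc : Algebra.TensorProduct.assoc K K K A A A (Δ.rTensor A (Δ a)) = Δ.lTensor A (Δ a)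
  src : ∀ l, srcContract s χ l (Δ a) = a * s l
  tgt : ∀ l, tgtContract t χ l (Δ a) = a * t (MulOpposite.op l)

theorem IsCounitalAt.add {a b : A} (ha : IsCounitalAt s t χ Δ a) (hb : IsCounitalAt s t χ Δ b) :
    IsCounitalAt s t χ Δ (a + b) where
  coassoc := by simp only [map_add, ha.coassoc, hb.coassoc]
  src l := by simp only [map_add, ha.src, hb.src, add_mul]
  tgt l := by simp only [map_add, ha.tgt, hb.tgt, add_mul]

namespace IsLiftedComul

/-- Contracting Δ(a)(x ⊗ y) at l gives a s(χ(x)(l)) y by the hypothesis on a at the parameter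
χ(x)(l), that is, a times the contraction of x ⊗ y. Knowing the identity at l = 1 alone would not
suffice. -/
theorem isCounitalAt_mul (h : IsLiftedComul F s t χ Δ) {a b : A}
    (ha : IsCounitalAt s t χ Δ a) (hb : IsCounitalAt s t χ Δ b) :
    IsCounitalAt s t χ Δ (a * b) where
  coassoc := by
    rw [h.comul_mul, h.rTensor_mul, h.lTensor_mul, map_mul, ha.coassoc, hb.coassoc]
  src l := by
    have : ∀ w, srcContract s χ l (Δ a * w) = a * srcContract s χ l w := fun w => by
      induction w with
      | zero => simp
      | add x y hx hy => simp only [mul_add, map_add, hx, hy]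
      | tmul x y => rw [srcContract_mul_tmul, ha.src, srcContract_tmul, mul_assoc]
    rw [h.comul_mul, this, hb.src, mul_assoc]
  tgt l := by
    have : ∀ w, tgtContract t χ l (Δ a * w) = a * tgtContract t χ l w := fun w => by
      induction w with
      | zero => simp
      | add x y hx hy => simp only [mul_add, map_add, hx, hy]
      | tmul x y => rw [tgtContract_mul_tmul, ha.tgt, tgtContract_tmul, mul_assoc]
    rw [h.comul_mul, this, hb.tgt, mul_assoc]

/-- The element t(x_i) acts as right multiplication by x_i, which then meets s(y_i), and ∑ x_i y_i =
1. Hence contractions see only the representative of Δ before it is multiplied by E. -/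
theorem srcContract_unitElt_mul (h : IsLiftedComul F s t χ Δ) (l : L) (z : A ⊗[K] A) :
    srcContract s χ l (F.unitElt s t * z) = srcContract s χ l z := by
  induction z with
  | zero => simp
  | add a b ha hb => simp only [mul_add, map_add, ha, hb]
  | tmul a b =>
    simp only [F.unitElt_eq, Finset.sum_mul, map_sum, Algebra.TensorProduct.tmul_mul_tmul,
      srcContract_tmul, map_mul, h.act_tgt, Module.End.mul_apply, LinearMap.mulRight_apply,
      ← mul_assoc]
    simp only [mul_assoc (s _) (s _) (s _), ← Finset.sum_mul, ← Finset.mul_sum, ← map_mul,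
      ← map_sum, mul_assoc, F.sum_mul, mul_one]

theorem tgtContract_unitElt_mul (h : IsLiftedComul F s t χ Δ) (l : L) (z : A ⊗[K] A) :
    tgtContract t χ l (F.unitElt s t * z) = tgtContract t χ l z := by
  induction z with
  | zero => simp
  | add a b ha hb => simp only [mul_add, map_add, ha, hb]
  | tmul a b =>
    simp only [F.unitElt_eq, Finset.sum_mul, map_sum, Algebra.TensorProduct.tmul_mul_tmul,
      tgtContract_tmul, map_mul, h.act_src, Module.End.mul_apply, LinearMap.mulLeft_apply,
      ← mul_assoc]
    simp only [← Finset.sum_mul, ← map_mul, ← MulOpposite.op_mul, ← map_sum,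
      ← Finset.op_sum, ← mul_assoc, F.sum_mul, one_mul]

/-- Coassociativity at an element whose coproduct is `Δ(1)` times `y`, where `(Δ ⊗ 1)(y)` and
`(1 ⊗ Δ)(y)` agree up to the factors `Δ(1) ⊗ 1` and `1 ⊗ Δ(1)`. -/
theorem coassoc_of_eq (h : IsLiftedComul F s t χ Δ) {a : A} {y : A ⊗[K] A}
    {z : A ⊗[K] A ⊗[K] A} {z' : A ⊗[K] (A ⊗[K] A)}
    (ha : Δ a = F.unitElt s t * y) (h1 : Δ.rTensor A y = (F.unitElt s t ⊗ₜ[K] (1 : A)) * z)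
    (h2 : Δ.lTensor A y = ((1 : A) ⊗ₜ[K] F.unitElt s t) * z')
    (hz : Algebra.TensorProduct.assoc K K K A A A z = z') :
    Algebra.TensorProduct.assoc K K K A A A (Δ.rTensor A (Δ a)) = Δ.lTensor A (Δ a) := by
  rw [ha, h.rTensor_mul, h.lTensor_mul, h1, h2, ← mul_assoc, ← mul_assoc, h.rTensor_unitElt_mul,
    h.lTensor_unitElt_mul, map_mul, h.assoc_rTensor_unitElt, hz]

theorem isCounitalAt_src (h : IsLiftedComul F s t χ Δ) (f : L) : IsCounitalAt s t χ Δ (s f) where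
  coassoc := h.coassoc_of_eq (h.comul_src f) (z := (s f ⊗ₜ[K] (1 : A)) ⊗ₜ[K] (1 : A))
    (z' := s f ⊗ₜ[K] ((1 : A) ⊗ₜ[K] (1 : A))) (by simp [h.comul_src])
    (by simp [h.comul_one, ← Algebra.TensorProduct.one_def]) rfl
  src l := by
    rw [h.comul_src, h.srcContract_unitElt_mul]
    simp [h.act_src]
  tgt l := by
    rw [h.comul_src, h.tgtContract_unitElt_mul]
    simp [h.comm]

theorem isCounitalAt_tgt (h : IsLiftedComul F s t χ Δ) (g : L) :
    IsCounitalAt s t χ Δ (t (MulOpposite.op g)) where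
  coassoc := h.coassoc_of_eq (h.comul_tgt _)
    (z := ((1 : A) ⊗ₜ[K] (1 : A)) ⊗ₜ[K] t (MulOpposite.op g))
    (z' := (1 : A) ⊗ₜ[K] ((1 : A) ⊗ₜ[K] t (MulOpposite.op g)))
    (by simp [h.comul_one, ← Algebra.TensorProduct.one_def]) (by simp [h.comul_tgt]) rfl
  src l := by
    rw [h.comul_tgt, h.srcContract_unitElt_mul]
    simp [h.comm]
  tgt l := by
    rw [h.comul_tgt, h.tgtContract_unitElt_mul]
    simp [h.act_tgt]

/-- Matrix comultiplication is coassociative up to copies of E. In the contractions χ(M_ac) vanishes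
for c ≠ a, and the surviving term s(τ_a(l)) M_ab is M_ab s(l) by the twisted commutation; the target
side is the same with c = b. -/
theorem isCounitalAt_mat (h : IsLiftedComul F s t χ Δ) {τ : X → L ≃ₐ[K] L}
    {M : X → X → A} (hM : IsMatCorep F s t χ Δ τ M)
    (a b : X) : IsCounitalAt s t χ Δ (M a b) where
  coassoc := h.coassoc_of_eq (hM.comul a b)
    (z := ∑ c, ∑ d, (M a d ⊗ₜ[K] M d c) ⊗ₜ[K] M c b)
    (z' := ∑ c, ∑ d, M a c ⊗ₜ[K] (M c d ⊗ₜ[K] M d b))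
    (by simp [hM.comul, TensorProduct.sum_tmul, Finset.mul_sum])
    (by simp [hM.comul, TensorProduct.tmul_sum, Finset.mul_sum])
    (by
      simp only [map_sum, Algebra.TensorProduct.assoc_tmul]
      exact Finset.sum_comm)
  src l := by
    rw [hM.comul, h.srcContract_unitElt_mul, map_sum, Finset.sum_eq_single a]
    · simp [hM.act, hM.mul_src]
    · intro c _ hc; simp [hM.act, hc.symm]
    · simp
  tgt l := by
    rw [hM.comul, h.tgtContract_unitElt_mul, map_sum, Finset.sum_eq_single b]
    · simp [hM.act, hM.mul_tgt]
    · intro c _ hc; simp [hM.act, hc]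
    · simp

/-- The element `χ(b₍₁₎)(l) χ(b₍₂₎)(m)` is `χ(b)(l m)`. -/
theorem act_comul (h : IsLiftedComul F s t χ Δ) {b : A} (hb : IsCounitalAt s t χ Δ b) (l m : L) :
    LinearMap.mul' K L (TensorProduct.map (LinearMap.applyₗ l ∘ₗ χ.toLinearMap)
      (LinearMap.applyₗ m ∘ₗ χ.toLinearMap) (Δ b)) = χ b (l * m) := by
  -- A product χ(a)(l) χ(b)(m) is χ(s(χ(a)(l)) b)(m), so the source contraction computes it.
  have : ∀ z : A ⊗[K] A, LinearMap.mul' K L (TensorProduct.map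
      (LinearMap.applyₗ l ∘ₗ χ.toLinearMap) (LinearMap.applyₗ m ∘ₗ χ.toLinearMap) z) =
      χ (srcContract s χ l z) m := fun z => by
    induction z with
    | zero => simp
    | add a b ha hb => simp only [map_add, ha, hb, LinearMap.add_apply]
    | tmul a b => simp [h.act_src]
  rw [this, hb.src]
  simp [h.act_src]

/-- A lifted comultiplication that is counital and coassociative makes `A` a weak bialgebra. -/
theorem isWeakBialgebra (h : IsLiftedComul F s t χ Δ) (hA : ∀ a, IsCounitalAt s t χ Δ a) :
    IsWeakBialgebra Δ (F.ψ ∘ₗ LinearMap.applyₗ 1 ∘ₗ χ.toLinearMap) where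
  coassoc a := (hA a).coassoc
  counit_left a := by
    -- Applying ε to the first leg after multiplying by E yields ψ(χ(a)(1) x_i) s(y_i), which the
    -- dual bases reassemble to s(χ(a)(1)).
    have : ∀ z, TensorProduct.lid K A ((F.ψ ∘ₗ LinearMap.applyₗ 1 ∘ₗ χ.toLinearMap).rTensor A
        (F.unitElt s t * z)) = srcContract s χ 1 z := fun z => by
      induction z with
      | zero => simp
      | add a b ha hb => simp only [mul_add, map_add, ha, hb]
      | tmul a b =>
        rw [srcContract_tmul, ← F.sum_left (χ a 1)]
        simp [F.unitElt_eq, Finset.sum_mul, h.act_tgt]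
    rw [← h.one_mul_comul, this, (hA a).src, map_one, mul_one]
  counit_right a := by
    have : ∀ z, TensorProduct.rid K A ((F.ψ ∘ₗ LinearMap.applyₗ 1 ∘ₗ χ.toLinearMap).lTensor A
        (F.unitElt s t * z)) = tgtContract t χ 1 z := fun z => by
      induction z with
      | zero => simp
      | add a b ha hb => simp only [mul_add, map_add, ha, hb]
      | tmul a b =>
        rw [tgtContract_tmul, ← F.sum_right (χ b 1)]
        simp [F.unitElt_eq, Finset.sum_mul, h.act_src]
    rw [← h.one_mul_comul, this, (hA a).tgt, MulOpposite.op_one, map_one, mul_one]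
  comul_mul := h.comul_mul
  comul_one := by
    rw [h.comul_one, h.lTensor_unitElt]
    simp only [F.unitElt_eq, TensorProduct.sum_tmul, TensorProduct.tmul_sum, map_sum,
      Finset.sum_mul_sum, Algebra.TensorProduct.assoc_tmul, Algebra.TensorProduct.tmul_mul_tmul,
      one_mul, mul_one]
  comul_one' := by
    rw [h.comul_one, h.lTensor_unitElt]
    simp only [F.unitElt_eq, TensorProduct.sum_tmul, TensorProduct.tmul_sum, map_sum,
      Finset.sum_mul_sum, Algebra.TensorProduct.assoc_tmul, Algebra.TensorProduct.tmul_mul_tmul,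
      one_mul, mul_one, h.comm]
    exact Finset.sum_comm
  counit_mul a b c := by
    -- The dual bases in E fuse the two values of ψ into one: ψ(u x_i) ψ(y_i v), with χ(a) applied
    -- inside the first, becomes ψ(χ(a)(u v)). Then `act_comul` evaluates u v.
    have : ∀ z, LinearMap.mul' K K (TensorProduct.map
        ((F.ψ ∘ₗ LinearMap.applyₗ 1 ∘ₗ χ.toLinearMap) ∘ₗ LinearMap.mulLeft K a)
        ((F.ψ ∘ₗ LinearMap.applyₗ 1 ∘ₗ χ.toLinearMap) ∘ₗ LinearMap.mulRight K c)
        (F.unitElt s t * z)) = F.ψ (χ a (LinearMap.mul' K L (TensorProduct.map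
          (LinearMap.applyₗ 1 ∘ₗ χ.toLinearMap)
          (LinearMap.applyₗ (χ c 1) ∘ₗ χ.toLinearMap) z))) := fun z => by
      induction z with
      | zero => simp
      | add a b ha hb => simp only [mul_add, map_add, ha, hb]
      | tmul x y =>
        rw [TensorProduct.map_tmul, LinearMap.mul'_apply]
        conv_rhs =>
          enter [2, 2, 2]
          rw [← F.sum_right ((LinearMap.applyₗ (χ c 1) ∘ₗ χ.toLinearMap) y)]
        simp [F.unitElt_eq, Finset.sum_mul, Finset.mul_sum, h.act_src, h.act_tgt, mul_comm]
    rw [← h.one_mul_comul, this, h.act_comul (hA b)]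
    simp
  counit_mul' a b c := by
    -- The same fusion with c acting through the first leg and a through the second, so the other
    -- dual basis expansion is used.
    have : ∀ z, LinearMap.mul' K K (TensorProduct.map
        ((F.ψ ∘ₗ LinearMap.applyₗ 1 ∘ₗ χ.toLinearMap) ∘ₗ LinearMap.mulRight K c)
        ((F.ψ ∘ₗ LinearMap.applyₗ 1 ∘ₗ χ.toLinearMap) ∘ₗ LinearMap.mulLeft K a)
        (F.unitElt s t * z)) = F.ψ (χ a (LinearMap.mul' K L (TensorProduct.map
          (LinearMap.applyₗ (χ c 1) ∘ₗ χ.toLinearMap)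
          (LinearMap.applyₗ 1 ∘ₗ χ.toLinearMap) z))) := fun z => by
      induction z with
      | zero => simp
      | add a b ha hb => simp only [mul_add, map_add, ha, hb]
      | tmul x y =>
        rw [TensorProduct.map_tmul, LinearMap.mul'_apply]
        conv_rhs =>
          enter [2, 2, 1]
          rw [← F.sum_left ((LinearMap.applyₗ (χ c 1) ∘ₗ χ.toLinearMap) x)]
        simp [F.unitElt_eq, Finset.sum_mul, Finset.mul_sum, h.act_src, h.act_tgt, mul_comm]
    rw [← h.one_mul_comul, this, h.act_comul (hA b)]
    simp

/-- `ε_s(a) = t(χ(a)ᵀ(1))` -/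
theorem sourceCounit_eq (h : IsLiftedComul F s t χ Δ) (a : A) :
    sourceCounit Δ (F.ψ ∘ₗ LinearMap.applyₗ 1 ∘ₗ χ.toLinearMap) a =
      t (MulOpposite.op (F.transpose (χ a) 1)) := by
  change TensorProduct.rid K A (LinearMap.lTensor A _ (Δ 1)) = _
  rw [h.comul_one, F.transpose_apply]
  simp [F.unitElt_eq, h.act_src]

/-- `ε_t(a) = s(χ(a)(1))` -/
theorem targetCounit_eq (h : IsLiftedComul F s t χ Δ) (a : A) :
    targetCounit Δ (F.ψ ∘ₗ LinearMap.applyₗ 1 ∘ₗ χ.toLinearMap) a = s (χ a 1) := by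
  change TensorProduct.lid K A (LinearMap.rTensor A _ (Δ 1)) = _
  rw [h.comul_one, ← F.sum_left (χ a 1)]
  simp [F.unitElt_eq, h.act_tgt]

end IsLiftedComul

end Lifted

end FaceClosure

end
noncomputable section

namespace FaceClosure

/-! ### Convolution, antipodes and generalized inverses -/

section Conv

variable {K C A : Type*} [Field K] [AddCommGroup C] [Module K C] [Ring A] [Algebra K A]

theorem conv_apply (Δ : C →ₗ[K] C ⊗[K] C) (f g : C →ₗ[K] A) (c : C) :
    conv Δ f g c = LinearMap.mul' K A (TensorProduct.map f g (Δ c)) := rfl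

theorem conv_assoc {Δ : C →ₗ[K] C ⊗[K] C}
    (hΔ : ∀ c, TensorProduct.assoc K C C C (Δ.rTensor C (Δ c)) = Δ.lTensor C (Δ c))
    (f g k : C →ₗ[K] A) : conv Δ (conv Δ f g) k = conv Δ f (conv Δ g k) := by
  ext c
  have h1 : ∀ z : C ⊗[K] C, TensorProduct.map (conv Δ f g) k z =
      TensorProduct.map (LinearMap.mul' K A ∘ₗ TensorProduct.map f g) k (Δ.rTensor C z) :=
    fun z => by
      induction z with
      | zero => simp
      | add a b ha hb => simp only [map_add, ha, hb]
      | tmul a b => simp [conv_apply]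
  have h2 : ∀ z : C ⊗[K] C, TensorProduct.map f (conv Δ g k) z =
      TensorProduct.map f (LinearMap.mul' K A ∘ₗ TensorProduct.map g k) (Δ.lTensor C z) :=
    fun z => by
      induction z with
      | zero => simp
      | add a b ha hb => simp only [map_add, ha, hb]
      | tmul a b => simp [conv_apply]
  have h3 : ∀ z : C ⊗[K] C ⊗[K] C, LinearMap.mul' K A
      (TensorProduct.map (LinearMap.mul' K A ∘ₗ TensorProduct.map f g) k z) =
      LinearMap.mul' K A (TensorProduct.map f (LinearMap.mul' K A ∘ₗ TensorProduct.map g k)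
        (TensorProduct.assoc K C C C z)) := fun z => by
    induction z with
    | zero => simp
    | add a b ha hb => simp only [map_add, ha, hb]
    | tmul a b =>
      induction a with
      | zero => simp
      | add a b ha hb => simp only [TensorProduct.add_tmul, map_add, ha, hb]
      | tmul a c => simp [mul_assoc]
  rw [conv_apply, h1, h3, hΔ, conv_apply, h2]

theorem conv_mulRight (Δ : C →ₗ[K] C ⊗[K] C) (f g : C →ₗ[K] A) (a : A) :
    conv Δ f (LinearMap.mulRight K a ∘ₗ g) = LinearMap.mulRight K a ∘ₗ conv Δ f g := by
  ext c
  simp only [conv_apply, LinearMap.comp_apply]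
  generalize Δ c = z
  induction z with
  | zero => simp
  | add a b ha hb => simp only [map_add, ha, hb]
  | tmul a b => simp [mul_assoc]

theorem conv_mulLeft (Δ : C →ₗ[K] C ⊗[K] C) (f g : C →ₗ[K] A) (a : A) :
    conv Δ (LinearMap.mulLeft K a ∘ₗ f) g = LinearMap.mulLeft K a ∘ₗ conv Δ f g := by
  ext c
  simp only [conv_apply, LinearMap.comp_apply]
  generalize Δ c = z
  induction z with
  | zero => simp
  | add a b ha hb => simp only [map_add, ha, hb]
  | tmul a b => simp [mul_assoc]

/-- A scalar standing between the two legs may be assigned to either of them. -/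
theorem conv_mulRight_left (Δ : C →ₗ[K] C ⊗[K] C) (f g : C →ₗ[K] A) (a : A) :
    conv Δ (LinearMap.mulRight K a ∘ₗ f) g = conv Δ f (LinearMap.mulLeft K a ∘ₗ g) := by
  ext c
  simp only [conv_apply]
  generalize Δ c = z
  induction z with
  | zero => simp
  | add a b ha hb => simp only [map_add, ha, hb]
  | tmul a b => simp [mul_assoc]

end Conv

/-! ### Inverse matrices over a noncommutative ring -/

section MatrixInverse

variable {A X : Type*} [Ring A] [Fintype X] [DecidableEq X] {M N : X → X → A}

theorem matrix_mul_eq_one (h : ∀ a b, ∑ c, M a c * N c b = if a = b then 1 else 0) :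
    Matrix.of M * Matrix.of N = 1 := by
  ext a b
  rw [Matrix.mul_apply, Matrix.one_apply]
  exact h a b

/-- If `M_{ab} p_b = q_a M_{ab}` and `N` is inverse to `M`, then `p_a N_{ab} = N_{ab} q_b`. -/
theorem intertwine_inverse (hMN : ∀ a b, ∑ c, M a c * N c b = if a = b then 1 else 0)
    (hNM : ∀ a b, ∑ c, N a c * M c b = if a = b then 1 else 0) {p q : X → A}
    (h : ∀ a b, M a b * p b = q a * M a b) (a b : X) : p a * N a b = N a b * q b := by
  have h' : Matrix.of M * Matrix.diagonal p = Matrix.diagonal q * Matrix.of M := by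
    ext a b
    simpa using h a b
  have : Matrix.diagonal p * Matrix.of N = Matrix.of N * Matrix.diagonal q := by
    calc Matrix.diagonal p * Matrix.of N
        = Matrix.of N * (Matrix.of M * Matrix.diagonal p) * Matrix.of N := by
          rw [← mul_assoc, matrix_mul_eq_one hNM, one_mul]
      _ = Matrix.of N * Matrix.diagonal q := by
          rw [h', mul_assoc, mul_assoc, matrix_mul_eq_one hMN, mul_one]
  simpa using congrFun (congrFun this a) b

/-- A left inverse equals a right inverse. This is the source of the uniqueness of F. -/
theorem inverse_unique {N' : X → X → A}
    (hNM : ∀ a b, ∑ c, N a c * M c b = if a = b then 1 else 0)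
    (hMN' : ∀ a b, ∑ c, M a c * N' c b = if a = b then 1 else 0) (a b : X) : N a b = N' a b := by
  have : Matrix.of N = Matrix.of N' := by
    rw [← mul_one (Matrix.of N), ← matrix_mul_eq_one hMN', ← mul_assoc, matrix_mul_eq_one hNM,
      one_mul]
  exact congrFun (congrFun this a) b

end MatrixInverse

/-! ### Antipodes of a lifted comultiplication -/

section LiftedAntipode

variable {K L A X : Type*} [Field K] [Ring L] [Algebra K L] [Ring A] [Algebra K A]
    [Fintype X] [DecidableEq X]
    {F : FrobeniusSystem K L} {s : L →ₐ[K] A} {t : Lᵐᵒᵖ →ₐ[K] A}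
    {χ : A →ₐ[K] Module.End K L} {Δ : A →ₗ[K] A ⊗[K] A}

/-- The map `a ⊗ b ↦ S(a) c b`. -/
def leftSandwich (S : A →ₗ[K] A) (c : A) : A ⊗[K] A →ₗ[K] A :=
  LinearMap.mul' K A ∘ₗ TensorProduct.map S (LinearMap.mulLeft K c)

/-- The map `a ⊗ b ↦ a c S(b)`. -/
def rightSandwich (S : A →ₗ[K] A) (c : A) : A ⊗[K] A →ₗ[K] A :=
  LinearMap.mul' K A ∘ₗ TensorProduct.map (LinearMap.mulRight K c) S

@[simp]
theorem leftSandwich_tmul (S : A →ₗ[K] A) (c a b : A) :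
    leftSandwich S c (a ⊗ₜ[K] b) = S a * (c * b) := by simp [leftSandwich]

@[simp]
theorem rightSandwich_tmul (S : A →ₗ[K] A) (c a b : A) :
    rightSandwich S c (a ⊗ₜ[K] b) = a * c * S b := by simp [rightSandwich]

/-- An antimultiplicative linear map acting on the images of `s` and `t` as the antipode. -/
structure IsBaseAntipode (F : FrobeniusSystem K L) (s : L →ₐ[K] A) (t : Lᵐᵒᵖ →ₐ[K] A)
    (S : A →ₗ[K] A) : Prop where
  map_mul : ∀ a b, S (a * b) = S b * S a
  map_src : ∀ f, S (s f) = t (MulOpposite.op (F.nakayama f))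
  map_tgt : ∀ g, S (t (MulOpposite.op g)) = s g

/-- `S(a₍₁₎) t(l) a₍₂₎ = t(χ(a)ᵀ(l))` and `a₍₁₎ s(l) S(a₍₂₎) = s(χ(a)(l))` for all `l`. -/
structure IsAntipodalAt (F : FrobeniusSystem K L) (s : L →ₐ[K] A) (t : Lᵐᵒᵖ →ₐ[K] A)
    (χ : A →ₐ[K] Module.End K L) (Δ : A →ₗ[K] A ⊗[K] A) (S : A →ₗ[K] A) (a : A) : Prop where
  left : ∀ l, leftSandwich S (t (MulOpposite.op l)) (Δ a) =
    t (MulOpposite.op (F.transpose (χ a) l))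
  right : ∀ l, rightSandwich S (s l) (Δ a) = s (χ a l)

variable {S : A →ₗ[K] A}

theorem IsAntipodalAt.add {a b : A} (ha : IsAntipodalAt F s t χ Δ S a)
    (hb : IsAntipodalAt F s t χ Δ S b) : IsAntipodalAt F s t χ Δ S (a + b) where
  left l := by
    simp only [map_add, ha.left, hb.left, F.transpose_add, MulOpposite.op_add]
  right l := by simp only [map_add, ha.right, hb.right, LinearMap.add_apply]

namespace IsLiftedComul

/-- By antimultiplicativity S(a₍₁₎b₍₁₎) t(l) a₍₂₎b₍₂₎ = S(b₍₁₎) [S(a₍₁₎) t(l) a₍₂₎] b₍₂₎. The inner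
bracket is t(χ(a)ᵀ(l)), a new parameter for b, and the transposes compose in the matching reversed
order. On the right side the roles of a and b are exchanged. -/
theorem isAntipodalAt_mul (h : IsLiftedComul F s t χ Δ) (hS : IsBaseAntipode F s t S) {a b : A}
    (ha : IsAntipodalAt F s t χ Δ S a) (hb : IsAntipodalAt F s t χ Δ S b) :
    IsAntipodalAt F s t χ Δ S (a * b) where
  left l := by
    have h1 : ∀ z x y, leftSandwich S (t (MulOpposite.op l)) (z * (x ⊗ₜ[K] y)) =
        S x * (leftSandwich S (t (MulOpposite.op l)) z * y) := fun z x y => by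
      induction z with
      | zero => simp
      | add a b ha hb => simp only [add_mul, mul_add, map_add, ha, hb]
      | tmul a b => simp [hS.map_mul, mul_assoc]
    have h2 : ∀ w, leftSandwich S (t (MulOpposite.op l)) (Δ a * w) =
        leftSandwich S (t (MulOpposite.op (F.transpose (χ a) l))) w := fun w => by
      induction w with
      | zero => simp
      | add a b ha hb => simp only [mul_add, map_add, ha, hb]
      | tmul x y => rw [h1, ha.left, leftSandwich_tmul]
    rw [h.comul_mul, h2, hb.left, map_mul χ, F.transpose_mul]
  right l := by
    have h1 : ∀ x y w, rightSandwich S (s l) ((x ⊗ₜ[K] y) * w) =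
        x * rightSandwich S (s l) w * S y := fun x y w => by
      induction w with
      | zero => simp
      | add a b ha hb => simp only [add_mul, mul_add, map_add, ha, hb]
      | tmul a b => simp [hS.map_mul, mul_assoc]
    have h2 : ∀ z, rightSandwich S (s l) (z * Δ b) = rightSandwich S (s (χ b l)) z := fun z => by
      induction z with
      | zero => simp
      | add a b ha hb => simp only [add_mul, map_add, ha, hb]
      | tmul x y => rw [h1, hb.right, rightSandwich_tmul]
    rw [h.comul_mul, h2, ha.right, map_mul χ]; rfl

/-- S turns t(x_i) into s(x_i), which passes t(l) and meets s(y_i), so E contributes s(∑ x_i y_i) =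
1. -/
theorem leftSandwich_unitElt_mul (h : IsLiftedComul F s t χ Δ) (hS : IsBaseAntipode F s t S)
    (l : L) (z : A ⊗[K] A) : leftSandwich S (t (MulOpposite.op l)) (F.unitElt s t * z) =
      leftSandwich S (t (MulOpposite.op l)) z := by
  induction z with
  | zero => simp
  | add a b ha hb => simp only [mul_add, map_add, ha, hb]
  | tmul a b =>
    have : ∀ i, S (t (MulOpposite.op (F.x i)) * a) * (t (MulOpposite.op l) * (s (F.y i) * b)) =
        S a * s (F.x i * F.y i) * (t (MulOpposite.op l) * b) := fun i => by
      rw [hS.map_mul, hS.map_tgt, ← mul_assoc (t _), ← h.comm, map_mul]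
      simp only [mul_assoc]
    simp only [F.unitElt_eq, Finset.sum_mul, map_sum, Algebra.TensorProduct.tmul_mul_tmul,
      leftSandwich_tmul, this]
    rw [← Finset.sum_mul, ← Finset.mul_sum, ← map_sum, F.sum_mul, map_one, mul_one]

/-- Here E ends up outside: it wraps the value between t(x_i) and t(θ(y_i)). Only because the value
lies in the image of s, and so commutes with t, do the two factors meet as t(θ(y_i) x_i), whose sum
is 1. This is why the value s(f) must be known beforehand. -/
theorem rightSandwich_unitElt_mul (h : IsLiftedComul F s t χ Δ) (hS : IsBaseAntipode F s t S)
    (l : L) (z : A ⊗[K] A) {f : L} (hz : rightSandwich S (s l) z = s f) :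
    rightSandwich S (s l) (F.unitElt s t * z) = s f := by
  have h1 : ∀ w i, rightSandwich S (s l) ((t (MulOpposite.op (F.x i)) ⊗ₜ[K] s (F.y i)) * w) =
      t (MulOpposite.op (F.x i)) * rightSandwich S (s l) w *
        t (MulOpposite.op (F.nakayama (F.y i))) := fun w i => by
    induction w with
    | zero => simp
    | add a b ha hb => simp only [add_mul, mul_add, map_add, ha, hb]
    | tmul a b => simp [hS.map_mul, hS.map_src, mul_assoc]
  simp only [F.unitElt_eq, Finset.sum_mul, map_sum, h1, hz, ← h.comm]
  simp only [mul_assoc, ← map_mul, ← MulOpposite.op_mul, ← Finset.mul_sum, ← map_sum,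
    ← Finset.op_sum, F.sum_nakayama_mul]
  simp

theorem isAntipodalAt_src (h : IsLiftedComul F s t χ Δ) (hS : IsBaseAntipode F s t S) (f : L) :
    IsAntipodalAt F s t χ Δ S (s f) where
  left l := by
    rw [h.comul_src, h.leftSandwich_unitElt_mul hS, h.act_src, F.transpose_mulLeft,
      MulOpposite.op_mul, map_mul]
    simp [hS.map_src]
  right l := by
    rw [h.comul_src]
    refine h.rightSandwich_unitElt_mul hS l _ ?_
    have : S 1 = 1 := by rw [← map_one s, hS.map_src]; simp
    simp [this, h.act_src]

theorem isAntipodalAt_tgt (h : IsLiftedComul F s t χ Δ) (hS : IsBaseAntipode F s t S) (g : L) :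
    IsAntipodalAt F s t χ Δ S (t (MulOpposite.op g)) where
  left l := by
    have : S 1 = 1 := by rw [← map_one s, hS.map_src]; simp
    rw [h.comul_tgt, h.leftSandwich_unitElt_mul hS, h.act_tgt, F.transpose_mulRight,
      MulOpposite.op_mul, map_mul]
    simp [this]
  right l := by
    rw [h.comul_tgt]
    refine h.rightSandwich_unitElt_mul hS l _ ?_
    simp [hS.map_tgt, h.act_tgt]

/-- On the left, t(l) crosses M_cb as t(τ_b⁻¹(l)) and S(M) M = 1 remains; τ_a⁻¹ is the transpose of
τ_a because τ_a preserves ψ. On the right, s(l) leaves to the left as s(τ_a(l)) and M S(M) = 1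
remains. -/
theorem isAntipodalAt_mat (h : IsLiftedComul F s t χ Δ) (hS : IsBaseAntipode F s t S)
    {τ : X → L ≃ₐ[K] L} {M : X → X → A} (hM : IsMatCorep F s t χ Δ τ M)
    (hτ : ∀ a l, F.ψ (τ a l) = F.ψ l)
    (hMS : ∀ a b, ∑ c, M a c * S (M c b) = if a = b then 1 else 0)
    (hSM : ∀ a b, ∑ c, S (M a c) * M c b = if a = b then 1 else 0) (a b : X) :
    IsAntipodalAt F s t χ Δ S (M a b) where
  left l := by
    rw [hM.comul, h.leftSandwich_unitElt_mul hS, map_sum]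
    have : ∀ c, t (MulOpposite.op l) * M c b = M c b * t (MulOpposite.op ((τ b).symm l)) :=
      fun c => by rw [hM.mul_tgt]; simp
    simp only [leftSandwich_tmul, this, ← mul_assoc, ← Finset.sum_mul, hSM, hM.act]
    split_ifs with hab
    · rw [F.transpose_equiv _ (hτ a), hab, one_mul]
    · simp [F.transpose_zero]
  right l := by
    rw [hM.comul]
    refine h.rightSandwich_unitElt_mul hS l _ ?_
    simp only [map_sum, rightSandwich_tmul, hM.mul_src, mul_assoc, ← Finset.mul_sum, hMS, hM.act]
    split_ifs with hab
    · simp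
    · simp

/-- The two counital identities are the antipodal ones at l = 1. The third reduces to S ⋆ ε_t = S,
which follows by applying S to the target counit identity t(χ(a₍₂₎)(1)) a₍₁₎ = a. -/
theorem isWeakHopfAntipode (h : IsLiftedComul F s t χ Δ) (hS : IsBaseAntipode F s t S)
    (hA : ∀ a, IsCounitalAt s t χ Δ a) (hA' : ∀ a, IsAntipodalAt F s t χ Δ S a) :
    IsWeakHopfAntipode Δ (F.ψ ∘ₗ LinearMap.applyₗ 1 ∘ₗ χ.toLinearMap) S := by
  have left : conv Δ S LinearMap.id =
      sourceCounit Δ (F.ψ ∘ₗ LinearMap.applyₗ 1 ∘ₗ χ.toLinearMap) := by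
    ext a
    rw [h.sourceCounit_eq, ← (hA' a).left, conv_apply, MulOpposite.op_one, map_one]
    generalize Δ a = z
    induction z with
    | zero => simp
    | add a b ha hb => simp only [map_add, ha, hb]
    | tmul a b => simp
  have right : conv Δ LinearMap.id S =
      targetCounit Δ (F.ψ ∘ₗ LinearMap.applyₗ 1 ∘ₗ χ.toLinearMap) := by
    ext a
    rw [h.targetCounit_eq, ← (hA' a).right, conv_apply, map_one]
    generalize Δ a = z
    induction z with
    | zero => simp
    | add a b ha hb => simp only [map_add, ha, hb]
    | tmul a b => simp
  refine ⟨left, right, ?_⟩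
  rw [conv_assoc (fun a => (hA a).coassoc), right]
  ext a
  rw [conv_apply]
  have := congrArg S ((hA a).tgt 1)
  rw [MulOpposite.op_one, map_one, mul_one] at this
  rw [← this]
  generalize Δ a = z
  induction z with
  | zero => simp
  | add a b ha hb => simp only [map_add, ha, hb]
  | tmul a b => simp [h.targetCounit_eq, hS.map_mul, hS.map_tgt]

end IsLiftedComul

end LiftedAntipode

/-! ### Antipodes of algebra maps out of the weak bialgebra -/

section AntipodeOf

variable {K L B A X : Type*} [Field K] [Ring L] [Algebra K L] [Ring B] [Algebra K B]
    [Ring A] [Algebra K A] [Fintype X] [DecidableEq X]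
    {F : FrobeniusSystem K L} {s : L →ₐ[K] B} {t : Lᵐᵒᵖ →ₐ[K] B}
    {χ : B →ₐ[K] Module.End K L} {Δ : B →ₗ[K] B ⊗[K] B} {fp : B →ₐ[K] A} {fm : B →ₗ[K] A}

/-- When multiplication by b affects only one leg of the coproduct, it can be taken out of the
convolution. The next two lemmas are the other cases needed for s and t. -/
theorem conv_comp_mulLeft_left {b : B} (hb : ∀ a, Δ (b * a) = (b ⊗ₜ[K] (1 : B)) * Δ a)
    (f g : B →ₗ[K] A) :
    conv Δ (f ∘ₗ LinearMap.mulLeft K b) g = conv Δ f g ∘ₗ LinearMap.mulLeft K b := by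
  ext a
  rw [LinearMap.comp_apply, LinearMap.mulLeft_apply, conv_apply, conv_apply, hb]
  generalize Δ a = z
  induction z with
  | zero => simp
  | add a b ha hb => simp only [map_add, mul_add, ha, hb]
  | tmul a b => simp

theorem conv_comp_mulLeft_right {b : B} (hb : ∀ a, Δ (b * a) = ((1 : B) ⊗ₜ[K] b) * Δ a)
    (f g : B →ₗ[K] A) :
    conv Δ f (g ∘ₗ LinearMap.mulLeft K b) = conv Δ f g ∘ₗ LinearMap.mulLeft K b := by
  ext a
  rw [LinearMap.comp_apply, LinearMap.mulLeft_apply, conv_apply, conv_apply, hb]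
  generalize Δ a = z
  induction z with
  | zero => simp
  | add a b ha hb => simp only [map_add, mul_add, ha, hb]
  | tmul a b => simp

theorem conv_comp_mulRight_left {b : B} (hb : ∀ a, Δ (a * b) = Δ a * (b ⊗ₜ[K] (1 : B)))
    (f g : B →ₗ[K] A) :
    conv Δ (f ∘ₗ LinearMap.mulRight K b) g = conv Δ f g ∘ₗ LinearMap.mulRight K b := by
  ext a
  rw [LinearMap.comp_apply, LinearMap.mulRight_apply, conv_apply, conv_apply, hb]
  generalize Δ a = z
  induction z with
  | zero => simp
  | add a b ha hb => simp only [map_add, add_mul, ha, hb]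
  | tmul a b => simp

namespace IsAntipodeOf

/-- Convolve with f⁺ on the left. Since t(g) acts on the second leg, both sides become explicit:
ε_t(t(g)a) = s(χ(a)(1) g) = ε_t(a) s(g). The identity f⁻ ⋆ f⁺ ⋆ f⁻ = f⁻ then removes f⁺ again. -/
theorem neg_tgt_mul (h : IsLiftedComul F s t χ Δ) (hB : ∀ a, IsCounitalAt s t χ Δ a)
    (hf : IsAntipodeOf Δ (F.ψ ∘ₗ LinearMap.applyₗ 1 ∘ₗ χ.toLinearMap) fp fm) (g : L) (a : B) :
    fm (t (MulOpposite.op g) * a) = fm a * fp (s g) := by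
  have assoc := fun f g k : B →ₗ[K] A => conv_assoc (fun a => (hB a).coassoc) f g k
  have key : conv Δ fp.toLinearMap (fm ∘ₗ LinearMap.mulLeft K (t (MulOpposite.op g))) =
      conv Δ fp.toLinearMap (LinearMap.mulRight K (fp (s g)) ∘ₗ fm) := by
    rw [conv_comp_mulLeft_right (h.comul_tgt_mul _), conv_mulRight, hf.pos_neg]
    ext a
    simp [h.targetCounit_eq, h.act_tgt]
  have : fm ∘ₗ LinearMap.mulLeft K (t (MulOpposite.op g)) =
      LinearMap.mulRight K (fp (s g)) ∘ₗ fm := by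
    conv_lhs => rw [← hf.neg_pos_neg]
    conv_rhs => rw [← hf.neg_pos_neg]
    rw [← conv_comp_mulLeft_right (h.comul_tgt_mul _), ← conv_mulRight, assoc, key, ← assoc]
  exact LinearMap.congr_fun this a

/-- Now s(f) acts on the first leg, so the comparison is made after convolving with f⁺ on the right,
through ε_s(s(f)a) = ε_s(t(θ(f))a); the Nakayama automorphism enters with the transpose of left
multiplication by f. -/
theorem neg_src_mul (h : IsLiftedComul F s t χ Δ) (hB : ∀ a, IsCounitalAt s t χ Δ a)
    (hf : IsAntipodeOf Δ (F.ψ ∘ₗ LinearMap.applyₗ 1 ∘ₗ χ.toLinearMap) fp fm) (f : L) (a : B) :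
    fm (s f * a) = fm a * fp (t (MulOpposite.op (F.nakayama f))) := by
  have assoc := fun f g k : B →ₗ[K] A => conv_assoc (fun a => (hB a).coassoc) f g k
  set c := t (MulOpposite.op (F.nakayama f)) with hc
  have key : conv Δ (fm ∘ₗ LinearMap.mulLeft K (s f)) fp.toLinearMap =
      conv Δ (LinearMap.mulRight K (fp c) ∘ₗ fm) fp.toLinearMap := by
    have e : LinearMap.mulLeft K (fp c) ∘ₗ fp.toLinearMap =
        fp.toLinearMap ∘ₗ LinearMap.mulLeft K c := by ext; simp
    rw [conv_comp_mulLeft_left (h.comul_src_mul _), conv_mulRight_left, e,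
      conv_comp_mulLeft_right (h.comul_tgt_mul _), hf.neg_pos]
    ext a
    simp [h.sourceCounit_eq, h.act_src, h.act_tgt, hc, F.transpose_mul, F.transpose_mulLeft,
      F.transpose_mulRight]
  have e1 : conv Δ fm (conv Δ fp.toLinearMap fm) = fm := by rw [← assoc, hf.neg_pos_neg]
  -- When f⁺ is removed, the factor f⁺(c) is left in the middle of f⁻ ⋆ (f⁺ ⋆ f⁻). It moves to the
  -- right end because f⁺ ⋆ f⁻ = f⁺ ∘ ε_t takes values in the image of s, which commutes with c in
  -- the image of t.
  have e2 : LinearMap.mulLeft K (fp c) ∘ₗ conv Δ fp.toLinearMap fm =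
      LinearMap.mulRight K (fp c) ∘ₗ conv Δ fp.toLinearMap fm := by
    rw [hf.pos_neg]
    ext a
    simp [h.targetCounit_eq, ← map_mul, hc, h.comm]
  have : fm ∘ₗ LinearMap.mulLeft K (s f) = LinearMap.mulRight K (fp c) ∘ₗ fm := by
    conv_lhs => rw [← hf.neg_pos_neg]
    rw [← conv_comp_mulLeft_left (h.comul_src_mul _), ← conv_comp_mulLeft_left (h.comul_src_mul _),
      key, assoc, conv_mulRight_left, e2, conv_mulRight, e1]
  exact LinearMap.congr_fun this a

/-- Right multiplication by s(f) affects only the first leg, and ε_s(a s(f)) = t(θ(f)) ε_s(a). As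
the factor now stands at the outer left, cancelling f⁺ needs no commutation. -/
theorem neg_mul_src (h : IsLiftedComul F s t χ Δ)
    (hf : IsAntipodeOf Δ (F.ψ ∘ₗ LinearMap.applyₗ 1 ∘ₗ χ.toLinearMap) fp fm) (f : L) (a : B) :
    fm (a * s f) = fp (t (MulOpposite.op (F.nakayama f))) * fm a := by
  set c := t (MulOpposite.op (F.nakayama f)) with hc
  have key : conv Δ (fm ∘ₗ LinearMap.mulRight K (s f)) fp.toLinearMap =
      conv Δ (LinearMap.mulLeft K (fp c) ∘ₗ fm) fp.toLinearMap := by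
    rw [conv_comp_mulRight_left (h.comul_mul_src _), conv_mulLeft, hf.neg_pos]
    ext a
    simp [h.sourceCounit_eq, h.act_src, hc, F.transpose_mul, F.transpose_mulLeft]
  have : fm ∘ₗ LinearMap.mulRight K (s f) = LinearMap.mulLeft K (fp c) ∘ₗ fm := by
    conv_lhs => rw [← hf.neg_pos_neg]
    conv_rhs => rw [← hf.neg_pos_neg]
    rw [← conv_comp_mulRight_left (h.comul_mul_src _),
      ← conv_comp_mulRight_left (h.comul_mul_src _), key, conv_mulLeft, conv_mulLeft]
  exact LinearMap.congr_fun this a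

/-- The antipode inverts a matrix corepresentation from the right. -/
theorem sum_pos_neg (h : IsLiftedComul F s t χ Δ) (hB : ∀ a, IsCounitalAt s t χ Δ a)
    (hf : IsAntipodeOf Δ (F.ψ ∘ₗ LinearMap.applyₗ 1 ∘ₗ χ.toLinearMap) fp fm)
    {τ : X → L ≃ₐ[K] L} {M : X → X → B} (hM : IsMatCorep F s t χ Δ τ M)
    (hτ : ∀ a l, F.ψ (τ a l) = F.ψ l) (a b : X) :
    ∑ c, fp (M a c) * fm (M c b) = if a = b then 1 else 0 := by
  have h1 : conv Δ fp.toLinearMap fm (M a b) = if a = b then 1 else 0 := by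
    rw [hf.pos_neg, LinearMap.comp_apply, h.targetCounit_eq, hM.act]
    split_ifs <;> simp
  rw [← h1, conv_apply, hM.comul]
  -- Evaluate f⁻ in two ways on s(τ_c(l)) M_cb = M_cb s(l).
  have comm : ∀ c l, fm (M c b) * fp (t (MulOpposite.op (F.nakayama (τ c l)))) =
      fp (t (MulOpposite.op (F.nakayama l))) * fm (M c b) := fun c l => by
    rw [← neg_src_mul h hB hf, ← neg_mul_src h hf, hM.mul_src]
  -- The twists in the two factors are inverse to each other because θ commutes with τ_c, so each
  -- product f⁺(M_ac) f⁻(M_cb) commutes with the image of t.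
  have comm' : ∀ c l, fp (M a c) * (fm (M c b) * fp (t (MulOpposite.op (F.nakayama l)))) =
      fp (t (MulOpposite.op (F.nakayama l))) * (fp (M a c) * fm (M c b)) := fun c l => by
    rw [← (τ c).apply_symm_apply l, comm, ← mul_assoc, ← map_mul, hM.mul_tgt,
      ← F.nakayama_equiv _ (hτ c), map_mul, mul_assoc]
  -- The factors contributed by E therefore come together on the left as t(θ(y_i) x_i), and these
  -- sum to 1.
  have e : ∀ i c, fp (t (MulOpposite.op (F.x i)) * M a c) * fm (s (F.y i) * M c b) =
      fp (t (MulOpposite.op (F.nakayama (F.y i) * F.x i))) * (fp (M a c) * fm (M c b)) :=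
    fun i c => by
      rw [neg_src_mul h hB hf, map_mul, mul_assoc, comm', MulOpposite.op_mul, map_mul, map_mul,
        mul_assoc]
  simp only [F.unitElt_eq, Finset.sum_mul_sum, map_sum, Algebra.TensorProduct.tmul_mul_tmul,
    TensorProduct.map_tmul, LinearMap.mul'_apply, AlgHom.toLinearMap_apply, e]
  simp only [← Finset.mul_sum, ← Finset.sum_mul, ← map_sum, ← Finset.op_sum, F.sum_nakayama_mul]
  simp

/-- The antipode inverts a matrix corepresentation from the left. -/
theorem sum_neg_pos (h : IsLiftedComul F s t χ Δ) (hB : ∀ a, IsCounitalAt s t χ Δ a)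
    (hf : IsAntipodeOf Δ (F.ψ ∘ₗ LinearMap.applyₗ 1 ∘ₗ χ.toLinearMap) fp fm)
    {τ : X → L ≃ₐ[K] L} {M : X → X → B} (hM : IsMatCorep F s t χ Δ τ M)
    (hτ : ∀ a l, F.ψ (τ a l) = F.ψ l) (a b : X) :
    ∑ c, fm (M a c) * fp (M c b) = if a = b then 1 else 0 := by
  have h1 : conv Δ fm fp.toLinearMap (M a b) = if a = b then 1 else 0 := by
    rw [hf.neg_pos, LinearMap.comp_apply, h.sourceCounit_eq, hM.act]
    split_ifs
    · rw [F.transpose_equiv _ (hτ a)]; simp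
    · rw [F.transpose_zero]; simp
  rw [← h1, conv_apply, hM.comul]
  -- In this order t(x_i) comes out of f⁻ as s(x_i) right beside s(y_i), so E collapses by e⁽¹⁾e⁽²⁾
  -- = 1 with no twist by θ.
  have e : ∀ i c, fm (t (MulOpposite.op (F.x i)) * M a c) * fp (s (F.y i) * M c b) =
      fm (M a c) * (fp (s (F.x i * F.y i)) * fp (M c b)) := fun i c => by
    rw [neg_tgt_mul h hB hf]
    simp only [map_mul, mul_assoc]
  simp only [F.unitElt_eq, Finset.sum_mul_sum, map_sum, Algebra.TensorProduct.tmul_mul_tmul,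
    TensorProduct.map_tmul, LinearMap.mul'_apply, AlgHom.toLinearMap_apply, e]
  rw [Finset.sum_comm]
  simp only [← Finset.mul_sum, ← Finset.sum_mul, ← map_sum, F.sum_mul]
  simp

end IsAntipodeOf

end AntipodeOf

end FaceClosure

end
noncomputable section

namespace FaceClosure

/-! ### The weak Hopf algebra `A_σ` -/

section Shift

variable {K : Type*} [Field K] {R : Type*} [Ring R] [Algebra K R] {Λ : Type*}

/-- The automorphism `T_α` of the algebra of maps `Λ → R`. -/
def shiftEquiv (K : Type*) [Field K] {R : Type*} [Ring R] [Algebra K R] {Λ : Type*}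
    (α : Equiv.Perm Λ) : (Λ → R) ≃ₐ[K] (Λ → R) :=
  AlgEquiv.ofAlgHom (shift K α) (shift K α⁻¹)
    (by ext f l; simp [shift_apply]) (by ext f l; simp [shift_apply])

theorem shiftEquiv_apply (α : Equiv.Perm Λ) (f : Λ → R) : shiftEquiv K α f = shift K α f := rfl

/-- A permutation of Λ only reorders the summands of ψ. This makes the automorphisms T_deg(a)
orthogonal and lets them commute with θ. -/
theorem FrobeniusSystem.pi_form_shiftEquiv [Fintype Λ] [DecidableEq Λ] (F : FrobeniusSystem K R)
    (α : Equiv.Perm Λ) (f : Λ → R) : (F.pi Λ).ψ (shiftEquiv K α f) = (F.pi Λ).ψ f := by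
  simp only [pi, LinearMap.sum_apply, LinearMap.comp_apply, LinearMap.proj_apply]
  exact Equiv.sum_comp α (fun l => F.ψ (f l))

end Shift

namespace ASigma

variable {K : Type*} [Field K] {R : Type*} [Ring R] [Algebra K R] {Λ X : Type*}
  [Fintype X] [DecidableEq X] (D : SigmaDatum Λ X R)

theorem scal_tmul (f : Λ → R) (g : (Λ → R)ᵐᵒᵖ) :
    scal K D (f ⊗ₜ[K] g) = src K D f * tgt K D g := by
  simp only [src, tgt, AlgHom.comp_apply, ← map_mul]
  simp

variable {D} in
/-- Induction on the generators of `A_σ`. -/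
theorem induction {P : ASigma K D → Prop} (add : ∀ a b, P a → P b → P (a + b))
    (mul : ∀ a b, P a → P b → P (a * b)) (src : ∀ f, P (src K D f))
    (tgt : ∀ g, P (tgt K D (MulOpposite.op g))) (L : ∀ a b, P (L K D a b))
    (Linv : ∀ a b, P (Linv K D a b)) (a : ASigma K D) : P a := by
  obtain ⟨z, rfl⟩ := PresAlg.mk_surjective K {z | SigmaRel K D z} a
  change P (mk D z)
  induction z using FreeAlgebra.induction with
  | grade0 c =>
    have : mk D (algebraMap K _ c) = ASigma.src K D (algebraMap K _ c) := by
      rw [AlgHom.commutes, AlgHom.commutes]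
    rw [this]
    exact src _
  | grade1 g =>
    cases g with
    | scal ξ =>
      change P (scal K D ξ)
      induction ξ with
      | zero => rw [map_zero, ← map_zero (ASigma.src K D)]; exact src 0
      | add x y hx hy => rw [map_add]; exact add _ _ hx hy
      | tmul f g => rw [scal_tmul]; exact mul _ _ (src f) (tgt g.unop)
    | L a b => exact L a b
    | Linv a b => exact Linv a b
  | mul x y hx hy => rw [map_mul]; exact mul _ _ hx hy
  | add x y hx hy => rw [map_add]; exact add _ _ hx hy

/-! ### Algebra maps out of A_σ from generators and relations -/

section Lift

variable {C : Type*} [Ring C] [Algebra K C]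

/-- The defining relations of `A_σ` for an algebra map on `M ⊗ Mᵒᵖ` and two matrices. -/
structure Compatible (φ : (Λ → R) ⊗[K] (Λ → R)ᵐᵒᵖ →ₐ[K] C) (ℓ ℓi : X → X → C) : Prop where
  mul_inv : ∀ a b, ∑ c, ℓ a c * ℓi c b = if a = b then 1 else 0
  inv_mul : ∀ a b, ∑ c, ℓi a c * ℓ c b = if a = b then 1 else 0
  mul_inl : ∀ f a b, ℓ a b * φ (inl K f) = φ (inl K (shift K (D.deg a) f)) * ℓ a b
  mul_inr : ∀ f a b, ℓ a b * φ (inr K f) = φ (inr K (shift K (D.deg b) f)) * ℓ a b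
  inl_mul : ∀ f a b, φ (inl K f) * ℓi a b = ℓi a b * φ (inl K (shift K (D.deg b) f))
  inr_mul : ∀ f a b, φ (inr K f) * ℓi a b = ℓi a b * φ (inr K (shift K (D.deg a) f))
  exch : ∀ a b c d, ∑ x, ∑ y, φ (inl K (D.σ x y a c)) * ℓ y d * ℓ x b =
    ∑ x, ∑ y, φ (inr K (D.σ b d x y)) * ℓ c y * ℓ a x

variable {D} {φ : (Λ → R) ⊗[K] (Λ → R)ᵐᵒᵖ →ₐ[K] C} {ℓ ℓi : X → X → C}

/-- The algebra map on the free algebra with prescribed values on the generators. -/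
def liftFree (φ : (Λ → R) ⊗[K] (Λ → R)ᵐᵒᵖ →ₐ[K] C) (ℓ ℓi : X → X → C) :
    FreeAlgebra K (Gen K Λ X R) →ₐ[K] C :=
  FreeAlgebra.lift K fun g => match g with
    | .scal ξ => φ ξ
    | .L a b => ℓ a b
    | .Linv a b => ℓi a b

theorem liftFree_scal (ξ : (Λ → R) ⊗[K] (Λ → R)ᵐᵒᵖ) : liftFree φ ℓ ℓi (gScal ξ) = φ ξ := by
  simp [liftFree, gScal]

theorem liftFree_L (a b : X) : liftFree φ ℓ ℓi (gL K R Λ a b) = ℓ a b := by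
  simp [liftFree, gL]

theorem liftFree_Linv (a b : X) : liftFree φ ℓ ℓi (gLinv K R Λ a b) = ℓi a b := by
  simp [liftFree, gLinv]

/-- The universal property of `A_σ` as a presented algebra. -/
def lift (h : Compatible D φ ℓ ℓi) : ASigma K D →ₐ[K] C :=
  PresAlg.algLift (liftFree φ ℓ ℓi) (fun z hz => by
    cases hz with
    | add ξ ξ' => simp only [map_sub, map_add, liftFree_scal, sub_self]
    | smul c ξ => simp only [map_sub, map_smul, liftFree_scal, sub_self]
    | mul ξ ξ' => simp only [map_sub, map_mul, liftFree_scal, sub_self]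
    | one => simp only [map_sub, map_one, liftFree_scal, sub_self]
    | L_Linv a b =>
      simp only [map_sub, map_sum, map_mul, liftFree_L, liftFree_Linv, h.mul_inv,
        apply_ite (liftFree φ ℓ ℓi), map_one, map_zero, sub_self]
    | Linv_L a b =>
      simp only [map_sub, map_sum, map_mul, liftFree_L, liftFree_Linv, h.inv_mul,
        apply_ite (liftFree φ ℓ ℓi), map_one, map_zero, sub_self]
    | L_left f a b => simp only [map_sub, map_mul, liftFree_L, liftFree_scal, h.mul_inl, sub_self]
    | L_right f a b => simp only [map_sub, map_mul, liftFree_L, liftFree_scal, h.mul_inr, sub_self]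
    | Linv_left f a b =>
      simp only [map_sub, map_mul, liftFree_Linv, liftFree_scal, h.inl_mul, sub_self]
    | Linv_right f a b =>
      simp only [map_sub, map_mul, liftFree_Linv, liftFree_scal, h.inr_mul, sub_self]
    | exch a b c d =>
      simp only [map_sub, map_sum, map_mul, liftFree_L, liftFree_scal, h.exch, sub_self])

theorem lift_src (h : Compatible D φ ℓ ℓi) (f : Λ → R) : lift h (src K D f) = φ (inl K f) :=
  liftFree_scal (inl K f)

theorem lift_tgt (h : Compatible D φ ℓ ℓi) (g : Λ → R) :
    lift h (tgt K D (MulOpposite.op g)) = φ (inr K g) :=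
  liftFree_scal (inr K g)

theorem lift_L (h : Compatible D φ ℓ ℓi) (a b : X) : lift h (L K D a b) = ℓ a b :=
  liftFree_L a b

theorem lift_Linv (h : Compatible D φ ℓ ℓi) (a b : X) : lift h (Linv K D a b) = ℓi a b :=
  liftFree_Linv a b

end Lift

theorem act_src (f : Λ → R) : act D (src K D f) = LinearMap.mulLeft K f := by
  refine (actFree_scal D (inl K f)).trans ?_
  ext g l
  simp [inl]

theorem act_tgt (g : Λ → R) :
    act D (tgt K D (MulOpposite.op g)) = LinearMap.mulRight K g := by
  refine (actFree_scal D (inr K g)).trans ?_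
  ext f l
  simp [inr]

variable [Fintype Λ] [DecidableEq Λ] (F : FrobeniusSystem K R)

theorem comul_mk (z : FreeAlgebra K (Gen K Λ X R)) :
    comul D F (mk D z) = (F.pi Λ).unitElt (src K D) (tgt K D) * comulFree D z := rfl

theorem counit_eq : counit D F =
    (F.pi Λ).ψ ∘ₗ LinearMap.applyₗ 1 ∘ₗ (act (K := K) D).toLinearMap := rfl

theorem isLiftedComul :
    IsLiftedComul (F.pi Λ) (src K D) (tgt K D) (act D) (comul D F) where
  comm := src_tgt_comm D
  act_src := act_src D
  act_tgt := act_tgt D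
  comul_mul a b := by
    obtain ⟨x, rfl⟩ := PresAlg.mk_surjective K {z | SigmaRel K D z} a
    obtain ⟨y, rfl⟩ := PresAlg.mk_surjective K {z | SigmaRel K D z} b
    change comul D F (mk D x * mk D y) = comul D F (mk D x) * comul D F (mk D y)
    -- With Δ = E · Δ̄, multiplicativity amounts to E Δ̄(x) E Δ̄(y) = E Δ̄(x) Δ̄(y), and the middle
    -- E is absorbed because Δ̄(x) preserves the balancing ideal.
    rw [← map_mul, comul_mk, comul_mk, comul_mk, map_mul, ← mul_assoc, ← mul_assoc,
      FrobeniusSystem.unitElt_mul_mul_unitElt _ _ _ (comulFree_mul_mem D x)]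
  comul_one := by rw [← map_one (mk D), comul_mk, map_one, mul_one]
  comul_src f := by
    rw [← mk_inl, comul_mk, comulFree_scal]
    simp [inl, mk_inl]
    rfl
  comul_tgt g := by
    obtain ⟨g⟩ := g
    change comul D F (tgt K D (MulOpposite.op g)) = _
    rw [← mk_inr, comul_mk, comulFree_scal]
    simp [inr, mk_inr]
    rfl

theorem isMatCorep_L : IsMatCorep (F.pi Λ) (src K D) (tgt K D) (act D) (comul D F)
    (fun a => shiftEquiv K (D.deg a)) (L K D) where
  mul_src a b f := L_mul_src D f a b
  mul_tgt a b f := L_mul_tgt D f a b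
  act a b := actFree_L D a b
  comul a b := by rw [L, comul_mk, comulFree_L]

/-- The coproduct of (L⁻¹)_ab has its indices in the opposite order, so it is the transpose of L⁻¹
that is a corepresentation, with twists deg(a)⁻¹. -/
theorem isMatCorep_Linv : IsMatCorep (F.pi Λ) (src K D) (tgt K D) (act D) (comul D F)
    (fun a => shiftEquiv K (D.deg a)⁻¹) (fun a b => Linv K D b a) where
  mul_src a b f := Linv_mul_src D f b a
  mul_tgt a b f := Linv_mul_tgt D f b a
  act a b := by
    refine (actFree_Linv D b a).trans ?_
    by_cases hab : a = b
    · subst hab; simp; rfl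
    · rw [if_neg hab, if_neg (Ne.symm hab)]
  comul a b := by rw [Linv, comul_mk, comulFree_Linv]

theorem isCounitalAt (a : ASigma K D) :
    IsCounitalAt (src K D) (tgt K D) (act D) (comul D F) a := by
  have h := isLiftedComul (K := K) D F
  induction a using induction with
  | add a b ha hb => exact ha.add hb
  | mul a b ha hb => exact h.isCounitalAt_mul ha hb
  | src f => exact h.isCounitalAt_src f
  | tgt g => exact h.isCounitalAt_tgt g
  | L a b => exact h.isCounitalAt_mat (isMatCorep_L D F) a b
  | Linv a b => exact h.isCounitalAt_mat (isMatCorep_Linv D F) b a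

theorem isWeakBialgebra : IsWeakBialgebra (comul (K := K) D F) (counit D F) :=
  (isLiftedComul D F).isWeakBialgebra (isCounitalAt D F)

/-! #### The antipode of `A_σ` for a rigid family -/

/-- The map `f ⊗ g ↦ t(θ(f)) s(g)` into the opposite algebra of `A_σ`. -/
def antipodeScal : (Λ → R) ⊗[K] (Λ → R)ᵐᵒᵖ →ₐ[K] (ASigma K D)ᵐᵒᵖ :=
  Algebra.TensorProduct.lift ((AlgHom.opComm.symm (tgt K D)).comp (F.pi Λ).nakayama)
    (AlgHom.op (src K D)) (fun f g => by
      change _ * _ = _ * _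
      apply MulOpposite.unop_injective
      simp [src_tgt_comm])

theorem antipodeScal_inl (f : Λ → R) : antipodeScal D F (inl K f) =
    MulOpposite.op (tgt K D (MulOpposite.op ((F.pi Λ).nakayama f))) := by
  simp [antipodeScal, inl]

theorem antipodeScal_inr (g : Λ → R) :
    antipodeScal D F (inr K g) = MulOpposite.op (src K D g) := by
  simp [antipodeScal, inr]

/-- The exchange relation for the matrix `L⁻¹`. -/
theorem Linv_exchange (a b c d : X) :
    ∑ x, ∑ y, Linv K D x b * Linv K D y d * tgt K D (MulOpposite.op (D.σ x y a c)) =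
      ∑ x, ∑ y, Linv K D a x * Linv K D c y * src K D (D.σ b d x y) := by
  -- Solve the exchange relation for its source weight by multiplying with L⁻¹ twice on the right;
  -- the left side of that relation is already replaced by the right one.
  have h1 : ∀ x y, src K D (D.σ b d x y) = ∑ u, ∑ v,
      (∑ p, ∑ q, tgt K D (MulOpposite.op (D.σ u v p q)) * L K D y q * L K D x p) *
        (Linv K D u b * Linv K D v d) := fun x y => by
    simp only [← exchange]
    have e : ∀ v, ∑ u, (∑ p, ∑ q, src K D (D.σ p q x y) * L K D q v * L K D p u) *
        (Linv K D u b * Linv K D v d) =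
        ∑ q, src K D (D.σ b q x y) * (L K D q v * Linv K D v d) := fun v => by
      simp only [Finset.sum_mul]
      rw [Finset.sum_comm]
      have e' : ∀ p, ∑ u, ∑ q, src K D (D.σ p q x y) * L K D q v * L K D p u *
          (Linv K D u b * Linv K D v d) = ∑ q, src K D (D.σ p q x y) * L K D q v *
            ((if p = b then 1 else 0) * Linv K D v d) := fun p => by
        rw [Finset.sum_comm]
        simp only [← L_mul_Linv, Finset.mul_sum, Finset.sum_mul, mul_assoc]
      simp only [e']
      rw [Finset.sum_eq_single b]
      · simp [mul_assoc]
      · intro p _ hp; simp [hp]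
      · simp
    rw [Finset.sum_comm]
    simp only [e]
    rw [Finset.sum_comm]
    simp only [← Finset.mul_sum, L_mul_Linv]
    simp
  -- Multiplying by L⁻¹ twice on the left isolates the target weight, shifted by the two factors it
  -- passes.
  have h2 : ∀ u v, ∑ x, ∑ y, Linv K D a x * Linv K D c y *
      (∑ p, ∑ q, tgt K D (MulOpposite.op (D.σ u v p q)) * L K D y q * L K D x p) =
      tgt K D (MulOpposite.op (shift K (D.deg a)⁻¹ (shift K (D.deg c)⁻¹ (D.σ u v a c)))) :=
    fun u v => by
    have e : ∀ x y p q, Linv K D a x * Linv K D c y *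
        (tgt K D (MulOpposite.op (D.σ u v p q)) * L K D y q * L K D x p) =
        tgt K D (MulOpposite.op (shift K (D.deg a)⁻¹ (shift K (D.deg c)⁻¹ (D.σ u v p q)))) *
          (Linv K D a x * ((Linv K D c y * L K D y q) * L K D x p)) := fun x y p q => by
      rw [← mul_assoc (tgt K D _), ← Linv_mul_tgt, mul_assoc (Linv K D a x) (tgt K D _),
        mul_assoc (Linv K D a x), ← mul_assoc (Linv K D c y), ← mul_assoc (Linv K D c y),
        Linv_mul_tgt]
      simp only [mul_assoc]
    simp only [Finset.mul_sum, e]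
    rw [sum_swap₄]
    rw [Finset.sum_eq_single a, Finset.sum_eq_single c]
    · simp only [← Finset.mul_sum, ← Finset.sum_mul, Linv_mul_L]
      simp [Linv_mul_L]
    · intro q _ hq
      simp only [← Finset.mul_sum, ← Finset.sum_mul, Linv_mul_L]
      simp [hq.symm]
    · simp
    · intro p _ hp
      refine Finset.sum_eq_zero fun q _ => ?_
      simp only [← Finset.mul_sum, ← Finset.sum_mul, Linv_mul_L]
      by_cases hq : c = q
      · simp [hq, Linv_mul_L, hp.symm]
      · simp [hq]
    · simp
  -- The invariance of σ enters here. The two sides evaluate σ at l deg(x)⁻¹ deg(y)⁻¹ and at l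
  -- deg(a)⁻¹ deg(c)⁻¹. If these points differ, then at neither of them do the two routes have the
  -- same end, and both values vanish.
  have h3 : ∀ x y, shift K (D.deg x)⁻¹ (shift K (D.deg y)⁻¹ (D.σ x y a c)) =
      shift K (D.deg a)⁻¹ (shift K (D.deg c)⁻¹ (D.σ x y a c)) := fun x y => by
    ext l
    simp only [shift_apply]
    by_cases hl : (D.deg y)⁻¹ ((D.deg x)⁻¹ l) = (D.deg c)⁻¹ ((D.deg a)⁻¹ l)
    · rw [hl]
    · rw [D.invariant a x c y, D.invariant a x c y]
      · intro h
        apply hl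
        rw [Equiv.Perm.inv_eq_iff_eq, Equiv.Perm.inv_eq_iff_eq, h]
        simp
      · intro h
        apply hl
        rw [eq_comm, Equiv.Perm.inv_eq_iff_eq, Equiv.Perm.inv_eq_iff_eq, ← h]
        simp
  calc _ = ∑ x, ∑ y, tgt K D (MulOpposite.op
          (shift K (D.deg a)⁻¹ (shift K (D.deg c)⁻¹ (D.σ x y a c)))) *
          (Linv K D x b * Linv K D y d) := by
        refine Finset.sum_congr rfl fun x _ => Finset.sum_congr rfl fun y _ => ?_
        rw [mul_assoc, Linv_mul_tgt, ← mul_assoc, Linv_mul_tgt, h3, mul_assoc]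
    _ = _ := by
        simp only [← h2, h1, Finset.mul_sum, Finset.sum_mul, mul_assoc]
        rw [sum_swap₄]

/-- These are the relations for an algebra map from A_σ to its opposite. Reversing products turns
the rigidity identities for x into the statement that x inverts L⁻¹ there, and the commutation rules
for x follow from those of L⁻¹ by inverting matrices. -/
theorem antipode_compatible {x : X → X → ASigma K D}
    (h1 : ∀ a b, ∑ c, Linv K D c b * x a c = if a = b then 1 else 0)
    (h2 : ∀ a b, ∑ c, x c b * Linv K D a c = if a = b then 1 else 0) :
    Compatible D (antipodeScal D F) (fun a b => MulOpposite.op (Linv K D a b))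
      (fun a b => MulOpposite.op (x a b)) where
  mul_inv a b := by
    apply MulOpposite.unop_injective
    simp only [Finset.unop_sum, MulOpposite.unop_mul, MulOpposite.unop_op, h2,
      apply_ite MulOpposite.unop, MulOpposite.unop_one, MulOpposite.unop_zero]
  inv_mul a b := by
    apply MulOpposite.unop_injective
    simp only [Finset.unop_sum, MulOpposite.unop_mul, MulOpposite.unop_op, h1,
      apply_ite MulOpposite.unop, MulOpposite.unop_one, MulOpposite.unop_zero]
  mul_inl f a b := by
    rw [antipodeScal_inl, antipodeScal_inl, ← MulOpposite.op_mul, ← MulOpposite.op_mul,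
      tgt_mul_Linv]
    have := (F.pi Λ).nakayama_equiv _ (F.pi_form_shiftEquiv (D.deg a)) f
    simp only [shiftEquiv_apply] at this
    rw [this]
  mul_inr f a b := by
    rw [antipodeScal_inr, antipodeScal_inr, ← MulOpposite.op_mul, ← MulOpposite.op_mul,
      src_mul_Linv]
  inl_mul f a b := by
    have := (F.pi Λ).nakayama_equiv _ (F.pi_form_shiftEquiv (D.deg b)) f
    simp only [shiftEquiv_apply] at this
    rw [antipodeScal_inl, antipodeScal_inl, ← MulOpposite.op_mul, ← MulOpposite.op_mul, this]
    congr 1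
    -- Rigidity pairs the entries of x and L⁻¹ across transposed indices, so the matrices inverse to
    -- each other over A_σ itself are the two transposes.
    refine intertwine_inverse (M := fun a b => Linv K D b a) (N := fun a b => x b a)
      (fun a b => ?_) (fun a b => ?_)
      (p := fun b => tgt K D (MulOpposite.op (shift K (D.deg b) ((F.pi Λ).nakayama f))))
      (q := fun _ => tgt K D (MulOpposite.op ((F.pi Λ).nakayama f)))
      (fun a b => (tgt_mul_Linv D _ b a).symm) b a |>.symm
    · rw [h1 b a]; simp only [eq_comm]
    · rw [h2 b a]; simp only [eq_comm]
  inr_mul f a b := by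
    rw [antipodeScal_inr, antipodeScal_inr, ← MulOpposite.op_mul, ← MulOpposite.op_mul]
    congr 1
    have := intertwine_inverse (M := fun a b => Linv K D b a) (N := fun a b => x b a)
      (fun a b => by rw [h1 b a]; simp only [eq_comm])
      (fun a b => by rw [h2 b a]; simp only [eq_comm])
      (p := fun _ => src K D (shift K (D.deg a) f))
      (q := fun c => src K D (shift K (D.deg c)⁻¹ (shift K (D.deg a) f)))
      (fun c d => Linv_mul_src D _ d c) b a
    refine Eq.trans ?_ this.symm
    congr 2
    ext l
    simp [shift_apply]
  exch a b c d := by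
    -- The weights have central values, hence are fixed by θ, and the relation becomes literally the
    -- exchange relation for L⁻¹.
    have hc : ∀ a b c d, (F.pi Λ).nakayama (D.σ a b c d) = D.σ a b c d := fun a b c d =>
      (F.pi Λ).nakayama_of_central fun z => by
        ext l
        exact (Subring.mem_center_iff.1 (D.central a b c d l) (z l)).symm
    apply MulOpposite.unop_injective
    simp only [antipodeScal_inl, antipodeScal_inr, hc, Finset.unop_sum, MulOpposite.unop_mul,
      MulOpposite.unop_op, ← mul_assoc]
    exact Linv_exchange D a b c d

/-- A rigid family makes `A_σ` a weak Hopf algebra. -/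
theorem exists_antipode (hrigid : IsRigid K D) :
    ∃ S : ASigma K D →ₗ[K] ASigma K D, IsWeakHopfAntipode (comul D F) (counit D F) S := by
  obtain ⟨x, _, hx⟩ := hrigid
  have hc := antipode_compatible D F (fun a b => (hx a b).1) (fun a b => (hx a b).2.1)
  let S : ASigma K D →ₗ[K] ASigma K D :=
    (MulOpposite.opLinearEquiv K).symm.toLinearMap ∘ₗ (lift hc).toLinearMap
  have hS : ∀ a, S a = (lift hc a).unop := fun a => rfl
  have hS' : IsBaseAntipode (F.pi Λ) (src K D) (tgt K D) S :=
    { map_mul := fun a b => by simp only [hS, map_mul, MulOpposite.unop_mul]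
      map_src := fun f => by rw [hS, lift_src, antipodeScal_inl, MulOpposite.unop_op]
      map_tgt := fun g => by rw [hS, lift_tgt, antipodeScal_inr, MulOpposite.unop_op] }
  have hL : ∀ a b, S (L K D a b) = Linv K D a b := fun a b => by
    rw [hS, lift_L, MulOpposite.unop_op]
  have hLinv : ∀ a b, S (Linv K D a b) = x a b := fun a b => by
    rw [hS, lift_Linv, MulOpposite.unop_op]
  have h := isLiftedComul (K := K) D F
  refine ⟨S, h.isWeakHopfAntipode hS' (isCounitalAt D F) fun a => ?_⟩
  induction a using induction with
  | add a b ha hb => exact ha.add hb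
  | mul a b ha hb => exact h.isAntipodalAt_mul hS' ha hb
  | src f => exact h.isAntipodalAt_src hS' f
  | tgt g => exact h.isAntipodalAt_tgt hS' g
  | L a b =>
    refine h.isAntipodalAt_mat hS' (isMatCorep_L D F) (fun a => F.pi_form_shiftEquiv _)
      (fun a b => ?_) (fun a b => ?_) a b
    · simp only [hL, L_mul_Linv]
    · simp only [hL, Linv_mul_L]
  | Linv a b =>
    refine h.isAntipodalAt_mat hS' (isMatCorep_Linv D F) (fun a => F.pi_form_shiftEquiv _)
      (fun a b => ?_) (fun a b => ?_) b a
    · simp only [hLinv, (hx b a).1, eq_comm]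
    · simp only [hLinv, (hx b a).2.1, eq_comm]

end ASigma

end FaceClosure

end
noncomputable section

namespace FaceClosure

open LQuiver LQuiver.FaceAlg

/-! ### The weak bialgebra `𝔄(w_σ)` -/

/-- `∑_λ t(δ_λ) ⊗ s(δ_λ)` is absorbed by `t(e⁽¹⁾) ⊗ s(e⁽²⁾)`. -/
theorem FrobeniusSystem.unitElt_mul_sum_single {K R A Λ : Type*} [Field K] [Ring R] [Algebra K R]
    [Ring A] [Algebra K A] [Fintype Λ] [DecidableEq Λ] (F : FrobeniusSystem K (Λ → R))
    (s : (Λ → R) →ₐ[K] A) (t : (Λ → R)ᵐᵒᵖ →ₐ[K] A) :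
    F.unitElt s t * ∑ u : Λ, t (MulOpposite.op (Pi.single u 1)) ⊗ₜ[K] s (Pi.single u 1) =
      F.unitElt s t := by
  have h1 : ∑ u : Λ, (Pi.single u 1 : Λ → R) = 1 := by
    ext l; simp [Finset.sum_apply, Pi.single_apply]
  have h2 : ∀ u : Λ, t (MulOpposite.op (Pi.single u 1)) ⊗ₜ[K] s (Pi.single u 1) =
      (t (MulOpposite.op (Pi.single u 1)) ⊗ₜ[K] (1 : A)) * ((1 : A) ⊗ₜ[K] s (Pi.single u 1)) :=
    fun u => by simp
  simp only [h2, Finset.mul_sum, ← mul_assoc, F.unitElt_mul]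
  simp only [mul_assoc, ← Finset.mul_sum, Algebra.TensorProduct.tmul_mul_tmul, ← map_mul,
    ← Pi.single_mul, mul_one, ← TensorProduct.tmul_sum, ← map_sum, h1, map_one]
  rw [← Algebra.TensorProduct.one_def, mul_one]

theorem LQuiver.QPath.sum_vertex {Λ Q : Type*} {𝒬 : LQuiver Λ Q} [Fintype Λ] [Fintype Q]
    {N : Type*} [AddCommMonoid N] (n : ℕ) (hn : n = 0) (f : {u : 𝒬.QPath // u.length = n} → N) :
    ∑ u, f u = ∑ v : Λ, f ⟨vertex 𝒬 v, hn.symm⟩ := by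
  subst hn
  symm
  refine Fintype.sum_bijective (fun v : Λ => (⟨vertex 𝒬 v, rfl⟩ : {u : 𝒬.QPath // u.length = 0}))
    ⟨fun v v' h => congrArg (fun x => x.1.src) h, fun u => ?_⟩ _ _ (fun _ => rfl)
  obtain ⟨⟨v, l, hc⟩, hl⟩ := u
  obtain rfl := List.length_eq_zero_iff.1 hl
  exact ⟨v, rfl⟩

namespace AFace

section General

variable {K R : Type*} [Field K] [Ring R] [Algebra K R] {Λ Q : Type*} [Fintype Λ] [DecidableEq Λ]
  [Fintype Q] {𝒬 : LQuiver Λ Q} (W : FaceWeights 𝒬 R)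

theorem src_mul_mk (z : R ⊗[K] Rᵐᵒᵖ) (p q : 𝒬.QPath) (h : p.length = q.length) (f : Λ → R) :
    src K W f * mk W (z ⊗ₜ[K] e K p q h) = mk W (((f p.src ⊗ₜ[K] 1) * z) ⊗ₜ[K] e K p q h) :=
  (map_mul (mk W) _ _).symm.trans (congrArg (mk W) (HFace.src_mul_tmul z p q h f))

theorem tgt_mul_mk (z : R ⊗[K] Rᵐᵒᵖ) (p q : 𝒬.QPath) (h : p.length = q.length)
    (f : (Λ → R)ᵐᵒᵖ) : tgt K W f * mk W (z ⊗ₜ[K] e K p q h) =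
      mk W ((1 ⊗ₜ[K] MulOpposite.op (f.unop q.src) * z) ⊗ₜ[K] e K p q h) :=
  (map_mul (mk W) _ _).symm.trans (congrArg (mk W) (HFace.tgt_mul_tmul z p q h f))

theorem src_eq (f : Λ → R) : src K W f =
    ∑ v : Λ, ∑ v' : Λ, mk W ((f v ⊗ₜ[K] (1 : Rᵐᵒᵖ)) ⊗ₜ[K] HFace.eV K 𝒬 v v') := by
  change mk W (HFace.srcLin K R 𝒬 f) = _
  simp only [HFace.srcLin_apply, map_sum]

theorem tgt_eq (f : (Λ → R)ᵐᵒᵖ) : tgt K W f = ∑ v : Λ, ∑ v' : Λ,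
    mk W (((1 : R) ⊗ₜ[K] MulOpposite.op (f.unop v)) ⊗ₜ[K] HFace.eV K 𝒬 v' v) := by
  change mk W (HFace.tgtLin K R 𝒬 f) = _
  simp only [HFace.tgtLin_apply, map_sum]

theorem src_tgt_comm (f : Λ → R) (g : (Λ → R)ᵐᵒᵖ) :
    src K W f * tgt K W g = tgt K W g * src K W f := by
  simp only [src_eq, Finset.sum_mul, Finset.mul_sum, HFace.eV, mk_mul_tgt, tgt_mul_mk]
  refine Finset.sum_congr rfl fun v _ => Finset.sum_congr rfl fun v' _ => ?_
  simp [QPath.tgt, QPath.vertex, endpt]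

theorem src_single_mul_tgt_single (v v' : Λ) :
    src K W (Pi.single v 1) * tgt K W (MulOpposite.op (Pi.single v' 1)) =
      face K W (HFace.eV K 𝒬 v v') := by
  rw [tgt_eq, Finset.mul_sum, Finset.sum_eq_single v']
  · rw [Finset.mul_sum, Finset.sum_eq_single v]
    · rw [HFace.eV, src_mul_mk]
      simp [QPath.vertex, mk_tmul, ← Algebra.TensorProduct.one_def]
    · intro u _ hu
      rw [HFace.eV, src_mul_mk]
      simp [QPath.vertex, hu]
    · simp
  · intro u _ hu
    simp [hu]
  · simp

theorem tgt_single_mul_src (u : Λ) (f : Λ → R) :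
    tgt K W (MulOpposite.op (Pi.single u 1)) * src K W f =
      ∑ v, mk W ((f v ⊗ₜ[K] (1 : Rᵐᵒᵖ)) ⊗ₜ[K] HFace.eV K 𝒬 v u) := by
  rw [src_eq, Finset.mul_sum]
  refine Finset.sum_congr rfl fun v _ => ?_
  rw [Finset.mul_sum, Finset.sum_eq_single u]
  · rw [HFace.eV, tgt_mul_mk]
    simp [QPath.vertex]
  · intro u' _ hu
    rw [HFace.eV, tgt_mul_mk]
    simp [QPath.vertex, hu]
  · simp

theorem src_single_mul_tgt (u : Λ) (g : Λ → R) :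
    src K W (Pi.single u 1) * tgt K W (MulOpposite.op g) =
      ∑ v, mk W ((1 ⊗ₜ[K] MulOpposite.op (g v)) ⊗ₜ[K] HFace.eV K 𝒬 u v) := by
  rw [tgt_eq, Finset.mul_sum]
  refine Finset.sum_congr rfl fun v _ => ?_
  rw [Finset.mul_sum, Finset.sum_eq_single u]
  · rw [HFace.eV, src_mul_mk]
    simp [QPath.vertex]
  · intro u' _ hu
    rw [HFace.eV, src_mul_mk]
    simp [QPath.vertex, hu]
  · simp

theorem comulH_eV (r : R) (r' : Rᵐᵒᵖ) (v v' : Λ) :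
    comulH W ((r ⊗ₜ[K] r') ⊗ₜ[K] HFace.eV K 𝒬 v v') =
      ∑ u, mk W ((r ⊗ₜ[K] 1) ⊗ₜ[K] HFace.eV K 𝒬 v u) ⊗ₜ[K]
        mk W ((1 ⊗ₜ[K] r') ⊗ₜ[K] HFace.eV K 𝒬 u v') := by
  rw [HFace.eV, comulH_apply, QPath.sum_vertex (QPath.vertex 𝒬 v).length rfl]
  rfl

/-- On vertices the coproduct inserts an intermediate vertex, so before multiplication by E it sends
1 not to 1 ⊗ 1 but to the idempotent ∑_u t(δ_u) ⊗ s(δ_u). The idempotent is kept as a factor because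
E absorbs it. -/
theorem comulH_src (f : Λ → R) : comulH W (HFace.srcLin K R 𝒬 f) =
    (∑ u : Λ, tgt K W (MulOpposite.op (Pi.single u 1)) ⊗ₜ[K] src K W (Pi.single u 1)) *
      (src K W f ⊗ₜ[K] 1) := by
  have h : ∀ u : Λ, src K W (Pi.single u 1) =
      ∑ v, mk W ((1 ⊗ₜ[K] 1) ⊗ₜ[K] HFace.eV K 𝒬 u v) := fun u => by
    have := src_single_mul_tgt (K := K) W u 1
    rw [MulOpposite.op_one, map_one, mul_one] at this
    rw [this]
    rfl
  rw [Finset.sum_mul]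
  simp only [Algebra.TensorProduct.tmul_mul_tmul, mul_one, tgt_single_mul_src]
  simp only [h, HFace.srcLin_apply, map_sum, comulH_eV, TensorProduct.sum_tmul,
    TensorProduct.tmul_sum]
  conv_lhs => enter [2, v]; rw [Finset.sum_comm]
  rw [Finset.sum_comm]
  exact Finset.sum_congr rfl fun u _ => Finset.sum_comm

theorem comulH_tgt (g : Λ → R) : comulH W (HFace.tgtLin K R 𝒬 (MulOpposite.op g)) =
    (∑ u : Λ, tgt K W (MulOpposite.op (Pi.single u 1)) ⊗ₜ[K] src K W (Pi.single u 1)) *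
      (1 ⊗ₜ[K] tgt K W (MulOpposite.op g)) := by
  have h : ∀ u : Λ, tgt K W (MulOpposite.op (Pi.single u 1)) =
      ∑ v, mk W ((1 ⊗ₜ[K] 1) ⊗ₜ[K] HFace.eV K 𝒬 v u) := fun u => by
    have := tgt_single_mul_src (K := K) W u 1
    rw [map_one, mul_one] at this
    rw [this]
    rfl
  rw [Finset.sum_mul]
  simp only [Algebra.TensorProduct.tmul_mul_tmul, mul_one, src_single_mul_tgt]
  simp only [h, HFace.tgtLin_apply, map_sum, comulH_eV, TensorProduct.sum_tmul,
    TensorProduct.tmul_sum]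
  rw [Finset.sum_comm]
  conv_lhs => enter [2, v]; rw [Finset.sum_comm]
  rw [Finset.sum_comm]
  refine Finset.sum_congr rfl fun u _ => ?_
  rw [Finset.sum_comm]
  rfl

variable [DecidableEq Q]

theorem act_mk (z : HFace K R 𝒬) : act W (mk W z) = actH K R 𝒬 z := rfl

theorem vertex_inj {v v' : Λ} : QPath.vertex 𝒬 v = QPath.vertex 𝒬 v' ↔ v = v' :=
  ⟨fun h => congrArg QPath.src h, fun h => congrArg _ h⟩

theorem act_src (f : Λ → R) : act W (src K W f) = LinearMap.mulLeft K f := by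
  refine LinearMap.ext fun m => ?_
  simp only [src_eq, map_sum, act_mk, LinearMap.sum_apply, HFace.eV, actH_apply, vertex_inj,
    Finset.sum_ite_eq, Finset.mem_univ, if_true]
  ext l
  simp [QPath.vertex, QPath.tgt, endpt, Pi.single_apply]

theorem act_tgt (g : Λ → R) :
    act W (tgt K W (MulOpposite.op g)) = LinearMap.mulRight K g := by
  refine LinearMap.ext fun m => ?_
  simp only [tgt_eq, map_sum, act_mk, LinearMap.sum_apply, HFace.eV, actH_apply, vertex_inj,
    Finset.sum_ite_eq', Finset.mem_univ, if_true]
  ext l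
  simp [QPath.vertex, QPath.tgt, endpt, Pi.single_apply]

variable (F : FrobeniusSystem K R)

theorem comul_mk (z : HFace K R 𝒬) :
    comul W F (mk W z) = (F.pi Λ).unitElt (src K W) (tgt K W) * comulH W z := rfl

theorem counit_eq : counit W F =
    (F.pi Λ).ψ ∘ₗ LinearMap.applyₗ 1 ∘ₗ (act (K := K) W).toLinearMap := rfl

theorem comul_src (f : Λ → R) : comul W F (src K W f) =
    (F.pi Λ).unitElt (src K W) (tgt K W) * (src K W f ⊗ₜ[K] 1) := by
  change comul W F (mk W (HFace.srcLin K R 𝒬 f)) = _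
  rw [comul_mk, comulH_src, ← mul_assoc, FrobeniusSystem.unitElt_mul_sum_single]

theorem isLiftedComul :
    IsLiftedComul (F.pi Λ) (src K W) (tgt K W) (act W) (comul W F) where
  comm := src_tgt_comm W
  act_src := act_src W
  act_tgt := act_tgt W
  comul_mul a b := by
    obtain ⟨x, rfl⟩ := PresAlg.mk_surjective K {z | ∃ ab cd, z = HFace.gen K W ab cd} a
    obtain ⟨y, rfl⟩ := PresAlg.mk_surjective K {z | ∃ ab cd, z = HFace.gen K W ab cd} b
    change comul W F (mk W x * mk W y) = comul W F (mk W x) * comul W F (mk W y)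
    rw [← map_mul, comul_mk, comul_mk, comul_mk, comulH_mul, ← mul_assoc, ← mul_assoc,
      FrobeniusSystem.unitElt_mul_mul_unitElt _ _ _ (comulH_mul_mem W x)]
  comul_one := by
    rw [← map_one (src K W), comul_src, map_one, ← Algebra.TensorProduct.one_def, mul_one]
  comul_src := comul_src W F
  comul_tgt g := by
    obtain ⟨g⟩ := g
    change comul W F (mk W (HFace.tgtLin K R 𝒬 (MulOpposite.op g))) = _
    rw [comul_mk, comulH_tgt, ← mul_assoc, FrobeniusSystem.unitElt_mul_sum_single]
    rfl

end General

/-! ### The generators ℓ_ab of 𝔄(w_σ) -/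

section Sigma

variable {K : Type*} [Field K] {R : Type*} [Ring R] [Algebra K R] {Λ X : Type*}
  [Fintype Λ] [DecidableEq Λ] [Fintype X] [DecidableEq X] (D : SigmaDatum Λ X R)

/-- The element `ℓ_{ab} = ∑_{λ, μ} e[(λ, a); (μ, b)]` of `𝔄(w_σ)`. -/
def ell (K : Type*) [Field K] [Algebra K R] (D : SigmaDatum Λ X R) (a b : X) :
    AFace K (sigmaWeights D) :=
  ∑ l : Λ, ∑ m : Λ, face K (sigmaWeights D) (HFace.eA K (sigmaQuiver D) (l, a) (m, b))

theorem face_eq_mk (x : FaceAlg K (sigmaQuiver D)) :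
    face K (sigmaWeights D) x = mk (sigmaWeights D) (1 ⊗ₜ[K] x) := rfl

theorem src_mul_eA (f : Λ → R) (l m : Λ) (a b : X) :
    src K (sigmaWeights D) f * face K _ (HFace.eA K (sigmaQuiver D) (l, a) (m, b)) =
      scal K _ (f l ⊗ₜ[K] 1) * face K _ (HFace.eA K (sigmaQuiver D) (l, a) (m, b)) := by
  rw [face_eq_mk, HFace.eA, src_mul_mk, mul_one, mk_tmul, mk_tmul, map_one, one_mul]
  rfl

theorem tgt_mul_eA (g : Λ → R) (l m : Λ) (a b : X) :
    tgt K (sigmaWeights D) (MulOpposite.op g) *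
        face K _ (HFace.eA K (sigmaQuiver D) (l, a) (m, b)) =
      scal K _ (1 ⊗ₜ[K] MulOpposite.op (g m)) *
        face K _ (HFace.eA K (sigmaQuiver D) (l, a) (m, b)) := by
  rw [face_eq_mk, HFace.eA, tgt_mul_mk, mul_one, mk_tmul, mk_tmul, map_one, one_mul]
  rfl

theorem eA_mul_src (f : Λ → R) (l m : Λ) (a b : X) :
    face K _ (HFace.eA K (sigmaQuiver D) (l, a) (m, b)) * src K (sigmaWeights D) f =
      scal K _ (f (D.deg a l) ⊗ₜ[K] 1) *
        face K _ (HFace.eA K (sigmaQuiver D) (l, a) (m, b)) := by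
  rw [face_eq_mk, HFace.eA, mk_mul_src, one_mul, mk_tmul, mk_tmul, map_one, one_mul]
  rfl

theorem eA_mul_tgt (g : Λ → R) (l m : Λ) (a b : X) :
    face K _ (HFace.eA K (sigmaQuiver D) (l, a) (m, b)) *
        tgt K (sigmaWeights D) (MulOpposite.op g) =
      scal K _ (1 ⊗ₜ[K] MulOpposite.op (g (D.deg b m))) *
        face K _ (HFace.eA K (sigmaQuiver D) (l, a) (m, b)) := by
  rw [face_eq_mk, HFace.eA, mk_mul_tgt, one_mul, mk_tmul, mk_tmul, map_one, one_mul]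
  rfl

theorem src_single_mul_ell (l : Λ) (a b : X) :
    src K (sigmaWeights D) (Pi.single l 1) * ell K D a b =
      ∑ m, face K _ (HFace.eA K (sigmaQuiver D) (l, a) (m, b)) := by
  rw [ell, Finset.mul_sum, Finset.sum_eq_single l]
  · simp [Finset.mul_sum, src_mul_eA, ← Algebra.TensorProduct.one_def]
  · intro l' _ hl
    simp [Finset.mul_sum, src_mul_eA, hl]
  · simp

theorem tgt_single_mul_ell (m : Λ) (a b : X) :
    tgt K (sigmaWeights D) (MulOpposite.op (Pi.single m 1)) * ell K D a b =
      ∑ l, face K _ (HFace.eA K (sigmaQuiver D) (l, a) (m, b)) := by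
  rw [ell, Finset.mul_sum]
  refine Finset.sum_congr rfl fun l _ => ?_
  rw [Finset.mul_sum, Finset.sum_eq_single m]
  · simp [tgt_mul_eA, ← Algebra.TensorProduct.one_def]
  · intro l' _ hl
    simp [tgt_mul_eA, hl]
  · simp

/-- Cutting ℓ_ab with the vertex idempotents recovers its single summands. Since e[l; m] = s(δ_l)
t(δ_m), this is why s, t and ℓ generate the whole algebra. -/
theorem face_eV_mul_ell (l m : Λ) (a b : X) :
    face K (sigmaWeights D) (HFace.eV K (sigmaQuiver D) l m) * ell K D a b =
      face K _ (HFace.eA K (sigmaQuiver D) (l, a) (m, b)) := by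
  rw [← src_single_mul_tgt_single, mul_assoc, tgt_single_mul_ell, Finset.mul_sum,
    Finset.sum_eq_single l]
  · simp [src_mul_eA, ← Algebra.TensorProduct.one_def]
  · intro l' _ hl
    simp [src_mul_eA, hl]
  · simp

/-- Only the summands with equal upper and lower arrow act; for a = b they send f to f(λ deg(a))
δ_λ, and their sum is the shift. -/
theorem act_ell (a b : X) : act (sigmaWeights D) (ell K D a b) =
    if a = b then (shiftEquiv K (D.deg a)).toLinearMap else 0 := by
  have inj : ∀ x y : Λ × X, QPath.arrow (sigmaQuiver D) x = QPath.arrow (sigmaQuiver D) y ↔ x = y :=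
    fun x y => ⟨fun h => by simpa [QPath.arrow] using congrArg QPath.arrows h,
      fun h => congrArg _ h⟩
  refine LinearMap.ext fun f => ?_
  simp only [ell, face_eq_mk, map_sum, act_mk, LinearMap.sum_apply, HFace.eA,
    Algebra.TensorProduct.one_def, actH_apply, inj, Prod.mk.injEq]
  split_ifs with hab
  · subst hab
    simp only [and_true, Finset.sum_ite_eq, Finset.mem_univ, if_true]
    ext l
    simp [QPath.arrow, QPath.tgt, endpt, sigmaQuiver, Pi.single_apply, shiftEquiv_apply,
      shift_apply]
  · simp [hab]

variable (F : FrobeniusSystem K R)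

/-- The coproduct of e[(l,a); (m,b)] runs over middle arrows (u,c). Summed over l and m it factors
into the vertex idempotent at u times ℓ_ac ⊗ ℓ_cb, and E absorbs the idempotent. -/
theorem isMatCorep_ell : IsMatCorep (F.pi Λ) (src K (sigmaWeights D)) (tgt K (sigmaWeights D))
    (act (sigmaWeights D)) (comul (sigmaWeights D) F)
    (fun a => shiftEquiv K (D.deg a)) (ell K D) where
  mul_src a b f := by
    simp only [ell, Finset.sum_mul, Finset.mul_sum, src_mul_eA, eA_mul_src]
    rfl
  mul_tgt a b f := by
    simp only [ell, Finset.sum_mul, Finset.mul_sum, tgt_mul_eA, eA_mul_tgt]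
    rfl
  act := act_ell D
  comul a b := by
    have h1 : ell K D a b = mk (sigmaWeights D) (1 ⊗ₜ[K] ∑ l : Λ, ∑ m : Λ,
        HFace.eA K (sigmaQuiver D) (l, a) (m, b)) := by
      rw [← face_eq_mk, map_sum]
      simp only [map_sum, ell]
    have h2 : comulH (sigmaWeights D) (1 ⊗ₜ[K] ∑ l : Λ, ∑ m : Λ,
        HFace.eA K (sigmaQuiver D) (l, a) (m, b)) =
        (∑ u : Λ, tgt K (sigmaWeights D) (MulOpposite.op (Pi.single u 1)) ⊗ₜ[K]
          src K (sigmaWeights D) (Pi.single u 1)) * ∑ c, ell K D a c ⊗ₜ[K] ell K D c b := by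
      rw [comulH_tmul, map_one, one_mul, Finset.sum_mul_sum]
      simp only [Algebra.TensorProduct.tmul_mul_tmul, src_single_mul_ell, tgt_single_mul_ell,
        map_sum, comulFace_eA, Fintype.sum_prod_type, TensorProduct.sum_tmul,
        TensorProduct.tmul_sum]
      have : ∀ f : Λ → Λ → Λ → X → AFace K (sigmaWeights D) ⊗[K] AFace K (sigmaWeights D),
          ∑ l, ∑ m, ∑ u, ∑ c, f l m u c = ∑ u, ∑ c, ∑ m, ∑ l, f l m u c := fun f => by
        calc ∑ l, ∑ m, ∑ u, ∑ c, f l m u c = ∑ p : Λ × Λ, ∑ q : Λ × X, f p.2 p.1 q.1 q.2 := by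
              simp only [Fintype.sum_prod_type]
              exact Finset.sum_comm
          _ = _ := by
              rw [Finset.sum_comm]
              simp only [Fintype.sum_prod_type]
      rw [this]
    conv_lhs => rw [h1, comul_mk, h2, ← mul_assoc, FrobeniusSystem.unitElt_mul_sum_single]

variable {D} in
/-- Induction on the generators `s(f)`, `t(g)` and `ℓ_{ab}` of `𝔄(w_σ)`. -/
theorem induction {P : AFace K (sigmaWeights D) → Prop} (add : ∀ a b, P a → P b → P (a + b))
    (mul : ∀ a b, P a → P b → P (a * b)) (src : ∀ f, P (src K (sigmaWeights D) f))
    (tgt : ∀ g, P (tgt K (sigmaWeights D) (MulOpposite.op g))) (ell : ∀ a b, P (ell K D a b))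
    (a : AFace K (sigmaWeights D)) : P a := by
  have zero : P 0 := by rw [← map_zero (AFace.src K (sigmaWeights D))]; exact src 0
  have smul : ∀ (c : K) a, P a → P (c • a) := fun c a ha => by
    have : c • a = AFace.src K (sigmaWeights D) (algebraMap K _ c) * a := by
      rw [AlgHom.commutes, ← Algebra.smul_def]
    rw [this]
    exact mul _ _ (src _) ha
  have eV : ∀ v v', P (face K (sigmaWeights D) (HFace.eV K (sigmaQuiver D) v v')) :=
    fun v v' => by
      rw [← src_single_mul_tgt_single]
      exact mul _ _ (src _) (tgt _)
  have face_e : ∀ p q h, P (face K (sigmaWeights D) (e K p q h)) := by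
    rintro ⟨v, l, hl⟩ ⟨v', l', hl'⟩ h
    change l.length = l'.length at h
    induction l generalizing v v' l' with
    | nil =>
      obtain rfl : l' = [] := List.length_eq_zero_iff.1 h.symm
      exact eV v v'
    | cons x l ih =>
      obtain ⟨y, l', rfl⟩ : ∃ y m, l' = y :: m := List.exists_cons_of_length_eq_add_one h.symm
      obtain ⟨rfl, h1⟩ := hl
      obtain ⟨rfl, h1'⟩ := hl'
      have h' : l.length = l'.length := by simpa using h
      have := ih _ h1 _ l' h1' h'
      -- A pair of paths is the product of its first pair of arrows and the remaining pair, so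
      -- induction on the length applies.
      have e1 : HFace.eA K (sigmaQuiver D) x y *
          e K (⟨_, l, h1⟩ : (sigmaQuiver D).QPath) ⟨_, l', h1'⟩ h' =
          e K ⟨_, x :: l, rfl, h1⟩ ⟨_, y :: l', rfl, h1'⟩ h := by
        exact (e_mul_e _ _ _ _ _ _).trans (dif_pos ⟨rfl, rfl⟩)
      rw [← e1, map_mul]
      refine mul _ _ ?_ this
      obtain ⟨l, a⟩ := x
      obtain ⟨m, b⟩ := y
      rw [← face_eV_mul_ell]
      exact mul _ _ (eV _ _) (ell _ _)
  have hface : ∀ x, P (face K (sigmaWeights D) x) := fun x => by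
    induction x using induction_e with
    | h0 => rw [map_zero]; exact zero
    | hadd a b ha hb => rw [map_add]; exact add _ _ ha hb
    | hsmul c a ha => rw [map_smul]; exact smul _ _ ha
    | he p q h => exact face_e p q h
  have hscal : ∀ z, P (scal K (sigmaWeights D) z) := fun z => by
    induction z with
    | zero => rw [map_zero]; exact zero
    | add a b ha hb => rw [map_add]; exact add _ _ ha hb
    | tmul r r' =>
      have : r ⊗ₜ[K] r' = (r ⊗ₜ[K] 1) * (1 ⊗ₜ[K] MulOpposite.op r'.unop) := by simp
      rw [this, map_mul, ← src_const, ← tgt_const]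
      exact mul _ _ (src _) (tgt _)
  obtain ⟨z, rfl⟩ := PresAlg.mk_surjective K
    {z | ∃ ab cd, z = HFace.gen K (sigmaWeights D) ab cd} a
  change P (mk (sigmaWeights D) z)
  induction z using TensorProduct.induction_on with
  | zero => rw [map_zero]; exact zero
  | add a b ha hb => rw [map_add]; exact add _ _ ha hb
  | tmul z x => rw [mk_tmul]; exact mul _ _ (hscal z) (hface x)

theorem isCounitalAt (a : AFace K (sigmaWeights D)) : IsCounitalAt (src K (sigmaWeights D))
    (tgt K (sigmaWeights D)) (act (sigmaWeights D)) (comul (sigmaWeights D) F) a := by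
  have h := isLiftedComul (K := K) (sigmaWeights D) F
  induction a using induction with
  | add a b ha hb => exact ha.add hb
  | mul a b ha hb => exact h.isCounitalAt_mul ha hb
  | src f => exact h.isCounitalAt_src f
  | tgt g => exact h.isCounitalAt_tgt g
  | ell a b => exact h.isCounitalAt_mat (isMatCorep_ell D F) a b

theorem isWeakBialgebra :
    IsWeakBialgebra (comul (K := K) (sigmaWeights D) F) (counit (sigmaWeights D) F) :=
  (isLiftedComul _ F).isWeakBialgebra (isCounitalAt D F)

/-- Of all summands of ℓ_cd only the one starting at the two end points is composable. -/
theorem eA_mul_ell (l m : Λ) (a b c d : X) :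
    face K (sigmaWeights D) (HFace.eA K (sigmaQuiver D) (l, a) (m, b)) * ell K D c d =
      face K _ (HFace.eA K (sigmaQuiver D) (l, a) (m, b) *
        HFace.eA K (sigmaQuiver D) (D.deg a l, c) (D.deg b m, d)) := by
  have : face K (sigmaWeights D) (HFace.eA K (sigmaQuiver D) (l, a) (m, b)) =
      face K _ (HFace.eA K (sigmaQuiver D) (l, a) (m, b)) *
        face K (sigmaWeights D) (HFace.eV K (sigmaQuiver D) (D.deg a l) (D.deg b m)) := by
    rw [← map_mul, HFace.eA, HFace.eV, e_mul_vertex]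
    simp [QPath.arrow, QPath.tgt, endpt, sigmaQuiver]
  rw [this, mul_assoc, face_eV_mul_ell, map_mul]

theorem sigmaWeights_apply (ab cd : (sigmaQuiver D).Comp2) : (sigmaWeights D).w ab cd =
    if ab.1.1.1 = cd.1.1.1 then D.σ ab.1.2.2 ab.1.1.2 cd.1.2.2 cd.1.1.2 ab.1.1.1 else 0 := rfl

theorem sum_comp2_single {N : Type*} [AddCommMonoid N] (l : Λ) (f : X → X → N) :
    ∑ xy : (sigmaQuiver D).Comp2, (if xy.1.1.1 = l then f xy.1.1.2 xy.1.2.2 else 0) =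
      ∑ y, ∑ x, f x y := by
  rw [ASigma.sum_comp2_sigma D (fun l' x y => if l' = l then f x y else 0),
    Finset.sum_eq_single l]
  · simp only [if_true]
    exact Finset.sum_comm
  · intro l' _ hl
    simp [hl]
  · simp

/-- The exchange relation for the elements `ℓ_{ab}`. -/
theorem ell_exchange (a b c d : X) :
    ∑ x, ∑ y, src K (sigmaWeights D) (D.σ x y a c) * ell K D y d * ell K D x b =
      ∑ x, ∑ y, tgt K (sigmaWeights D) (MulOpposite.op (D.σ b d x y)) *
        ell K D c y * ell K D a x := by
  have h1 : ∀ (f : Λ → R) (x y z w : X), src K (sigmaWeights D) f * ell K D y z * ell K D x w =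
      ∑ l, ∑ m, scal K _ (f l ⊗ₜ[K] 1) *
        face K _ (HFace.eA K (sigmaQuiver D) (l, y) (m, z) *
          HFace.eA K (sigmaQuiver D) (D.deg y l, x) (D.deg z m, w)) := fun f x y z w => by
    conv_lhs => rw [ell]
    simp only [Finset.mul_sum, Finset.sum_mul, src_mul_eA, mul_assoc, eA_mul_ell]
  have h2 : ∀ (f : Λ → R) (x y z w : X),
      tgt K (sigmaWeights D) (MulOpposite.op f) * ell K D y z * ell K D x w =
      ∑ l, ∑ m, scal K _ (1 ⊗ₜ[K] MulOpposite.op (f m)) *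
        face K _ (HFace.eA K (sigmaQuiver D) (l, y) (m, z) *
          HFace.eA K (sigmaQuiver D) (D.deg y l, x) (D.deg z m, w)) := fun f x y z w => by
    conv_lhs => rw [ell]
    simp only [Finset.mul_sum, Finset.sum_mul, tgt_mul_eA, mul_assoc, eA_mul_ell]
  -- The exchange relation splits over the pairs (l, m) of starting vertices on top and bottom; each
  -- component is one defining relation.
  have key : ∀ l m : Λ, ∑ x, ∑ y, scal K (sigmaWeights D) (D.σ x y a c l ⊗ₜ[K] 1) *
        face K _ (HFace.eA K (sigmaQuiver D) (l, y) (m, d) *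
          HFace.eA K (sigmaQuiver D) (D.deg y l, x) (D.deg d m, b)) =
      ∑ x, ∑ y, scal K (sigmaWeights D) (1 ⊗ₜ[K] MulOpposite.op (D.σ b d x y m)) *
        face K _ (HFace.eA K (sigmaQuiver D) (l, c) (m, y) *
          HFace.eA K (sigmaQuiver D) (D.deg c l, a) (D.deg y m, x)) := fun l m => by
    -- The index pairs are the two composable pairs with arrow labels (c, a) from l and (d, b) from
    -- m. The factor δ_{λ,μ} in w_σ restricts the sums to the same starting vertices.
    have rel := relation (K := K) (sigmaWeights D)
      ⟨((l, c), (D.deg c l, a)), rfl⟩ ⟨((m, d), (D.deg d m, b)), rfl⟩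
    rw [← sum_comp2_single D l (fun x y => scal K (sigmaWeights D) (D.σ y x a c l ⊗ₜ[K] 1) *
        face K _ (HFace.eA K (sigmaQuiver D) (l, x) (m, d) *
          HFace.eA K (sigmaQuiver D) (D.deg x l, y) (D.deg d m, b))),
      ← sum_comp2_single D m (fun x y => scal K (sigmaWeights D)
          (1 ⊗ₜ[K] MulOpposite.op (D.σ b d y x m)) *
        face K _ (HFace.eA K (sigmaQuiver D) (l, c) (m, x) *
          HFace.eA K (sigmaQuiver D) (D.deg c l, a) (D.deg x m, y)))]
    refine Eq.trans (Finset.sum_congr rfl ?_) (rel.trans (Finset.sum_congr rfl ?_))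
    · rintro ⟨⟨⟨l', x⟩, ⟨l'', y⟩⟩, h⟩ _
      dsimp only [sigmaQuiver] at h
      subst h
      rw [sigmaWeights_apply]
      by_cases hl : l' = l
      · subst hl; rw [if_pos rfl, if_pos rfl]
      · rw [if_neg hl, if_neg hl, TensorProduct.zero_tmul, map_zero, zero_mul]
    · rintro ⟨⟨⟨l', x⟩, ⟨l'', y⟩⟩, h⟩ _
      dsimp only [sigmaQuiver] at h
      subst h
      rw [sigmaWeights_apply]
      by_cases hl : l' = m
      · subst hl; rw [if_pos rfl, if_pos rfl]
      · rw [if_neg hl, if_neg (Ne.symm hl), MulOpposite.op_zero, TensorProduct.tmul_zero,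
          map_zero, zero_mul]
  have sw : ∀ f : X → X → Λ → Λ → AFace K (sigmaWeights D),
      ∑ x, ∑ y, ∑ l, ∑ m, f x y l m = ∑ l, ∑ m, ∑ x, ∑ y, f x y l m := fun f => by
    calc _ = ∑ p : X × X, ∑ q : Λ × Λ, f p.1 p.2 q.1 q.2 := by
          simp only [Fintype.sum_prod_type]
      _ = _ := by
          rw [Finset.sum_comm]
          simp only [Fintype.sum_prod_type]
  simp only [h1, h2]
  rw [sw, sw]
  exact Finset.sum_congr rfl fun l _ => Finset.sum_congr rfl fun m _ => key l m

end Sigma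

end AFace

end FaceClosure

end
noncomputable section

namespace FaceClosure

open LQuiver LQuiver.FaceAlg

/-! ### The homomorphism `Φ` and its universal property -/

namespace ASigma

variable {K : Type*} [Field K] {R : Type*} [Ring R] [Algebra K R] {Λ X : Type*}
  [Fintype Λ] [DecidableEq Λ] [Fintype X] [DecidableEq X] (D : SigmaDatum Λ X R)

theorem act_L (a b : X) :
    act D (L K D a b) = if a = b then (shiftEquiv K (D.deg a)).toLinearMap else 0 :=
  actFree_L D a b

theorem act_Linv (a b : X) :
    act D (Linv K D a b) = if a = b then (shift K (D.deg a)⁻¹).toLinearMap else 0 :=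
  actFree_Linv D a b

theorem Phi_mk (z : HFace K R (sigmaQuiver D)) :
    Phi K D (AFace.mk (sigmaWeights D) z) = phiH K D z := rfl

theorem sum_single_one : ∑ v : Λ, (Pi.single v 1 : Λ → R) = 1 := by
  ext l; simp [Finset.sum_apply, Pi.single_apply]

theorem const_mul_single (r : R) (v : Λ) :
    (fun _ => r : Λ → R) * Pi.single v 1 = Pi.single v r := by
  ext l
  by_cases hl : l = v
  · subst hl; simp
  · simp [Pi.single_eq_of_ne hl]

theorem single_mul_const (r : R) (v : Λ) :
    Pi.single v 1 * (fun _ => r : Λ → R) = Pi.single v r := by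
  ext l
  by_cases hl : l = v
  · subst hl; simp
  · simp [Pi.single_eq_of_ne hl]

theorem sum_single_apply (f : Λ → R) : ∑ v : Λ, Pi.single v (f v) = f := by
  ext l; simp [Finset.sum_apply, Pi.single_apply]

/-- Together with the lemmas on t and ℓ, this identifies Φ on generators; they replace the path
formula from here on. -/
theorem Phi_src (f : Λ → R) : Phi K D (AFace.src K (sigmaWeights D) f) = src K D f := by
  have h1 : tgt K D (MulOpposite.op fun _ => (1 : Rᵐᵒᵖ).unop) = 1 := map_one (tgt K D)
  have h2 : ∀ v v', Phi K D (AFace.mk (sigmaWeights D)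
      ((f v ⊗ₜ[K] (1 : Rᵐᵒᵖ)) ⊗ₜ[K] HFace.eV K (sigmaQuiver D) v v')) =
      src K D (Pi.single v (f v)) * tgt K D (MulOpposite.op (Pi.single v' 1)) := fun v v' => by
    rw [Phi_mk, HFace.eV, phiH_apply, h1, mul_one]
    simp only [QPath.vertex, List.zipWith_nil_left, List.prod_nil, mul_one]
    rw [← mul_assoc, ← map_mul, const_mul_single]
  simp only [AFace.src_eq, map_sum, h2]
  simp only [← Finset.mul_sum, ← Finset.sum_mul, ← map_sum, ← Finset.op_sum, sum_single_one,
    sum_single_apply]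
  simp

theorem Phi_tgt (g : Λ → R) : Phi K D (AFace.tgt K (sigmaWeights D) (MulOpposite.op g)) =
    tgt K D (MulOpposite.op g) := by
  have h1 : src K D (fun _ => (1 : R)) = 1 := map_one (src K D)
  have h2 : ∀ v v', Phi K D (AFace.mk (sigmaWeights D)
      (((1 : R) ⊗ₜ[K] MulOpposite.op (g v)) ⊗ₜ[K] HFace.eV K (sigmaQuiver D) v' v)) =
      src K D (Pi.single v' 1) * tgt K D (MulOpposite.op (Pi.single v (g v))) := fun v v' => by
    rw [Phi_mk, HFace.eV, phiH_apply, h1, one_mul]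
    simp only [QPath.vertex, List.zipWith_nil_left, List.prod_nil, mul_one]
    rw [← mul_assoc, ← src_tgt_comm, mul_assoc, ← map_mul, ← MulOpposite.op_mul,
      MulOpposite.unop_op, single_mul_const]
  simp only [AFace.tgt_eq, map_sum, MulOpposite.unop_op, h2]
  simp only [← Finset.mul_sum, ← Finset.sum_mul, ← map_sum, ← Finset.op_sum, sum_single_one,
    sum_single_apply]
  simp

theorem Phi_ell (a b : X) : Phi K D (AFace.ell K D a b) = L K D a b := by
  have h : ∀ l m, Phi K D (AFace.face K (sigmaWeights D)
      (HFace.eA K (sigmaQuiver D) (l, a) (m, b))) = dd K D l m * L K D a b := fun l m => by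
    change phiH K D (1 ⊗ₜ[K] _) = _
    rw [phiH, Algebra.TensorProduct.lift_tmul, map_one, one_mul, HFace.eA, phiFace, algHom_e,
      phiBasis]
    simp [QPath.arrow, prodL, sigmaQuiver]
  simp only [AFace.ell, map_sum, h, ← Finset.sum_mul, sum_dd, one_mul]

/-- Both actions agree on generators. As the counits are ψ(χ(·)(1)), this gives compatibility of Φ
with them. -/
theorem act_Phi (a : AFace K (sigmaWeights D)) :
    act D (Phi K D a) = AFace.act (sigmaWeights D) a := by
  induction a using AFace.induction with
  | add a b ha hb => simp only [map_add, ha, hb]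
  | mul a b ha hb => simp only [map_mul, ha, hb]
  | src f => rw [Phi_src, act_src, AFace.act_src]
  | tgt g => rw [Phi_tgt, act_tgt, AFace.act_tgt]
  | ell a b => rw [Phi_ell, act_L, AFace.act_ell]

variable (F : FrobeniusSystem K R)

/-- Two multiplicative maps from `𝔄(w_σ)` to `A_σ ⊗ A_σ` agree: `Φ` is comultiplicative. -/
theorem comul_Phi (a : AFace K (sigmaWeights D)) : comul D F (Phi K D a) =
    Algebra.TensorProduct.map (Phi K D) (Phi K D) (AFace.comul (sigmaWeights D) F a) := by
  have h := isLiftedComul (K := K) D F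
  have h' := AFace.isLiftedComul (K := K) (sigmaWeights D) F
  have hE : Algebra.TensorProduct.map (Phi K D) (Phi K D)
      ((F.pi Λ).unitElt (AFace.src K (sigmaWeights D)) (AFace.tgt K (sigmaWeights D))) =
      (F.pi Λ).unitElt (src K D) (tgt K D) := by
    simp only [FrobeniusSystem.unitElt_eq, map_sum, Algebra.TensorProduct.map_tmul, Phi_src,
      Phi_tgt]
  induction a using AFace.induction with
  | add a b ha hb => simp only [map_add, ha, hb]
  | mul a b ha hb => rw [map_mul, h.comul_mul, h'.comul_mul, map_mul, ha, hb]
  | src f => rw [Phi_src, h.comul_src, h'.comul_src, map_mul, hE]; simp [Phi_src]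
  | tgt g => rw [Phi_tgt, h.comul_tgt, h'.comul_tgt, map_mul, hE]; simp [Phi_tgt]
  | ell a b =>
    rw [Phi_ell, (isMatCorep_L D F).comul, (AFace.isMatCorep_ell D F).comul, map_mul, hE]
    simp [Phi_ell]

theorem isWeakBialgHom_Phi : IsWeakBialgHom (AFace.comul (sigmaWeights D) F)
    (AFace.counit (sigmaWeights D) F) (comul D F) (counit D F) (Phi K D) where
  comul := comul_Phi D F
  counit a := by
    rw [counit_eq, AFace.counit_eq]
    simp only [LinearMap.comp_apply, AlgHom.toLinearMap_apply, act_Phi]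

/-! ### The universal property -/

section Universal

variable {A : Type*} [Ring A] [Algebra K A] {fp : AFace K (sigmaWeights D) →ₐ[K] A}
  {fm : AFace K (sigmaWeights D) →ₗ[K] A}

/-- The restriction of `f⁺` to `M ⊗ Mᵒᵖ`. -/
def baseHom (fp : AFace K (sigmaWeights D) →ₐ[K] A) : (Λ → R) ⊗[K] (Λ → R)ᵐᵒᵖ →ₐ[K] A :=
  Algebra.TensorProduct.lift (fp.comp (AFace.src K (sigmaWeights D)))
    (fp.comp (AFace.tgt K (sigmaWeights D))) (fun f g => by
      change _ * _ = _ * _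
      simp only [AlgHom.comp_apply, ← map_mul, AFace.src_tgt_comm])

theorem baseHom_inl (f : Λ → R) :
    baseHom D fp (inl K f) = fp (AFace.src K (sigmaWeights D) f) := by
  simp [baseHom, inl]

theorem baseHom_inr (g : Λ → R) :
    baseHom D fp (inr K g) = fp (AFace.tgt K (sigmaWeights D) (MulOpposite.op g)) := by
  simp [baseHom, inr]

/-- The exchange relation and the rules for L already hold in 𝔄(w_σ), so f⁺ transports them. The
antipode supplies the inverse matrix f⁻(ℓ), and its commutation rules follow formally from those of
f⁺(ℓ). -/
theorem baseHom_compatible (hf : IsAntipodeOf (AFace.comul (sigmaWeights D) F)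
    (AFace.counit (sigmaWeights D) F) fp fm) : Compatible D (baseHom D fp)
      (fun a b => fp (AFace.ell K D a b)) (fun a b => fm (AFace.ell K D a b)) := by
  have hl := AFace.isLiftedComul (K := K) (sigmaWeights D) F
  have hM := AFace.isMatCorep_ell (K := K) D F
  have hτ : ∀ (a : X) (l : Λ → R), (F.pi Λ).ψ (shiftEquiv K (D.deg a) l) = (F.pi Λ).ψ l :=
    fun a => F.pi_form_shiftEquiv _
  have hPN := IsAntipodeOf.sum_pos_neg hl (AFace.isCounitalAt D F) hf hM hτ
  have hNP := IsAntipodeOf.sum_neg_pos hl (AFace.isCounitalAt D F) hf hM hτ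
  refine ⟨hPN, hNP, fun f a b => ?_, fun f a b => ?_, fun f a b => ?_, fun f a b => ?_,
    fun a b c d => ?_⟩
  · rw [baseHom_inl, baseHom_inl, ← map_mul, ← map_mul, hM.mul_src]
    rfl
  · rw [baseHom_inr, baseHom_inr, ← map_mul, ← map_mul, hM.mul_tgt]
    rfl
  · simp only [baseHom_inl]
    refine intertwine_inverse hPN hNP
      (p := fun _ => fp (AFace.src K (sigmaWeights D) f))
      (q := fun b => fp (AFace.src K (sigmaWeights D) (shift K (D.deg b) f)))
      (fun a b => ?_) a b
    rw [← map_mul, ← map_mul, hM.mul_src]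
    rfl
  · simp only [baseHom_inr]
    -- The twist of ℓ past t depends on the column, so T_deg(a)(f) is fixed on one side and p_c is
    -- chosen to be twisted back by deg(c). At c = a the shifts cancel and leave f.
    have := intertwine_inverse hPN hNP
      (p := fun c => fp (AFace.tgt K (sigmaWeights D)
        (MulOpposite.op ((shiftEquiv K (D.deg c)).symm (shift K (D.deg a) f)))))
      (q := fun _ => fp (AFace.tgt K (sigmaWeights D) (MulOpposite.op (shift K (D.deg a) f))))
      (fun a b => by rw [← map_mul, ← map_mul, hM.mul_tgt, AlgEquiv.apply_symm_apply]) a b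
    rwa [← shiftEquiv_apply, AlgEquiv.symm_apply_apply] at this
  · simp only [baseHom_inl, baseHom_inr, ← map_mul, ← map_sum, AFace.ell_exchange]

variable {D} in
theorem comp_Phi_src {G : ASigma K D →ₐ[K] A} (hG : G.comp (Phi K D) = fp) (f : Λ → R) :
    G (src K D f) = fp (AFace.src K (sigmaWeights D) f) := by
  rw [← hG, AlgHom.comp_apply, Phi_src]

variable {D} in
theorem comp_Phi_tgt {G : ASigma K D →ₐ[K] A} (hG : G.comp (Phi K D) = fp) (g : Λ → R) :
    G (tgt K D (MulOpposite.op g)) =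
      fp (AFace.tgt K (sigmaWeights D) (MulOpposite.op g)) := by
  rw [← hG, AlgHom.comp_apply, Phi_tgt]

variable {D} in
theorem comp_Phi_L {G : ASigma K D →ₐ[K] A} (hG : G.comp (Phi K D) = fp) (a b : X) :
    G (L K D a b) = fp (AFace.ell K D a b) := by
  rw [← hG, AlgHom.comp_apply, Phi_ell]

theorem map_L_mul_Linv (G : ASigma K D →ₐ[K] A) (a b : X) :
    ∑ c, G (L K D a c) * G (Linv K D c b) = if a = b then 1 else 0 := by
  simp only [← map_mul, ← map_sum, L_mul_Linv, apply_ite G, map_one, map_zero]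

theorem map_Linv_mul_L (G : ASigma K D →ₐ[K] A) (a b : X) :
    ∑ c, G (Linv K D a c) * G (L K D c b) = if a = b then 1 else 0 := by
  simp only [← map_mul, ← map_sum, Linv_mul_L, apply_ite G, map_one, map_zero]

/-- Algebra maps on `A_σ` are determined by their composition with `Φ`. -/
theorem Phi_epi {G G' : ASigma K D →ₐ[K] A} (h : G.comp (Phi K D) = G'.comp (Phi K D)) :
    G = G' := by
  have hL : ∀ a b, G (L K D a b) = G' (L K D a b) := fun a b => by
    rw [comp_Phi_L h, AlgHom.comp_apply, Phi_ell]
  ext a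
  induction a using induction with
  | add a b ha hb => simp only [map_add, ha, hb]
  | mul a b ha hb => simp only [map_mul, ha, hb]
  | src f => rw [comp_Phi_src h, AlgHom.comp_apply, Phi_src]
  | tgt g => rw [comp_Phi_tgt h, AlgHom.comp_apply, Phi_tgt]
  | L a b => exact hL a b
  | Linv a b =>
    refine inverse_unique (M := fun a b => G (L K D a b)) (N := fun a b => G (Linv K D a b))
      (N' := fun a b => G' (Linv K D a b)) (map_Linv_mul_L D G) (fun a b => ?_) a b
    simp only [hL]
    exact map_L_mul_Linv D G' a b

theorem existsUnique_lift (hf : IsAntipodeOf (AFace.comul (sigmaWeights D) F)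
    (AFace.counit (sigmaWeights D) F) fp fm) :
    ∃! G : ASigma K D →ₐ[K] A, G.comp (Phi K D) = fp := by
  have hc := baseHom_compatible D F hf
  have hG : (lift hc).comp (Phi K D) = fp := by
    ext a
    rw [AlgHom.comp_apply]
    induction a using AFace.induction with
    | add a b ha hb => simp only [map_add, ha, hb]
    | mul a b ha hb => simp only [map_mul, ha, hb]
    | src f => rw [Phi_src, lift_src, baseHom_inl]
    | tgt g => rw [Phi_tgt, lift_tgt, baseHom_inr]
    | ell a b => rw [Phi_ell, lift_L]
  exact ⟨lift hc, hG, fun G' hG' => Phi_epi D (hG'.trans hG.symm)⟩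

variable {ΔA : A →ₗ[K] A ⊗[K] A} {εA : A →ₗ[K] K}

/-- Both composites are multiplicative, agree on the image of Φ, and in particular have the same
value at 1. The images of L⁻¹ are thus inverse to the same matrix relative to the common idempotent
Δ_A(1), which forces them to be equal. -/
theorem comul_comp (hA : IsWeakBialgebra ΔA εA)
    (hfp : IsWeakBialgHom (AFace.comul (sigmaWeights D) F) (AFace.counit (sigmaWeights D) F)
      ΔA εA fp) {G : ASigma K D →ₐ[K] A} (hG : G.comp (Phi K D) = fp) (a : ASigma K D) :
    ΔA (G a) = Algebra.TensorProduct.map G G (comul D F a) := by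
  have h := isLiftedComul (K := K) D F
  have onPhi : ∀ a, ΔA (G (Phi K D a)) =
      Algebra.TensorProduct.map G G (comul D F (Phi K D a)) := fun a => by
    have : G (Phi K D a) = fp a := by rw [← hG]; rfl
    rw [this, comul_Phi, ← AlgHom.comp_apply, ← Algebra.TensorProduct.map_comp, hG]
    exact hfp.comul a
  have hL : ∀ a b, ΔA (G (L K D a b)) = Algebra.TensorProduct.map G G (comul D F (L K D a b)) :=
    fun a b => by rw [← Phi_ell, onPhi]
  have hone : ΔA 1 = Algebra.TensorProduct.map G G (comul D F 1) := by
    have := onPhi 1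
    rwa [map_one, map_one] at this
  induction a using induction with
  | add a b ha hb => simp only [map_add, ha, hb]
  | mul a b ha hb => rw [map_mul, hA.comul_mul, h.comul_mul, map_mul, ha, hb]
  | src f => rw [← Phi_src, onPhi]
  | tgt g => rw [← Phi_tgt, onPhi]
  | L a b => exact hL a b
  | Linv a b =>
    set T := Algebra.TensorProduct.map G G
    have h1 : ∀ a b, ∑ c, ΔA (G (Linv K D a c)) * ΔA (G (L K D c b)) =
        if a = b then ΔA 1 else 0 := fun a b => by
      simp only [← hA.comul_mul, ← map_sum, map_Linv_mul_L, apply_ite ΔA, map_zero]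
    have h2 : ∀ a b, ∑ c, T (comul D F (L K D a c)) * T (comul D F (Linv K D c b)) =
        if a = b then ΔA 1 else 0 := fun a b => by
      simp only [← map_mul, ← h.comul_mul, ← map_sum, L_mul_Linv, hone]
      split_ifs <;> simp
    -- The computation N = N(MN') = (NM)N' = N', with Δ_A(1) in place of the unit.
    calc ΔA (G (Linv K D a b))
        = ∑ c, ΔA (G (Linv K D a c)) * if c = b then ΔA 1 else 0 := by
          simp [← hA.comul_mul]
      _ = ∑ d, (if a = d then ΔA 1 else 0) * T (comul D F (Linv K D d b)) := by
          simp_rw [← fun c => h2 c b, ← h1 a, Finset.mul_sum, Finset.sum_mul, hL, mul_assoc]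
          rw [Finset.sum_comm]
      _ = T (comul D F (Linv K D a b)) := by
          simp only [ite_mul, zero_mul, Finset.sum_ite_eq, Finset.mem_univ, if_true]
          rw [hone, ← map_mul, ← h.comul_mul, one_mul]

/-- Multiplicativity is not available for counits, so the values on L⁻¹ must be extracted from the
weak bialgebra axioms of A. They are then propagated to products by replacing k t(l) with t(χ(k)(l))
under the counit. -/
theorem counit_comp (hA : IsWeakBialgebra ΔA εA)
    (hfp : IsWeakBialgHom (AFace.comul (sigmaWeights D) F) (AFace.counit (sigmaWeights D) F)
      ΔA εA fp) {G : ASigma K D →ₐ[K] A} (hG : G.comp (Phi K D) = fp) (a : ASigma K D) :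
    εA (G a) = counit D F a := by
  have h := isLiftedComul (K := K) D F
  have hΔ := comul_comp D F hA hfp hG
  set FF := F.pi Λ with hFF
  have onPhi : ∀ a, εA (G (Phi K D a)) = FF.ψ (act D (Phi K D a) 1) := fun a => by
    have : G (Phi K D a) = fp a := by rw [← hG]; rfl
    rw [this, hfp.counit, act_Phi]
    rfl
  have onTgt : ∀ g, εA (G (tgt K D (MulOpposite.op g))) = FF.ψ g := fun g => by
    rw [← Phi_tgt, onPhi, Phi_tgt, act_tgt]
    simp
  -- The values ψ(l g) can be read off after applying G, so nondegeneracy of ψ makes G ∘ t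
  -- injective.
  have onTgtInj : ∀ g g', G (tgt K D (MulOpposite.op g)) = G (tgt K D (MulOpposite.op g')) →
      g = g' := fun g g' hg => FF.ext_right fun l => by
    rw [← onTgt, ← onTgt, MulOpposite.op_mul, MulOpposite.op_mul, map_mul (tgt K D),
      map_mul (tgt K D), map_mul G, map_mul G, hg]
  -- The axiom ε(x 1₍₁₎) ε(1₍₂₎ y) = ε(x y) in A, with Δ_A(1) equal to the image of E.
  have weak : ∀ x y, εA (G (x * y)) = ∑ i, εA (G (x * tgt K D (MulOpposite.op (FF.x i)))) *
      εA (G (src K D (FF.y i) * y)) := fun x y => by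
    have := hA.counit_mul (G x) 1 (G y)
    rw [mul_one, ← map_mul, ← map_one G, hΔ, h.comul_one, FrobeniusSystem.unitElt_eq] at this
    rw [← this]
    simp
  -- If k pairs with the image of s as the counit of A_σ predicts, then by the previous identity and
  -- the dual bases k may be replaced by t(χ(k)(1)) at the right end.
  have absorb : ∀ k, (∀ l, εA (G (src K D l * k)) = FF.ψ (l * act D k 1)) → ∀ x,
      εA (G (x * k)) = εA (G (x * tgt K D (MulOpposite.op (act D k 1)))) := fun k hk x => by
    rw [weak x k]
    conv_rhs => rw [← FF.sum_right (act D k 1)]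
    simp only [hk, Finset.op_sum, MulOpposite.op_smul, map_sum, map_smul, Finset.mul_sum,
      mul_smul_comm, smul_eq_mul, mul_comm]
  have absorbPhi : ∀ a x, εA (G (x * Phi K D a)) =
      εA (G (x * tgt K D (MulOpposite.op (act D (Phi K D a) 1)))) := fun a x =>
    absorb _ (fun l => by
      rw [← Phi_src, ← map_mul, onPhi, map_mul, map_mul, Phi_src, act_src]
      rfl) x
  have onLinv : ∀ (a b : X) (l : Λ → R), εA (G (src K D l * Linv K D a b)) =
      if a = b then FF.ψ l else 0 := fun a b l => by
    -- The element r_c represents the unknown functional: its value at l is ψ(l r_c). The goal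
    -- becomes r_b = δ_ab.
    let r : X → Λ → R := fun c => ∑ i, εA (G (src K D (FF.y i) * Linv K D a c)) • FF.x i
    -- The right counit axiom in A for the image of (L⁻¹)_ab, written out with Δ((L⁻¹)_ab) = E · ∑_c
    -- (L⁻¹)_cb ⊗ (L⁻¹)_ac.
    have hr : ∀ b, ∑ c, G (tgt K D (MulOpposite.op (r c))) * G (Linv K D c b) =
        G (Linv K D a b) := fun b => by
      have := hA.counit_right (G (Linv K D a b))
      rw [hΔ, (isMatCorep_Linv D F).comul b a, FrobeniusSystem.unitElt_eq, ← hFF,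
        Finset.sum_mul_sum] at this
      conv_rhs => rw [← this]
      simp only [r, map_sum, Algebra.TensorProduct.tmul_mul_tmul,
        Algebra.TensorProduct.map_tmul, LinearMap.lTensor_tmul, TensorProduct.rid_tmul,
        Finset.op_sum, MulOpposite.op_smul, map_smul, Finset.sum_mul, smul_mul_assoc]
      simp only [map_mul G]
      exact Finset.sum_comm
    -- Cancel L⁻¹ in that identity by multiplying with L on the right, then use injectivity of G ∘
    -- t.
    have hrb : r b = if a = b then 1 else 0 := by
      apply onTgtInj
      calc G (tgt K D (MulOpposite.op (r b)))
          = ∑ c, ∑ d, G (tgt K D (MulOpposite.op (r c))) * G (Linv K D c d) * G (L K D d b) := by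
            simp only [mul_assoc, ← Finset.mul_sum, map_Linv_mul_L]
            simp
        _ = ∑ d, G (Linv K D a d) * G (L K D d b) := by
            rw [Finset.sum_comm]
            simp only [← Finset.sum_mul, hr]
        _ = _ := by
            rw [map_Linv_mul_L]
            split_ifs <;> simp
    have : εA (G (src K D l * Linv K D a b)) = FF.ψ (l * r b) := by
      conv_lhs => rw [← FF.sum_left l]
      simp only [r, map_sum, map_smul, Finset.sum_mul, Finset.mul_sum, smul_mul_assoc,
        mul_smul_comm, smul_eq_mul, mul_comm]
    rw [this, hrb]
    split_ifs <;> simp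
  -- Keeping x and l arbitrary makes the statement stable under products: b is absorbed into l first
  -- and a into the result. The counit identity is the case x = 1, l = 1.
  have main : ∀ k x l, εA (G (x * k * tgt K D (MulOpposite.op l))) =
      εA (G (x * tgt K D (MulOpposite.op (act D k l)))) := fun k => by
    induction k using induction with
    | add a b ha hb =>
      intro x l
      simp only [mul_add, add_mul, map_add, ha, hb, LinearMap.add_apply, MulOpposite.op_add]
    | mul a b ha hb =>
      intro x l
      rw [← mul_assoc x, hb, ha, map_mul (act D)]
      rfl
    | src f =>
      intro x l
      have := absorbPhi (AFace.src K _ f * AFace.tgt K _ (MulOpposite.op l)) x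
      simpa [Phi_src, Phi_tgt, act_src, act_tgt, mul_assoc] using this
    | tgt g =>
      intro x l
      rw [mul_assoc, ← map_mul, ← MulOpposite.op_mul, act_tgt]
      rfl
    | L a b =>
      intro x l
      have := absorbPhi (AFace.ell K D a b * AFace.tgt K _ (MulOpposite.op l)) x
      simpa [Phi_ell, Phi_tgt, act_tgt, mul_assoc] using this
    | Linv a b =>
      intro x l
      have h1 : act D (Linv K D a b) 1 = if a = b then 1 else 0 := by
        rw [act_Linv]
        split_ifs <;> simp
      have h2 := absorb (Linv K D a b) (fun l => by
        rw [onLinv, h1]; split_ifs <;> simp)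
      rw [mul_assoc, Linv_mul_tgt, ← mul_assoc, h2, h1, act_Linv]
      split_ifs <;> simp
  have := main a 1 1
  rw [MulOpposite.op_one, map_one, one_mul, mul_one, one_mul, onTgt] at this
  rw [this]
  rfl

theorem isWeakBialgHom_comp (hA : IsWeakBialgebra ΔA εA)
    (hfp : IsWeakBialgHom (AFace.comul (sigmaWeights D) F) (AFace.counit (sigmaWeights D) F)
      ΔA εA fp) {G : ASigma K D →ₐ[K] A} (hG : G.comp (Phi K D) = fp) :
    IsWeakBialgHom (comul D F) (counit D F) ΔA εA G :=
  ⟨comul_comp D F hA hfp hG, counit_comp D F hA hfp hG⟩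

end Universal

end ASigma

end FaceClosure

end

theorem mainTheorem3 {K : Type*} [Field K] {R : Type*} [Ring R] [Algebra K R]
    {Λ X : Type*} [Fintype Λ] [DecidableEq Λ] [Nonempty Λ] [Fintype X] [DecidableEq X]
    (D : SigmaDatum Λ X R) (F : FrobeniusSystem K R) (hrigid : ASigma.IsRigid K D) :
    -- `𝔄(w_σ)` is a weak bialgebra
    IsWeakBialgebra (AFace.comul (sigmaWeights D) F) (AFace.counit (sigmaWeights D) F) ∧
    -- `A_σ` is a weak Hopf algebra
    IsWeakBialgebra (ASigma.comul D F) (ASigma.counit D F) ∧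
    (∃ S : ASigma K D →ₗ[K] ASigma K D,
      IsWeakHopfAntipode (ASigma.comul D F) (ASigma.counit D F) S) ∧
    -- `Φ` is a weak bialgebra homomorphism
    IsWeakBialgHom (AFace.comul (sigmaWeights D) F) (AFace.counit (sigmaWeights D) F)
      (ASigma.comul D F) (ASigma.counit D F) (ASigma.Phi K D) ∧
    -- the universal property
    ∀ (A : Type*) [Ring A] [Algebra K A] (fp : AFace K (sigmaWeights D) →ₐ[K] A)
      (fm : AFace K (sigmaWeights D) →ₗ[K] A),
      IsAntipodeOf (AFace.comul (sigmaWeights D) F) (AFace.counit (sigmaWeights D) F) fp fm →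
      (∃! G : ASigma K D →ₐ[K] A, G.comp (ASigma.Phi K D) = fp) ∧
      ∀ (ΔA : A →ₗ[K] A ⊗[K] A) (εA : A →ₗ[K] K), IsWeakBialgebra ΔA εA →
        IsWeakBialgHom (AFace.comul (sigmaWeights D) F) (AFace.counit (sigmaWeights D) F)
          ΔA εA fp →
        ∀ G : ASigma K D →ₐ[K] A, G.comp (ASigma.Phi K D) = fp →
          IsWeakBialgHom (ASigma.comul D F) (ASigma.counit D F) ΔA εA G := by
  refine ⟨AFace.isWeakBialgebra D F, ASigma.isWeakBialgebra D F, ASigma.exists_antipode D F hrigid,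
    ASigma.isWeakBialgHom_Phi D F, fun A _ _ fp fm hf => ⟨ASigma.existsUnique_lift D F hf,
      fun ΔA εA hA hfp G hG => ASigma.isWeakBialgHom_comp D F hA hfp hG⟩⟩
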